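/- Let $(M,g)$ be a $3$-dimensional Lorentzian manifold (smooth, without boundary, Hausdorff, second countable, signature $(-,+,+)$) and let $\zeta$ be a complete timelike Killing vector field on $M$. Suppose that: 1. $(M,g)$ is chronological, i.e. there are no closed timelike curves; 2. for every $p\in M$ and every timelike plane $\Pi\subset T_pM$ containing $\zeta_p$, the sectional curvature satisfies $K(\Pi)\ge 0$, where $K(\mathrm{span}(u,v))=\dfrac{g(R(u,v)v,u)}{g(u,u)g(v,v)-g(u,v)^2}$ and $R(X,Y)Z=\nabla_X\nabla_YZ-\nabla_Y\nabla_XZ-\nabla_{[X,Y]}Z$; 3. $(M,g)$ is null complete and spacelike complete, i.e. every maximal null geodesic and every maximal spacelike geodesic is defined on all of $\mathbb{R}$. Let $i:L\hookrightarrow M$ be a connected, smoothly embedded, topologically closed surface that is null (the form $i^*g$ is degenerate at every point of $L$) and totally geodesic ($\nabla_UV$ is tangent to $L$ for all vector fields $U,V$ tangent to $L$). Let $\widetilde g=i^*(g+\alpha\otimes\alpha)$, with $\alpha=g(\zeta,\cdot)$, be the rigged metric on $L$ constructed from $\zeta$. Then $\widetilde g$ is a Riemannian metric on $L$, $(L,\widetilde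 g)$ is (geodesically) complete, and the universal covering of $L$, with the lifted metric, is isometric to $\mathbb{R}^2$ with the Euclidean metric; that is, there is a smooth covering map $\pi:\mathbb{R}^2\to L$ for which $\pi^*\widetilde g$ is the Euclidean metric. -/

import Mathlib

open Set Function Bundle
open scoped Manifold ContDiff Topology

noncomputable section LorentzSurface

/-! Manifolds are modelled on a finite-dimensional normed space `E` (without boundary). -/

section General

variable {E : Type*} [NormedAddCommGroup E] [NormedSpace ℝ E]
  {M : Type*} [TopologicalSpace M] [ChartedSpace E M]

/-- A field of bilinear forms on the tangent spaces (no regularity or symmetry yet). -/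
abbrev BilinField (E : Type*) [NormedAddCommGroup E] [NormedSpace ℝ E]
    (M : Type*) [TopologicalSpace M] [ChartedSpace E M] : Type _ :=
  ∀ x : M, TangentSpace 𝓘(ℝ, E) x →L[ℝ] TangentSpace 𝓘(ℝ, E) x →L[ℝ] ℝ

/-- Vector fields (no regularity yet). -/
abbrev VField (E : Type*) [NormedAddCommGroup E] [NormedSpace ℝ E]
    (M : Type*) [TopologicalSpace M] [ChartedSpace E M] : Type _ :=
  ∀ x : M, TangentSpace 𝓘(ℝ, E) x

/-- A smooth vector field. -/
def IsSmoothField [IsManifold 𝓘(ℝ, E) ∞ M] (X : VField E M) : Prop :=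
  ContMDiff 𝓘(ℝ, E) 𝓘(ℝ, E).tangent ∞ (fun x => (⟨x, X x⟩ : TangentBundle 𝓘(ℝ, E) M))

/-- A smooth Lorentzian metric of signature `(-,+,…,+)`: each form has a timelike vector whose
orthogonal complement is positive definite. -/
structure IsLorentzianMetric [IsManifold 𝓘(ℝ, E) ∞ M] (g : BilinField E M) : Prop where
  symm : ∀ (x : M) (u v : TangentSpace 𝓘(ℝ, E) x), g x u v = g x v u
  index_one : ∀ x : M, ∃ v : TangentSpace 𝓘(ℝ, E) x, g x v v < 0 ∧
    ∀ w : TangentSpace 𝓘(ℝ, E) x, w ≠ 0 → g x v w = 0 → 0 < g x w w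
  contMDiff : ContMDiff 𝓘(ℝ, E) (𝓘(ℝ, E).prod 𝓘(ℝ, E →L[ℝ] E →L[ℝ] ℝ)) ∞
    (fun x => TotalSpace.mk' (E →L[ℝ] E →L[ℝ] ℝ)
      (E := fun x : M => TangentSpace 𝓘(ℝ, E) x →L[ℝ] TangentSpace 𝓘(ℝ, E) x →L[ℝ] ℝ) x (g x))

/-- The coordinate expression `y ↦ (g_ij(y))` of `g` in the chart `e`, as a function on `E` with
values in the bilinear forms on `E` (meaningful on `e.target`). -/
def coordMetric (g : BilinField E M) (e : OpenPartialHomeomorph M E) (y : E) :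
    E →L[ℝ] E →L[ℝ] ℝ :=
  let A : E →L[ℝ] TangentSpace 𝓘(ℝ, E) (e.symm y) := mfderiv 𝓘(ℝ, E) 𝓘(ℝ, E) e.symm y
  (ContinuousLinearMap.precomp ℝ A).comp ((g (e.symm y)).comp A)

/-- Christoffel symbols of the first kind of a metric `G` on (an open subset of) `E`: the linear form
`w ↦ ½ (∂_u G(v,w) + ∂_v G(u,w) - ∂_w G(u,v))`. -/
def christoffelFirst (G : E → E →L[ℝ] E →L[ℝ] ℝ) (y u v : E) : E →L[ℝ] ℝ :=
  (1 / 2 : ℝ) • (fderiv ℝ G y u v + fderiv ℝ G y v u - ((fderiv ℝ G y).flip u).flip v)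

/-- Christoffel symbols of the second kind: the vector `Γ(u,v)` with
`G(Γ(u,v), w) = ½ (∂_u G(v,w) + ∂_v G(u,w) - ∂_w G(u,v))` for all `w`. -/
def christoffel (G : E → E →L[ℝ] E →L[ℝ] ℝ) (y u v : E) : E :=
  (G y).inverse (christoffelFirst G y u v)

/-- The Riemann tensor of a metric `G` on (an open subset of) `E`:
`R(u,v)w = ∇_u ∇_v w - ∇_v ∇_u w` for constant vector fields `u`, `v`, `w`. -/
def coordRiemann (G : E → E →L[ℝ] E →L[ℝ] ℝ) (y u v w : E) : E :=
  fderiv ℝ (fun z => christoffel G z v w) y u - fderiv ℝ (fun z => christoffel G z u w) y v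
    + christoffel G y u (christoffel G y v w) - christoffel G y v (christoffel G y u w)

/-- The `(0,4)` curvature `g(R(u,v)v,u)` at `p`, computed in the chart at `p`. -/
def curvatureForm (g : BilinField E M) (p : M) (u v : TangentSpace 𝓘(ℝ, E) p) : ℝ :=
  let e := chartAt E p
  let G := coordMetric g e
  let u' : E := mfderiv 𝓘(ℝ, E) 𝓘(ℝ, E) e p u
  let v' : E := mfderiv 𝓘(ℝ, E) 𝓘(ℝ, E) e p v
  G (e p) (coordRiemann G (e p) u' v' v') u'

/-- The sectional curvature `K = g(R(u,v)v,u) / (g(u,u) g(v,v) - g(u,v)²)` of the (nondegenerate)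
plane spanned by `u` and `v`. -/
def sectionalCurvature (g : BilinField E M) (p : M) (u v : TangentSpace 𝓘(ℝ, E) p) : ℝ :=
  curvatureForm g p u v / (g p u u * g p v v - g p u v ^ 2)

/-- The Levi-Civita derivative `∇_v Y` at `p` of a vector field `Y`, computed in the chart at `p`. -/
def covDeriv (g : BilinField E M) (Y : VField E M) (p : M) (v : TangentSpace 𝓘(ℝ, E) p) :
    TangentSpace 𝓘(ℝ, E) p :=
  let e := chartAt E p
  let Y' : E → E := fun y => mfderiv 𝓘(ℝ, E) 𝓘(ℝ, E) e (e.symm y) (Y (e.symm y))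
  let v' : E := mfderiv 𝓘(ℝ, E) 𝓘(ℝ, E) e p v
  (mfderiv 𝓘(ℝ, E) 𝓘(ℝ, E) e p).inverse
    (fderiv ℝ Y' (e p) v' + christoffel (coordMetric g e) (e p) v' (Y' (e p)))

/-- The velocity of a curve, as an element of the tangent bundle. -/
def velocity (γ : ℝ → M) (t : ℝ) : TangentBundle 𝓘(ℝ, E) M :=
  ⟨γ t, mfderiv 𝓘(ℝ, ℝ) 𝓘(ℝ, E) γ t (1 : ℝ)⟩

/-- `γ : ℝ → M` is a geodesic of `g`, defined on the whole real line: in every chart of the atlas it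
solves `c'' + Γ(c',c') = 0`. -/
def IsGeodesic (g : BilinField E M) (γ : ℝ → M) : Prop :=
  ContMDiff 𝓘(ℝ, ℝ) 𝓘(ℝ, E) ∞ γ ∧
    ∀ e ∈ atlas E M, ∀ t : ℝ, γ t ∈ e.source →
      deriv (deriv (fun s => e (γ s))) t +
        christoffel (coordMetric g e) (e (γ t)) (deriv (fun s => e (γ s)) t)
          (deriv (fun s => e (γ s)) t) = 0

/-- The tangent vector `v` at `p` is the initial velocity of a geodesic defined on all of `ℝ`, that
is, the maximal geodesic with initial velocity `v` is complete. -/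
def HasCompleteGeodesic (g : BilinField E M) (p : M) (v : TangentSpace 𝓘(ℝ, E) p) : Prop :=
  ∃ γ : ℝ → M, IsGeodesic g γ ∧ velocity (E := E) γ 0 = ⟨p, v⟩

/-- All geodesics are complete. -/
def IsGeodesicallyComplete (g : BilinField E M) : Prop :=
  ∀ (p : M) (v : TangentSpace 𝓘(ℝ, E) p), HasCompleteGeodesic g p v

/-- All null (lightlike) geodesics are complete. -/
def IsNullComplete (g : BilinField E M) : Prop :=
  ∀ (p : M) (v : TangentSpace 𝓘(ℝ, E) p), v ≠ 0 → g p v v = 0 → HasCompleteGeodesic g p v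

/-- All spacelike geodesics are complete. -/
def IsSpacelikeComplete (g : BilinField E M) : Prop :=
  ∀ (p : M) (v : TangentSpace 𝓘(ℝ, E) p), 0 < g p v v → HasCompleteGeodesic g p v

/-- `Z` is timelike everywhere. -/
def IsTimelikeField (g : BilinField E M) (Z : VField E M) : Prop :=
  ∀ x : M, g x (Z x) (Z x) < 0

/-- `Z` is a (smooth) Killing field: `L_Z g = 0`, that is,
`Z (g(X,Y)) = g([Z,X],Y) + g(X,[Z,Y])` for all smooth vector fields `X`, `Y`. -/
def IsKillingField [IsManifold 𝓘(ℝ, E) ∞ M] (g : BilinField E M) (Z : VField E M) : Prop :=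
  IsSmoothField Z ∧ ∀ X Y : VField E M, IsSmoothField X → IsSmoothField Y → ∀ x : M,
    mfderiv 𝓘(ℝ, E) 𝓘(ℝ, ℝ) (fun z => g z (X z) (Y z)) x (Z x) =
      g x (VectorField.mlieBracket 𝓘(ℝ, E) Z X x) (Y x) +
        g x (X x) (VectorField.mlieBracket 𝓘(ℝ, E) Z Y x)

/-- A complete vector field: all its integral curves are defined on `ℝ`. -/
def IsCompleteField (Z : VField E M) : Prop :=
  ∀ p : M, ∃ γ : ℝ → M, γ 0 = p ∧ IsMIntegralCurve (I := 𝓘(ℝ, E)) γ Z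

/-- There is a smooth curve `[0,1] → M` from `p` to `q` which is timelike and future-directed for the
time orientation given by the timelike field `Z`. -/
def SmoothTimelikeRel (g : BilinField E M) (Z : VField E M) (p q : M) : Prop :=
  ∃ γ : ℝ → M, γ 0 = p ∧ γ 1 = q ∧ ContMDiffOn 𝓘(ℝ, ℝ) 𝓘(ℝ, E) ∞ γ (Icc 0 1) ∧
    ∀ t ∈ Icc (0 : ℝ) 1,
      let v : TangentSpace 𝓘(ℝ, E) (γ t) :=
        mfderivWithin 𝓘(ℝ, ℝ) 𝓘(ℝ, E) γ (Icc 0 1) t (1 : ℝ)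
      g (γ t) v v < 0 ∧ g (γ t) v (Z (γ t)) < 0

/-- `p ≪ q`: there is a piecewise smooth future-directed timelike curve from `p` to `q`. -/
def ChronPrec (g : BilinField E M) (Z : VField E M) : M → M → Prop :=
  Relation.TransGen (SmoothTimelikeRel g Z)

/-- The chronology condition: there is no closed timelike curve. -/
def IsChronological (g : BilinField E M) (Z : VField E M) : Prop :=
  ∀ p : M, ¬ ChronPrec g Z p p

end General

section Submanifold

variable {E : Type*} [NormedAddCommGroup E] [NormedSpace ℝ E]
  {M : Type*} [TopologicalSpace M] [ChartedSpace E M]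
  {F : Type*} [NormedAddCommGroup F] [NormedSpace ℝ F]
  {L : Type*} [TopologicalSpace L] [ChartedSpace F L]

/-- The pullback `i^* g` of a field of bilinear forms by a map `i : L → M`. -/
def pullbackForm (g : BilinField E M) (i : L → M) : BilinField F L := fun q =>
  let A : TangentSpace 𝓘(ℝ, F) q →L[ℝ] TangentSpace 𝓘(ℝ, E) (i q) :=
    mfderiv 𝓘(ℝ, F) 𝓘(ℝ, E) i q
  (ContinuousLinearMap.precomp ℝ A).comp ((g (i q)).comp A)

/-- The immersed submanifold `i : L → M` is null: the induced form is degenerate at each point. -/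
def IsNullImmersed (g : BilinField E M) (i : L → M) : Prop :=
  ∀ q : L, ∃ v : TangentSpace 𝓘(ℝ, F) q, v ≠ 0 ∧
    ∀ w : TangentSpace 𝓘(ℝ, F) q, pullbackForm (F := F) g i q v w = 0

/-- The vector `w` at `i q` is tangent to the submanifold `i : L → M`. -/
def IsTangentTo (F : Type*) [NormedAddCommGroup F] [NormedSpace ℝ F] [ChartedSpace F L]
    (i : L → M) (q : L) (w : TangentSpace 𝓘(ℝ, E) (i q)) : Prop :=
  ∃ u : TangentSpace 𝓘(ℝ, F) q, mfderiv 𝓘(ℝ, F) 𝓘(ℝ, E) i q u = w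

/-- `i : L → M` is totally geodesic: `∇_U V` is tangent to `L` for all `U`, `V` tangent to `L`. -/
def IsTotallyGeodesic [IsManifold 𝓘(ℝ, E) ∞ M] (F : Type*) [NormedAddCommGroup F] [NormedSpace ℝ F] [ChartedSpace F L]
    (g : BilinField E M) (i : L → M) : Prop :=
  ∀ V : VField E M, IsSmoothField V → (∀ q : L, IsTangentTo F i q (V (i q))) →
    ∀ (q : L) (u : TangentSpace 𝓘(ℝ, E) (i q)), IsTangentTo F i q u →
      IsTangentTo F i q (covDeriv g V (i q) u)

/-- The field `g + α ⊗ α` on `M`, where `α = g(Z, ·)`. -/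
def riggedForm (g : BilinField E M) (Z : VField E M) : BilinField E M := fun x =>
  g x + (g x (Z x)).smulRight (g x (Z x))

/-- The rigged metric on `L` from the rigging `Z`: the pullback of `g + α ⊗ α`, `α = g(Z, ·)`. -/
def riggedMetric (g : BilinField E M) (Z : VField E M) (i : L → M) : BilinField F L :=
  pullbackForm (riggedForm g Z) i

/-- `pr : N → L` is the universal covering of `L`, and the metric `h'` of `N` is the lift `pr^* h` of the
metric `h` of `L`. -/
structure IsMetricUniversalCovering {F' : Type*} [NormedAddCommGroup F'] [NormedSpace ℝ F']
    {N : Type*} [TopologicalSpace N] [ChartedSpace F' N]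
    (h' : BilinField F' N) (h : BilinField F L) (pr : N → L) : Prop where
  simplyConnected : SimplyConnectedSpace N
  isCoveringMap : IsCoveringMap pr
  surjective : Surjective pr
  isLocalDiffeomorph : IsLocalDiffeomorph 𝓘(ℝ, F') 𝓘(ℝ, F) ∞ pr
  pullback_eq : pullbackForm h pr = h'

end Submanifold

/-- The Euclidean metric of `ℝⁿ`. -/
def euclideanMetric (n : ℕ) :
    BilinField (EuclideanSpace ℝ (Fin n)) (EuclideanSpace ℝ (Fin n)) :=
  fun _ => (innerSL ℝ : EuclideanSpace ℝ (Fin n) →L[ℝ] EuclideanSpace ℝ (Fin n) →L[ℝ] ℝ)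

end LorentzSurface

/-! The argument has three stages.

The field `ζ` is parallel. Let `γ` be a null geodesic and `f = g(ζ,ζ)` along it. A Killing field is
affine, so it satisfies the Jacobi equation along `γ`, and `f'' = 2(-g(R(ζ,γ')γ',ζ) + g(∇ζ,∇ζ))`,
where `∇ζ` is the derivative along `γ'`. The product `g(ζ,γ')` is conserved and nonzero, so the
denominator of the sectional curvature is `-g(ζ,γ')² < 0` and the curvature hypothesis makes the
first term nonnegative. Since `∇ζ` is skew, its value on `γ'` is orthogonal to the null vector `γ'`,
so the second term is nonnegative too. Thus `f` is convex, it is negative, and it is defined on all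
of `ℝ` by null completeness; hence it is constant. Then the derivative of `ζ` along `γ'` is null and
orthogonal to `γ'`, so it is `c • γ'`, and `f' = 0` gives `c = 0`. Null vectors span, so `∇ζ = 0`
(`IsKillingField.isParallelField`).

The rigged metric is flat. Since `L` is totally geodesic, it inherits a torsion-free connection for
which both `B = i^*g` and `η = i^*α` are parallel. The form `B` has rank one, so locally `B = θ ⊗
θ`, and parallelism makes `θ` and `η` closed. Their primitives are coordinates in which `B + η ⊗ η`
is Euclidean (`IsParallelPair.exists_flat_coordinates`). The induced connection is then the flat
one, so straight lines in flat charts are geodesics of `M` (`mapHessian_flatChart_eq_zero`).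

The flat lines are complete, and `L` is a quotient of the plane. Tangent vectors of a null surface
are null or spacelike, so the geodesics of `M` that they generate are complete; they stay in `L`
because `L` is closed and totally geodesic (`geodesic_tangent`). A connected manifold with an atlas
whose transitions are Euclidean isometries and whose lines are complete is covered by its model
space through the exponential map (`IsAffineAtlas.exists_exp`, `isCoveringMap_of_germs`). -/

noncomputable section

set_option linter.unusedSectionVars false
set_option synthInstance.maxHeartbeats 200000

/-! ### Norms on spaces of bilinear and trilinear maps. -/

section Shortcuts

variable {E : Type*} [NormedAddCommGroup E] [NormedSpace ℝ E] {Y : Type*} [NormedAddCommGroup Y]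
  [NormedSpace ℝ Y]

instance bilinearNormedAddCommGroup : NormedAddCommGroup (E →L[ℝ] E →L[ℝ] Y) :=
  ContinuousLinearMap.toNormedAddCommGroup

instance bilinearNormedSpace : NormedSpace ℝ (E →L[ℝ] E →L[ℝ] Y) :=
  ContinuousLinearMap.toNormedSpace

instance trilinearNormedAddCommGroup : NormedAddCommGroup (E →L[ℝ] E →L[ℝ] E →L[ℝ] Y) :=
  ContinuousLinearMap.toNormedAddCommGroup

instance trilinearNormedSpace : NormedSpace ℝ (E →L[ℝ] E →L[ℝ] E →L[ℝ] Y) :=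
  ContinuousLinearMap.toNormedSpace

end Shortcuts

lemma two_le_smooth : (2 : ℕ∞ω) ≤ ∞ :=
  WithTop.coe_le_coe.2 (le_top : (2 : ℕ∞) ≤ ⊤)

/-! ### Levi-Civita calculus in a coordinate domain. -/

section CoordinateMetric

variable {E : Type*} [NormedAddCommGroup E] [NormedSpace ℝ E] [FiniteDimensional ℝ E]
  {X : Type*} [NormedAddCommGroup X] [NormedSpace ℝ X]

/-- A smooth nondegenerate symmetric metric on an open subset of a vector space. -/
structure IsCoordMetricOn (G : E → E →L[ℝ] E →L[ℝ] ℝ) (Ω : Set E) : Prop where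
  isOpen : IsOpen Ω
  contDiffOn : ContDiffOn ℝ ∞ G Ω
  symm : ∀ y ∈ Ω, ∀ u v, G y u v = G y v u
  nondeg : ∀ y ∈ Ω, ∀ u, (∀ w, G y u w = 0) → u = 0

namespace IsCoordMetricOn

variable {G : E → E →L[ℝ] E →L[ℝ] ℝ} {Ω : Set E} {y : E}

lemma contDiffAt (hG : IsCoordMetricOn G Ω) (hy : y ∈ Ω) : ContDiffAt ℝ ∞ G y :=
  hG.contDiffOn.contDiffAt (hG.isOpen.mem_nhds hy)

lemma differentiableAt (hG : IsCoordMetricOn G Ω) (hy : y ∈ Ω) : DifferentiableAt ℝ G y :=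
  (hG.contDiffAt hy).differentiableAt (by simp)

/-- Nondegeneracy is injectivity of `E → E*`, and the dimensions agree. Without this, the `inverse`
in `christoffel` would take its default value zero. -/
lemma isInvertible (hG : IsCoordMetricOn G Ω) (hy : y ∈ Ω) : (G y).IsInvertible := by
  have hinj : Injective (G y : E →ₗ[ℝ] (E →L[ℝ] ℝ)) := by
    rw [← LinearMap.ker_eq_bot, LinearMap.ker_eq_bot']
    intro u hu
    exact hG.nondeg y hy u fun w => by
      have : G y u = 0 := hu
      simp [this]
  have hfr : Module.finrank ℝ E = Module.finrank ℝ (E →L[ℝ] ℝ) := by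
    rw [← (LinearMap.toContinuousLinearMap (𝕜 := ℝ) (E := E) (F' := ℝ)).finrank_eq]
    exact (Subspace.dual_finrank_eq (K := ℝ) (V := E)).symm
  let f := LinearEquiv.ofInjectiveOfFinrankEq (G y : E →ₗ[ℝ] (E →L[ℝ] ℝ)) hinj hfr
  exact ⟨f.toContinuousLinearEquiv, by ext; rfl⟩

lemma ext_of_forall (hG : IsCoordMetricOn G Ω) (hy : y ∈ Ω) {u v : E}
    (h : ∀ w, G y u w = G y v w) : u = v :=
  sub_eq_zero.1 <| hG.nondeg y hy _ fun w => by simp [h w]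

/-- The Koszul formula. Identities between Christoffel symbols are proved by pairing with a vector
and using this, so that the inverse metric is not differentiated. -/
lemma apply_christoffel (hG : IsCoordMetricOn G Ω) (hy : y ∈ Ω) (u v w : E) :
    G y (christoffel G y u v) w =
      1 / 2 * (fderiv ℝ G y u v w + fderiv ℝ G y v u w - fderiv ℝ G y w u v) := by
  obtain ⟨f, hf⟩ := hG.isInvertible hy
  have : G y (christoffel G y u v) = christoffelFirst G y u v := by
    rw [christoffel, ← hf, ContinuousLinearMap.inverse_equiv]
    simp
  rw [this]
  simp [christoffelFirst]

lemma fderiv_symm (hG : IsCoordMetricOn G Ω) (hy : y ∈ Ω) (w u v : E) :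
    fderiv ℝ G y w u v = fderiv ℝ G y w v u := by
  have hd := (hG.differentiableAt hy).hasFDerivAt
  have h1 : ∀ u v, HasFDerivAt (fun z => G z u v)
      (((ContinuousLinearMap.apply ℝ ℝ v).comp (ContinuousLinearMap.apply ℝ (E →L[ℝ] ℝ) u)).comp
        (fderiv ℝ G y)) y := fun u v =>
    HasFDerivAt.comp (f := G) (f' := fderiv ℝ G y) y ((ContinuousLinearMap.apply ℝ ℝ v).comp
      (ContinuousLinearMap.apply ℝ (E →L[ℝ] ℝ) u)).hasFDerivAt hd
  have h2 : (fun z => G z u v) =ᶠ[𝓝 y] fun z => G z v u :=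
    Filter.eventuallyEq_of_mem (hG.isOpen.mem_nhds hy) fun z hz => hG.symm z hz u v
  have h3 := (h1 u v).unique ((h1 v u).congr_of_eventuallyEq h2)
  simpa using congrArg (fun T : E →L[ℝ] ℝ => T w) h3

lemma christoffel_comm (hG : IsCoordMetricOn G Ω) (hy : y ∈ Ω) (u v : E) :
    christoffel G y u v = christoffel G y v u := by
  refine hG.ext_of_forall hy fun w => ?_
  rw [hG.apply_christoffel hy, hG.apply_christoffel hy, hG.fderiv_symm hy w u v]
  ring

/-- Metric compatibility of the Levi-Civita connection. -/
lemma fderiv_apply (hG : IsCoordMetricOn G Ω) (hy : y ∈ Ω) (u a b : E) :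
    fderiv ℝ G y u a b = G y (christoffel G y u a) b + G y a (christoffel G y u b) := by
  rw [hG.symm y hy a, hG.apply_christoffel hy, hG.apply_christoffel hy, hG.fderiv_symm hy a u b,
    hG.fderiv_symm hy b u a, hG.fderiv_symm hy u b a]
  ring

/-- Metric compatibility for vector fields `a`, `b` along a map `f`, written with their covariant
derivatives. -/
lemma hasFDerivAt_apply (hG : IsCoordMetricOn G Ω) {f a b : X → E} {f' a' b' : X →L[ℝ] E} {x : X}
    (hx : f x ∈ Ω) (hf : HasFDerivAt f f' x) (ha : HasFDerivAt a a' x) (hb : HasFDerivAt b b' x) :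
    ∃ T : X →L[ℝ] ℝ, HasFDerivAt (fun z => G (f z) (a z) (b z)) T x ∧ ∀ u,
      T u = G (f x) (a' u + christoffel G (f x) (f' u) (a x)) (b x) +
        G (f x) (a x) (b' u + christoffel G (f x) (f' u) (b x)) := by
  have h1 : HasFDerivAt (fun z => G (f z)) ((fderiv ℝ G (f x)).comp f') x :=
    HasFDerivAt.comp (g := G) (g' := fderiv ℝ G (f x)) x (hG.differentiableAt hx).hasFDerivAt hf
  refine ⟨_, (h1.clm_apply ha).clm_apply hb, fun u => ?_⟩
  simp [hG.fderiv_apply hx]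
  ring

lemma hasDerivAt_apply (hG : IsCoordMetricOn G Ω) {f a b : ℝ → E} {f' a' b' : E} {t : ℝ}
    (hx : f t ∈ Ω) (hf : HasDerivAt f f' t) (ha : HasDerivAt a a' t) (hb : HasDerivAt b b' t) :
    HasDerivAt (fun z => G (f z) (a z) (b z))
      (G (f t) (a' + christoffel G (f t) f' (a t)) (b t) +
        G (f t) (a t) (b' + christoffel G (f t) f' (b t))) t := by
  obtain ⟨T, hT, h⟩ := hG.hasFDerivAt_apply hx hf.hasFDerivAt ha.hasFDerivAt hb.hasFDerivAt
  have := hT.hasDerivAt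
  rw [h 1] at this
  simpa using this

end IsCoordMetricOn

/-- The Hessian `D²F(u,v) + Γ(DF u, DF v)` of a map with values in a coordinate domain. -/
def mapHessian (G : E → E →L[ℝ] E →L[ℝ] ℝ) (F : X → E) (x u v : X) : E :=
  fderiv ℝ (fun z => fderiv ℝ F z v) x u + christoffel G (F x) (fderiv ℝ F x u) (fderiv ℝ F x v)

lemma hasFDerivAt_fderiv_apply {Y : Type*} [NormedAddCommGroup Y] [NormedSpace ℝ Y]
    {F : X → Y} {x : X} (hF : ContDiffAt ℝ 2 F x) (v : X) :
    HasFDerivAt (fun z => fderiv ℝ F z v) ((fderiv ℝ (fderiv ℝ F) x).flip v) x := by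
  have h : DifferentiableAt ℝ (fderiv ℝ F) x :=
    (hF.fderiv_right (m := 1) (by norm_num)).differentiableAt (by simp)
  have := h.hasFDerivAt.clm_apply (hasFDerivAt_const v x)
  refine this.congr_fderiv ?_
  ext u
  simp

lemma fderiv_fderiv_apply {Y : Type*} [NormedAddCommGroup Y] [NormedSpace ℝ Y]
    {F : X → Y} {x : X} (hF : ContDiffAt ℝ 2 F x) (u v : X) :
    fderiv ℝ (fun z => fderiv ℝ F z v) x u = fderiv ℝ (fderiv ℝ F) x u v := by
  rw [(hasFDerivAt_fderiv_apply hF v).fderiv]; rfl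

lemma fderiv_fderiv_apply_comm {Y : Type*} [NormedAddCommGroup Y] [NormedSpace ℝ Y]
    {F : X → Y} {x : X} (hF : ContDiffAt ℝ 2 F x) (u v : X) :
    fderiv ℝ (fun z => fderiv ℝ F z v) x u = fderiv ℝ (fun z => fderiv ℝ F z u) x v := by
  rw [fderiv_fderiv_apply hF, fderiv_fderiv_apply hF]
  exact hF.isSymmSndFDerivAt (by simp) u v

namespace IsCoordMetricOn

variable {G : E → E →L[ℝ] E →L[ℝ] ℝ} {Ω : Set E} {F : X → E} {x : X}

lemma mapHessian_comm (hG : IsCoordMetricOn G Ω) (hx : F x ∈ Ω) (hF : ContDiffAt ℝ 2 F x) (u v : X) :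
    mapHessian G F x u v = mapHessian G F x v u := by
  rw [mapHessian, mapHessian, fderiv_fderiv_apply_comm hF, hG.christoffel_comm hx]

/-- The fields `DF a` and `DF b` along `F` have the Hessian as covariant derivative. Hence
information on the pulled back metric becomes information on the Hessian. -/
lemma hasFDerivAt_pullback (hG : IsCoordMetricOn G Ω) (hx : F x ∈ Ω) (hF : ContDiffAt ℝ 2 F x)
    (a b : X) : ∃ T : X →L[ℝ] ℝ,
      HasFDerivAt (fun z => G (F z) (fderiv ℝ F z a) (fderiv ℝ F z b)) T x ∧ ∀ u,
      T u = G (F x) (mapHessian G F x u a) (fderiv ℝ F x b) +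
        G (F x) (fderiv ℝ F x a) (mapHessian G F x u b) := by
  obtain ⟨T, hT, h⟩ := hG.hasFDerivAt_apply hx (hF.differentiableAt (by simp)).hasFDerivAt
    (hasFDerivAt_fderiv_apply hF a) (hasFDerivAt_fderiv_apply hF b)
  refine ⟨T, hT, fun u => ?_⟩
  rw [h, mapHessian, mapHessian, fderiv_fderiv_apply hF, fderiv_fderiv_apply hF]
  rfl

/-- If the pullback of the metric under `F` is constant to first order at `x`, the Hessian of `F` is
orthogonal to the image of the derivative. -/
lemma mapHessian_orthogonal (hG : IsCoordMetricOn G Ω) (hx : F x ∈ Ω) (hF : ContDiffAt ℝ 2 F x)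
    (h : ∀ a b u, fderiv ℝ (fun z => G (F z) (fderiv ℝ F z a) (fderiv ℝ F z b)) x u = 0)
    (u v w : X) : G (F x) (mapHessian G F x u v) (fderiv ℝ F x w) = 0 := by
  have key : ∀ a b u, G (F x) (mapHessian G F x u a) (fderiv ℝ F x b) +
        G (F x) (mapHessian G F x u b) (fderiv ℝ F x a) = 0 := by
    intro a b u
    obtain ⟨T, hT, h'⟩ := hG.hasFDerivAt_pullback hx hF a b
    rw [hG.symm _ hx (mapHessian G F x u b), ← h', ← hT.fderiv, h]
  -- Koszul's argument: `G(Hess(u,v), DF w)` is symmetric in `u`, `v` and skew in `v`, `w`, so it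
  -- vanishes. The combination is `h1 + h2 - h3`.
  have h1 := key v w u
  have h2 := key u w v
  have h3 := key u v w
  rw [hG.mapHessian_comm hx hF v u] at h2
  rw [hG.mapHessian_comm hx hF w u, hG.mapHessian_comm hx hF w v] at h3
  linarith

end IsCoordMetricOn

end CoordinateMetric

/-! ### Smoothness of families of linear maps, tested on vectors. -/

section ContDiffClm

variable {E : Type*} [NormedAddCommGroup E] [NormedSpace ℝ E] [FiniteDimensional ℝ E]
  {X : Type*} [NormedAddCommGroup X] [NormedSpace ℝ X]
  {Y : Type*} [NormedAddCommGroup Y] [NormedSpace ℝ Y]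

lemma contDiffAt_clm_of_apply {n : ℕ∞ω} {f : X → E →L[ℝ] Y} {x : X}
    (h : ∀ u, ContDiffAt ℝ n (fun z => f z u) x) : ContDiffAt ℝ n f x := by
  let d := Module.finrank ℝ E
  have hd : d = Module.finrank ℝ (Fin d → ℝ) := (Module.finrank_fin_fun ℝ).symm
  let e₁ := ContinuousLinearEquiv.ofFinrankEq hd
  let e₂ := (e₁.arrowCongr (1 : Y ≃L[ℝ] Y)).trans (ContinuousLinearEquiv.piRing (Fin d))
  rw [← id_comp f, ← e₂.symm_comp_self]
  exact e₂.symm.contDiff.contDiffAt.comp x (contDiffAt_pi.mpr fun i => h _)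

end ContDiffClm

/-! ### Killing fields in coordinates: affinity and the Jacobi equation. -/

section KillingCoordinates

variable {E : Type*} [NormedAddCommGroup E] [NormedSpace ℝ E] [FiniteDimensional ℝ E]
  {X : Type*} [NormedAddCommGroup X] [NormedSpace ℝ X]

lemma christoffelFirst_add_left (G : E → E →L[ℝ] E →L[ℝ] ℝ) (y u u' v : E) :
    christoffelFirst G y (u + u') v = christoffelFirst G y u v + christoffelFirst G y u' v := by
  ext w; simp [christoffelFirst]; ring

lemma christoffelFirst_smul_left (G : E → E →L[ℝ] E →L[ℝ] ℝ) (y u v : E) (c : ℝ) :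
    christoffelFirst G y (c • u) v = c • christoffelFirst G y u v := by
  ext w; simp [christoffelFirst]; ring

lemma christoffelFirst_add_right (G : E → E →L[ℝ] E →L[ℝ] ℝ) (y u v v' : E) :
    christoffelFirst G y u (v + v') = christoffelFirst G y u v + christoffelFirst G y u v' := by
  ext w; simp [christoffelFirst]; ring

lemma christoffelFirst_smul_right (G : E → E →L[ℝ] E →L[ℝ] ℝ) (y u v : E) (c : ℝ) :
    christoffelFirst G y u (c • v) = c • christoffelFirst G y u v := by
  ext w; simp [christoffelFirst]; ring

/-- The Christoffel symbols as a continuous bilinear map. -/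
def christoffelMap (G : E → E →L[ℝ] E →L[ℝ] ℝ) (y : E) : E →L[ℝ] E →L[ℝ] E :=
  LinearMap.toContinuousLinearMap ((LinearMap.toContinuousLinearMap :
    (E →ₗ[ℝ] E) ≃ₗ[ℝ] (E →L[ℝ] E)).toLinearMap.comp
    (LinearMap.mk₂ ℝ (fun u v => christoffel G y u v)
      (fun u u' v => by simp [christoffel, christoffelFirst_add_left])
      (fun c u v => by simp [christoffel, christoffelFirst_smul_left])
      (fun u v v' => by simp [christoffel, christoffelFirst_add_right])
      (fun c u v => by simp [christoffel, christoffelFirst_smul_right])))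

@[simp] lemma christoffelMap_apply (G : E → E →L[ℝ] E →L[ℝ] ℝ) (y u v : E) :
    christoffelMap G y u v = christoffel G y u v := rfl

namespace IsCoordMetricOn

variable {G : E → E →L[ℝ] E →L[ℝ] ℝ} {Ω : Set E} {y : E}

lemma contDiffAt_fderiv (hG : IsCoordMetricOn G Ω) (hy : y ∈ Ω) :
    ContDiffAt ℝ ∞ (fderiv ℝ G) y :=
  (hG.contDiffAt hy).fderiv_right (m := ∞) (by simp)

lemma contDiffAt_christoffel_const (hG : IsCoordMetricOn G Ω) (hy : y ∈ Ω) (u v : E) :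
    ContDiffAt ℝ ∞ (fun z => christoffel G z u v) y := by
  have h1 := hG.contDiffAt_fderiv hy
  have h2 : ContDiffAt ℝ ∞ (fun z => christoffelFirst G z u v) y := by
    refine (ContDiffAt.const_smul (1 / 2 : ℝ) ?_)
    have h3 : ContDiffAt ℝ ∞ (fun z => ((fderiv ℝ G z).flip u).flip v) y := by
      have hL : ContDiff ℝ ∞ (fun T : E →L[ℝ] E →L[ℝ] E →L[ℝ] ℝ => (T.flip u).flip v) := by
        have h5 : ContDiff ℝ ∞ (fun T : E →L[ℝ] E →L[ℝ] E →L[ℝ] ℝ => T.flip u) :=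
          ((ContinuousLinearMap.apply ℝ (E →L[ℝ] E →L[ℝ] ℝ) u).comp
          (ContinuousLinearMap.flipₗᵢ ℝ E E (E →L[ℝ] ℝ)).toContinuousLinearEquiv.toContinuousLinearMap).contDiff
        have h6 : ContDiff ℝ ∞ (fun T : E →L[ℝ] E →L[ℝ] ℝ => T.flip v) :=
          ((ContinuousLinearMap.apply ℝ (E →L[ℝ] ℝ) v).comp
          (ContinuousLinearMap.flipₗᵢ ℝ E E ℝ).toContinuousLinearEquiv.toContinuousLinearMap).contDiff
        exact h6.comp h5
      exact hL.contDiffAt.comp y h1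
    exact (((h1.clm_apply contDiffAt_const).clm_apply contDiffAt_const).add
      ((h1.clm_apply contDiffAt_const).clm_apply contDiffAt_const)).sub h3
  obtain ⟨f, hf⟩ := hG.isInvertible hy
  -- Inversion of linear maps is smooth at an invertible one.
  have h4 : ContDiffAt ℝ ∞ (fun z => (G z).inverse) y := by
    refine ContDiffAt.comp (g := ContinuousLinearMap.inverse) y ?_ (hG.contDiffAt hy)
    rw [← hf]
    exact contDiffAt_map_inverse f
  exact h4.clm_apply h2

lemma contDiffAt_christoffelMap (hG : IsCoordMetricOn G Ω) (hy : y ∈ Ω) :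
    ContDiffAt ℝ ∞ (christoffelMap G) y := by
  refine contDiffAt_clm_of_apply fun u => contDiffAt_clm_of_apply fun v => ?_
  exact hG.contDiffAt_christoffel_const hy u v

lemma differentiableAt_christoffelMap (hG : IsCoordMetricOn G Ω) (hy : y ∈ Ω) :
    DifferentiableAt ℝ (christoffelMap G) y :=
  (hG.contDiffAt_christoffelMap hy).differentiableAt (by simp)

lemma fderiv_christoffel (hG : IsCoordMetricOn G Ω) (hy : y ∈ Ω) (u v w : E) :
    fderiv ℝ (fun z => christoffel G z v w) y u = fderiv ℝ (christoffelMap G) y u v w := by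
  have h := ((hG.differentiableAt_christoffelMap hy).hasFDerivAt.clm_apply
    (hasFDerivAt_const v y)).clm_apply (hasFDerivAt_const w y)
  have h2 : HasFDerivAt (fun z => christoffel G z v w) _ y := h
  rw [h2.fderiv]
  simp

lemma fderiv_christoffelMap_comm (hG : IsCoordMetricOn G Ω) (hy : y ∈ Ω) (u v w : E) :
    fderiv ℝ (christoffelMap G) y u v w = fderiv ℝ (christoffelMap G) y u w v := by
  rw [← hG.fderiv_christoffel hy, ← hG.fderiv_christoffel hy]
  refine congrArg (fun T : E →L[ℝ] E => T u) (Filter.EventuallyEq.fderiv_eq ?_)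
  exact Filter.eventuallyEq_of_mem (hG.isOpen.mem_nhds hy)
    fun z hz => hG.christoffel_comm hz v w

lemma coordRiemann_eq (hG : IsCoordMetricOn G Ω) (hy : y ∈ Ω) (u v w : E) :
    coordRiemann G y u v w = fderiv ℝ (christoffelMap G) y u v w -
      fderiv ℝ (christoffelMap G) y v u w + christoffel G y u (christoffel G y v w) -
      christoffel G y v (christoffel G y u w) := by
  rw [coordRiemann, hG.fderiv_christoffel hy, hG.fderiv_christoffel hy]

lemma contDiffAt_christoffel (hG : IsCoordMetricOn G Ω) {a b c : X → E} {x : X} (hx : a x ∈ Ω)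
    (ha : ContDiffAt ℝ ∞ a x) (hb : ContDiffAt ℝ ∞ b x) (hc : ContDiffAt ℝ ∞ c x) :
    ContDiffAt ℝ ∞ (fun z => christoffel G (a z) (b z) (c z)) x := by
  have h1 : ContDiffAt ℝ ∞ (fun z => christoffelMap G (a z)) x :=
    ContDiffAt.comp (g := christoffelMap G) x (hG.contDiffAt_christoffelMap hx) ha
  exact (h1.clm_apply hb).clm_apply hc

lemma hasDerivAt_christoffel (hG : IsCoordMetricOn G Ω) {f a b : ℝ → E} {f' a' b' : E} {t : ℝ}
    (hx : f t ∈ Ω) (hf : HasDerivAt f f' t) (ha : HasDerivAt a a' t) (hb : HasDerivAt b b' t) :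
    HasDerivAt (fun z => christoffel G (f z) (a z) (b z))
      (fderiv ℝ (christoffelMap G) (f t) f' (a t) (b t) + christoffel G (f t) a' (b t) +
        christoffel G (f t) (a t) b') t := by
  have h1 : HasDerivAt (fun z => christoffelMap G (f z)) (fderiv ℝ (christoffelMap G) (f t) f') t :=
    HasFDerivAt.comp_hasDerivAt (l := christoffelMap G) (l' := fderiv ℝ (christoffelMap G) (f t)) t
      (hG.differentiableAt_christoffelMap hx).hasFDerivAt hf
  have h2 := (h1.clm_apply ha).clm_apply hb
  have h3 : HasDerivAt (fun z => christoffel G (f z) (a z) (b z)) _ t := h2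
  refine h3.congr_deriv ?_
  simp

end IsCoordMetricOn

/-- The Killing equation in coordinates. -/
structure IsCoordKillingOn (G : E → E →L[ℝ] E →L[ℝ] ℝ) (Z : E → E) (Ω : Set E) : Prop where
  metric : IsCoordMetricOn G Ω
  contDiffOn : ContDiffOn ℝ ∞ Z Ω
  killing : ∀ y ∈ Ω, ∀ u v,
    fderiv ℝ G y (Z y) u v + G y (fderiv ℝ Z y u) v + G y u (fderiv ℝ Z y v) = 0

namespace IsCoordKillingOn

variable {G : E → E →L[ℝ] E →L[ℝ] ℝ} {Z : E → E} {Ω : Set E} {y : E}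

lemma contDiffAt (hZ : IsCoordKillingOn G Z Ω) (hy : y ∈ Ω) : ContDiffAt ℝ ∞ Z y :=
  hZ.contDiffOn.contDiffAt (hZ.metric.isOpen.mem_nhds hy)

lemma hasFDerivAt (hZ : IsCoordKillingOn G Z Ω) (hy : y ∈ Ω) : HasFDerivAt Z (fderiv ℝ Z y) y :=
  ((hZ.contDiffAt hy).differentiableAt (by simp)).hasFDerivAt

lemma hasFDerivAt_fderiv (hZ : IsCoordKillingOn G Z Ω) (hy : y ∈ Ω) :
    HasFDerivAt (fderiv ℝ Z) (fderiv ℝ (fderiv ℝ Z) y) y :=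
  (((hZ.contDiffAt hy).fderiv_right (m := ∞) (by simp)).differentiableAt (by simp)).hasFDerivAt

/-- The covariant derivative of a Killing field is skew. -/
lemma skew (hZ : IsCoordKillingOn G Z Ω) (hy : y ∈ Ω) (u v : E) :
    G y (fderiv ℝ Z y u + christoffel G y u (Z y)) v +
      G y u (fderiv ℝ Z y v + christoffel G y v (Z y)) = 0 := by
  have h := hZ.killing y hy u v
  rw [hZ.metric.fderiv_apply hy, hZ.metric.christoffel_comm hy (Z y),
    hZ.metric.christoffel_comm hy (Z y)] at h
  simp only [map_add, add_apply]
  linarith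

/-- The Killing equation holds on an open set and may be differentiated. Three permutations of the
result give affinity. -/
lemma killing_fderiv (hZ : IsCoordKillingOn G Z Ω) (hy : y ∈ Ω) (w u v : E) :
    fderiv ℝ (fderiv ℝ G) y w (Z y) u v + fderiv ℝ G y (fderiv ℝ Z y w) u v
      + fderiv ℝ G y w (fderiv ℝ Z y u) v + G y (fderiv ℝ (fderiv ℝ Z) y w u) v
      + fderiv ℝ G y w u (fderiv ℝ Z y v) + G y u (fderiv ℝ (fderiv ℝ Z) y w v) = 0 := by
  have hG1 : HasFDerivAt G (fderiv ℝ G y) y := (hZ.metric.differentiableAt hy).hasFDerivAt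
  have hG2 : HasFDerivAt (fderiv ℝ G) (fderiv ℝ (fderiv ℝ G) y) y :=
    ((hZ.metric.contDiffAt_fderiv hy).differentiableAt (by simp)).hasFDerivAt
  have hZ1 := hZ.hasFDerivAt hy
  have hZ2 := hZ.hasFDerivAt_fderiv hy
  have hu := hasFDerivAt_const (𝕜 := ℝ) u y
  have hv := hasFDerivAt_const (𝕜 := ℝ) v y
  have h := ((((hG2.clm_apply hZ1).clm_apply hu).clm_apply hv).add
    ((hG1.clm_apply (hZ2.clm_apply hu)).clm_apply hv)).add
    ((hG1.clm_apply hu).clm_apply (hZ2.clm_apply hv))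
  have h0 : HasFDerivAt (fun z => fderiv ℝ G z (Z z) u v + G z (fderiv ℝ Z z u) v +
      G z u (fderiv ℝ Z z v)) (0 : E →L[ℝ] ℝ) y :=
    (hasFDerivAt_const (0 : ℝ) y).congr_of_eventuallyEq
      (Filter.eventuallyEq_of_mem (hZ.metric.isOpen.mem_nhds hy) fun z hz => hZ.killing z hz u v)
  have h3 := congrArg (fun T : E →L[ℝ] ℝ => T w) (h.unique h0)
  simp at h3
  linarith

/-- A Killing field is affine: it preserves the Levi-Civita connection. -/
lemma affine (hZ : IsCoordKillingOn G Z Ω) (hy : y ∈ Ω) (u v : E) :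
    fderiv ℝ (fderiv ℝ Z) y u v + fderiv ℝ (christoffelMap G) y (Z y) u v
      + christoffel G y (fderiv ℝ Z y u) v + christoffel G y u (fderiv ℝ Z y v)
      - fderiv ℝ Z y (christoffel G y u v) = 0 := by
  refine hZ.metric.nondeg y hy _ fun w => ?_
  have hG1 : HasFDerivAt G (fderiv ℝ G y) y := (hZ.metric.differentiableAt hy).hasFDerivAt
  have hG2 : HasFDerivAt (fderiv ℝ G) (fderiv ℝ (fderiv ℝ G) y) y :=
    ((hZ.metric.contDiffAt_fderiv hy).differentiableAt (by simp)).hasFDerivAt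
  have hC := (hZ.metric.differentiableAt_christoffelMap hy).hasFDerivAt
  have cst : ∀ a : E, HasFDerivAt (fun _ : E => a) (0 : E →L[ℝ] E) y :=
    fun a => hasFDerivAt_const a y
  have hl := (hG1.clm_apply ((hC.clm_apply (cst u)).clm_apply (cst v))).clm_apply (cst w)
  have hr := ((((hG2.clm_apply (cst u)).clm_apply (cst v)).clm_apply (cst w)).add
    (((hG2.clm_apply (cst v)).clm_apply (cst u)).clm_apply (cst w))).sub
    (((hG2.clm_apply (cst w)).clm_apply (cst u)).clm_apply (cst v)) |>.const_mul (1 / 2)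
  have hr' := hr.congr_of_eventuallyEq (f₁ := fun z => G z (christoffelMap G z u v) w)
    (Filter.eventuallyEq_of_mem (hZ.metric.isOpen.mem_nhds hy)
      fun z hz => hZ.metric.apply_christoffel hz u v w)
  have h1 := congrArg (fun T : E →L[ℝ] ℝ => T (Z y)) (hl.unique hr')
  simp at h1
  have hs : ∀ a b, fderiv ℝ (fderiv ℝ G) y a b = fderiv ℝ (fderiv ℝ G) y b a := fun a b =>
    ((hZ.metric.contDiffAt hy).isSymmSndFDerivAt (by simpa using two_le_smooth)) a b
  have hsZ : ∀ a b, fderiv ℝ (fderiv ℝ Z) y a b = fderiv ℝ (fderiv ℝ Z) y b a := fun a b =>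
    ((hZ.contDiffAt hy).isSymmSndFDerivAt (by simpa using two_le_smooth)) a b
  -- The claim says that the Lie derivative of `Γ` along `Z` vanishes. Differentiating the Koszul
  -- formula along `Z` gave `h1`; the differentiated Killing equations `k1`, `k2`, `k3` enter with
  -- the signs of the Koszul formula, `k` accounts for the derivative of the metric paired with
  -- `Γ(u,v)`, and `c1`, `c2`, `c3` remove the remaining Christoffel symbols.
  have k1 := hZ.killing_fderiv hy u v w
  have k2 := hZ.killing_fderiv hy v u w
  have k3 := hZ.killing_fderiv hy w u v
  have k := hZ.killing y hy (christoffel G y u v) w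
  have c1 := hZ.metric.apply_christoffel hy (fderiv ℝ Z y u) v w
  have c2 := hZ.metric.apply_christoffel hy u (fderiv ℝ Z y v) w
  have c3 := hZ.metric.apply_christoffel hy u v (fderiv ℝ Z y w)
  have f1 := hZ.metric.fderiv_symm hy w u (fderiv ℝ Z y v)
  have g1 := hZ.metric.symm y hy u (fderiv ℝ (fderiv ℝ Z) y w v)
  have g2 := hZ.metric.symm y hy v (fderiv ℝ (fderiv ℝ Z) y u w)
  have g3 := hZ.metric.symm y hy u (fderiv ℝ (fderiv ℝ Z) y v w)
  rw [hs u] at k1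
  rw [hs v] at k2
  rw [hs w] at k3
  rw [hsZ w v] at k3 g1
  rw [hsZ w u] at k3
  rw [hsZ v u] at k2
  simp only [map_add, map_sub, add_apply, sub_apply]
  linarith

variable {c : ℝ → E} {t : ℝ}

/-- The derivative of a Killing field along a geodesic satisfies the Jacobi equation. -/
lemma hasDerivAt_covariant (hZ : IsCoordKillingOn G Z Ω) (ht : c t ∈ Ω) (hc : ContDiffAt ℝ 2 c t)
    (hgeod : deriv (deriv c) t + christoffel G (c t) (deriv c t) (deriv c t) = 0) :
    ∃ W', HasDerivAt (fun s => fderiv ℝ Z (c s) (deriv c s) +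
        christoffel G (c s) (deriv c s) (Z (c s))) W' t ∧
      W' + christoffel G (c t) (deriv c t) (fderiv ℝ Z (c t) (deriv c t) +
        christoffel G (c t) (deriv c t) (Z (c t))) =
        - coordRiemann G (c t) (Z (c t)) (deriv c t) (deriv c t) := by
  have h1 : HasDerivAt c (deriv c t) t := (hc.differentiableAt (by simp)).hasDerivAt
  have h2 : HasDerivAt (deriv c) (deriv (deriv c) t) t := by
    have h : ContDiffAt ℝ 1 (fderiv ℝ c) t := hc.fderiv_right (m := 1) (by norm_num)
    have h' : DifferentiableAt ℝ (fun s => fderiv ℝ c s 1) t :=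
      (h.clm_apply contDiffAt_const).differentiableAt (by simp)
    exact h'.hasDerivAt
  have hz : HasDerivAt (fun s => Z (c s)) (fderiv ℝ Z (c t) (deriv c t)) t :=
    HasFDerivAt.comp_hasDerivAt t (hZ.hasFDerivAt ht) h1
  have hz2 : HasDerivAt (fun s => fderiv ℝ Z (c s))
      (fderiv ℝ (fderiv ℝ Z) (c t) (deriv c t)) t :=
    HasFDerivAt.comp_hasDerivAt t (hZ.hasFDerivAt_fderiv ht) h1
  refine ⟨_, (hz2.clm_apply h2).add (hZ.metric.hasDerivAt_christoffel ht h1 h2 hz), ?_⟩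
  -- After `c''` is replaced by `-Γ(c',c')`, the claim differs from affinity at `(c',c')` only by
  -- the symmetry of `Γ` and of its derivative.
  have ha := hZ.affine ht (deriv c t) (deriv c t)
  rw [hZ.metric.coordRiemann_eq ht]
  have e1 : deriv (deriv c) t = - christoffel G (c t) (deriv c t) (deriv c t) :=
    eq_neg_of_add_eq_zero_left hgeod
  have n1 : christoffel G (c t) (- christoffel G (c t) (deriv c t) (deriv c t)) (Z (c t)) =
      - christoffel G (c t) (Z (c t)) (christoffel G (c t) (deriv c t) (deriv c t)) := by
    rw [hZ.metric.christoffel_comm ht, ← christoffelMap_apply, map_neg, christoffelMap_apply]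
  have n2 : ∀ a b d, christoffel G (c t) a (b + d) = christoffel G (c t) a b +
      christoffel G (c t) a d := fun a b d => by
    rw [← christoffelMap_apply, map_add]; rfl
  rw [e1, n1, n2, map_neg, hZ.metric.christoffel_comm ht (Z (c t)) (deriv c t)]
  rw [hZ.metric.christoffel_comm ht (fderiv ℝ Z (c t) (deriv c t)) (deriv c t)] at ha
  rw [hZ.metric.fderiv_christoffelMap_comm ht (deriv c t) (deriv c t) (Z (c t)), ← sub_eq_zero, ← ha]
  abel

/-- The second derivative of `G(Z,Z)` along a geodesic, for a Killing field `Z`. -/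
lemma hasDerivAt_deriv_normSq (hZ : IsCoordKillingOn G Z Ω) (ht : c t ∈ Ω)
    (hc : ContDiffAt ℝ 2 c t)
    (hgeod : deriv (deriv c) t + christoffel G (c t) (deriv c t) (deriv c t) = 0) :
    HasDerivAt (fun s => G (c s) (fderiv ℝ Z (c s) (deriv c s) +
        christoffel G (c s) (deriv c s) (Z (c s))) (Z (c s)))
      (- G (c t) (coordRiemann G (c t) (Z (c t)) (deriv c t) (deriv c t)) (Z (c t)) +
        G (c t) (fderiv ℝ Z (c t) (deriv c t) + christoffel G (c t) (deriv c t) (Z (c t)))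
          (fderiv ℝ Z (c t) (deriv c t) + christoffel G (c t) (deriv c t) (Z (c t)))) t := by
  have h1 : HasDerivAt c (deriv c t) t := (hc.differentiableAt (by simp)).hasDerivAt
  have hz : HasDerivAt (fun s => Z (c s)) (fderiv ℝ Z (c t) (deriv c t)) t :=
    HasFDerivAt.comp_hasDerivAt t (hZ.hasFDerivAt ht) h1
  obtain ⟨W', hW, hW'⟩ := hZ.hasDerivAt_covariant ht hc hgeod
  have := hZ.metric.hasDerivAt_apply ht h1 hW hz
  rw [hW'] at this
  simpa using this

lemma hasDerivAt_normSq (hZ : IsCoordKillingOn G Z Ω) (ht : c t ∈ Ω)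
    (hc : DifferentiableAt ℝ c t) :
    HasDerivAt (fun s => G (c s) (Z (c s)) (Z (c s)))
      (2 * G (c t) (fderiv ℝ Z (c t) (deriv c t) + christoffel G (c t) (deriv c t) (Z (c t)))
        (Z (c t))) t := by
  have hz : HasDerivAt (fun s => Z (c s)) (fderiv ℝ Z (c t) (deriv c t)) t :=
    HasFDerivAt.comp_hasDerivAt t (hZ.hasFDerivAt ht) hc.hasDerivAt
  have := hZ.metric.hasDerivAt_apply ht hc.hasDerivAt hz hz
  rw [hZ.metric.symm _ ht (Z (c t))] at this
  rwa [two_mul]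

end IsCoordKillingOn

end KillingCoordinates

/-! ### Derivatives, forms and fields read in the model space. -/

section DerivativeAt

variable {E : Type*} [NormedAddCommGroup E] [NormedSpace ℝ E]
  {M : Type*} [TopologicalSpace M] [ChartedSpace E M]
  {F : Type*} [NormedAddCommGroup F] [NormedSpace ℝ F]
  {N : Type*} [TopologicalSpace N] [ChartedSpace F N]
  {K : Type*} [NormedAddCommGroup K] [NormedSpace ℝ K]
  {P : Type*} [TopologicalSpace P] [ChartedSpace K P]

variable (E F) in
/-- The derivative of a map between manifolds, as a map between the model spaces. -/
def dAt (f : M → N) (x : M) : E →L[ℝ] F := mfderiv 𝓘(ℝ, E) 𝓘(ℝ, F) f x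

/-- A field of bilinear forms, with values in the bilinear forms on the model space. -/
def formAt (g : BilinField E M) (x : M) : E →L[ℝ] E →L[ℝ] ℝ := g x

/-- A vector field, with values in the model space. -/
def vecAt (Z : VField E M) (x : M) : E := Z x

lemma dAt_comp {f : M → N} {h : N → P} {x : M}
    (hh : MDifferentiableAt 𝓘(ℝ, F) 𝓘(ℝ, K) h (f x))
    (hf : MDifferentiableAt 𝓘(ℝ, E) 𝓘(ℝ, F) f x) :
    dAt E K (fun z => h (f z)) x = (dAt F K h (f x)).comp (dAt E F f x) :=
  mfderiv_comp x hh hf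

lemma dAt_eq_fderiv {f : E → F} {x : E} : dAt E F f x = fderiv ℝ f x :=
  mfderiv_eq_fderiv

lemma dAt_congr {f h : M → N} {x : M} (hfh : f =ᶠ[𝓝 x] h) : dAt E F f x = dAt E F h x :=
  hfh.mfderiv_eq

lemma fderiv_comp_dAt {f : E → N} {h : N → K} {x : E}
    (hh : MDifferentiableAt 𝓘(ℝ, F) 𝓘(ℝ, K) h (f x))
    (hf : MDifferentiableAt 𝓘(ℝ, E) 𝓘(ℝ, F) f x) :
    fderiv ℝ (fun z => h (f z)) x = (dAt F K h (f x)).comp (dAt E F f x) := by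
  rw [← dAt_eq_fderiv, dAt_comp hh hf]

end DerivativeAt

/-! ### From manifolds to coordinate domains. -/

section ChartBridge

variable {E : Type*} [NormedAddCommGroup E] [NormedSpace ℝ E] [FiniteDimensional ℝ E]
  {M : Type*} [TopologicalSpace M] [ChartedSpace E M] [IsManifold 𝓘(ℝ, E) ∞ M]

lemma mdifferentiable_of_mem_maximalAtlas {e : OpenPartialHomeomorph M E}
    (he : e ∈ IsManifold.maximalAtlas 𝓘(ℝ, E) ∞ M) :
    e.MDifferentiable 𝓘(ℝ, E) 𝓘(ℝ, E) :=
  ⟨(contMDiffOn_of_mem_maximalAtlas he).mdifferentiableOn (by simp),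
    (contMDiffOn_symm_of_mem_maximalAtlas he).mdifferentiableOn (by simp)⟩

/-- The coordinate expression of a vector field in a chart. -/
def coordField (Z : VField E M) (e : OpenPartialHomeomorph M E) (y : E) : E :=
  dAt E E e (e.symm y) (vecAt Z (e.symm y))

/-- The vector field which is constant in a chart. -/
def constField (e : OpenPartialHomeomorph M E) (u : E) : VField E M := fun x =>
  dAt E E e.symm (e x) u

section

variable {e : OpenPartialHomeomorph M E} (he : e ∈ IsManifold.maximalAtlas 𝓘(ℝ, E) ∞ M)
include he

lemma dAt_symm_dAt {x : M} (hx : x ∈ e.source) (v : E) :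
    dAt E E e.symm (e x) (dAt E E e x v) = v :=
  congrArg (fun T : E →L[ℝ] E => T v)
    ((mdifferentiable_of_mem_maximalAtlas he).symm_comp_deriv hx)

lemma dAt_dAt_symm' {y : E} (hy : y ∈ e.target) (v : E) :
    dAt E E e (e.symm y) (dAt E E e.symm y v) = v :=
  congrArg (fun T : E →L[ℝ] E => T v)
    ((mdifferentiable_of_mem_maximalAtlas he).comp_symm_deriv hy)

lemma dAt_symm_dAt' {y : E} (hy : y ∈ e.target) (v : E) :
    dAt E E e.symm y (dAt E E e (e.symm y) v) = v := by
  have h := dAt_symm_dAt he (e.map_target hy) v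
  rwa [e.right_inv hy] at h

lemma dAt_dAt_symm {x : M} (hx : x ∈ e.source) (v : E) :
    dAt E E e x (dAt E E e.symm (e x) v) = v := by
  have h := dAt_dAt_symm' he (e.map_source hx) v
  rwa [e.left_inv hx] at h

lemma isInvertible_dAt_symm {y : E} (hy : y ∈ e.target) : (dAt E E e.symm y).IsInvertible :=
  ContinuousLinearMap.IsInvertible.of_inverse (g := dAt E E e (e.symm y))
    (by ext v; exact dAt_symm_dAt' he hy v) (by ext v; exact dAt_dAt_symm' he hy v)

lemma isInvertible_dAt {x : M} (hx : x ∈ e.source) : (dAt E E e x).IsInvertible :=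
  ContinuousLinearMap.IsInvertible.of_inverse (g := dAt E E e.symm (e x))
    (by ext v; exact dAt_dAt_symm he hx v) (by ext v; exact dAt_symm_dAt he hx v)

lemma inverse_dAt_symm {y : E} (hy : y ∈ e.target) :
    (dAt E E e.symm y).inverse = dAt E E e (e.symm y) :=
  ContinuousLinearMap.inverse_eq
    (by ext v; exact dAt_symm_dAt' he hy v) (by ext v; exact dAt_dAt_symm' he hy v)

lemma inverse_dAt {x : M} (hx : x ∈ e.source) :
    (dAt E E e x).inverse = dAt E E e.symm (e x) :=
  ContinuousLinearMap.inverse_eq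
    (by ext v; exact dAt_dAt_symm he hx v) (by ext v; exact dAt_symm_dAt he hx v)

lemma vecAt_constField_symm {y : E} (hy : y ∈ e.target) (u : E) :
    vecAt (constField e u) (e.symm y) = dAt E E e.symm y u := by
  rw [vecAt, constField, e.right_inv hy]

lemma contMDiffAt_constField {x : M} (hx : x ∈ e.source) (u : E) :
    ContMDiffAt 𝓘(ℝ, E) 𝓘(ℝ, E).tangent ∞
      (fun x => (⟨x, constField e u x⟩ : TangentBundle 𝓘(ℝ, E) M)) x := by
  have h := ContMDiffAt.mpullback_vectorField_preimage (m := ∞) (n := ∞) (x₀ := x)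
    (contMDiffAt_vectorSpace_iff_contDiffAt.2 contDiffAt_const)
    (contMDiffAt_of_mem_maximalAtlas he hx) (isInvertible_dAt he hx) (by simp) (V := fun _ => u)
  refine h.congr_of_eventuallyEq (Filter.eventuallyEq_of_mem (e.open_source.mem_nhds hx)
    fun z hz => ?_)
  have : constField e u z = VectorField.mpullback 𝓘(ℝ, E) 𝓘(ℝ, E) e (fun _ => u) z :=
    congrArg (fun T : E →L[ℝ] E => T u) (inverse_dAt he hz).symm
  simp only [this]

lemma mpullback_eq_coordField {Z : VField E M} {y : E} (hy : y ∈ e.target) :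
    VectorField.mpullback 𝓘(ℝ, E) 𝓘(ℝ, E) e.symm Z y = coordField Z e y :=
  congrArg (fun T : E →L[ℝ] E => T (vecAt Z (e.symm y))) (inverse_dAt_symm he hy)

lemma contDiffAt_coordField {Z : VField E M} {y : E} (hy : y ∈ e.target)
    (hZ : ContMDiffAt 𝓘(ℝ, E) 𝓘(ℝ, E).tangent ∞
      (fun x => (⟨x, Z x⟩ : TangentBundle 𝓘(ℝ, E) M)) (e.symm y)) :
    ContDiffAt ℝ ∞ (coordField Z e) y := by
  have h := ContMDiffAt.mpullback_vectorField_preimage (n := ∞) hZ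
    (contMDiffAt_symm_of_mem_maximalAtlas he hy) (isInvertible_dAt_symm he hy) (by simp)
  refine (contMDiffAt_vectorSpace_iff_contDiffAt.1 h).congr_of_eventuallyEq ?_
  exact Filter.eventuallyEq_of_mem (e.open_target.mem_nhds hy)
    fun z hz => (mpullback_eq_coordField he hz).symm

lemma dAt_symm_coordField {Z : VField E M} {y : E} (hy : y ∈ e.target) :
    dAt E E e.symm y (coordField Z e y) = vecAt Z (e.symm y) :=
  dAt_symm_dAt' he hy _

end

/-- The field of bilinear forms `g` is smooth. -/
def IsSmoothForm (g : BilinField E M) : Prop :=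
  ContMDiff 𝓘(ℝ, E) (𝓘(ℝ, E).prod 𝓘(ℝ, E →L[ℝ] E →L[ℝ] ℝ)) ∞
    (fun x => TotalSpace.mk' (E →L[ℝ] E →L[ℝ] ℝ)
      (E := fun x : M => TangentSpace 𝓘(ℝ, E) x →L[ℝ] TangentSpace 𝓘(ℝ, E) x →L[ℝ] ℝ) x (g x))

lemma IsSmoothForm.contMDiffAt_apply {g : BilinField E M} (hg : IsSmoothForm g) {V W : VField E M}
    {x : M}
    (hV : ContMDiffAt 𝓘(ℝ, E) 𝓘(ℝ, E).tangent ∞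
      (fun x => (⟨x, V x⟩ : TangentBundle 𝓘(ℝ, E) M)) x)
    (hW : ContMDiffAt 𝓘(ℝ, E) 𝓘(ℝ, E).tangent ∞
      (fun x => (⟨x, W x⟩ : TangentBundle 𝓘(ℝ, E) M)) x) :
    ContMDiffAt 𝓘(ℝ, E) 𝓘(ℝ, ℝ) ∞ (fun x => formAt g x (vecAt V x) (vecAt W x)) x := by
  have : ContMDiffAt 𝓘(ℝ, E) (𝓘(ℝ, E).prod 𝓘(ℝ, ℝ)) ∞
      (fun x => TotalSpace.mk' ℝ (E := Bundle.Trivial M ℝ) x (g x (V x) (W x))) x := by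
    apply ContMDiffAt.clm_bundle_apply₂ (F₁ := E) (F₂ := E)
    · exact hg x
    · exact hV
    · exact hW
  simp only [contMDiffAt_totalSpace] at this
  exact this.2

lemma coordMetric_apply (g : BilinField E M) (e : OpenPartialHomeomorph M E) (y u v : E) :
    coordMetric g e y u v =
      formAt g (e.symm y) (dAt E E e.symm y u) (dAt E E e.symm y v) := rfl

lemma IsSmoothForm.contDiffAt_coordMetric {g : BilinField E M} (hg : IsSmoothForm g)
    {e : OpenPartialHomeomorph M E} (he : e ∈ IsManifold.maximalAtlas 𝓘(ℝ, E) ∞ M) {y : E}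
    (hy : y ∈ e.target) : ContDiffAt ℝ ∞ (coordMetric g e) y := by
  refine contDiffAt_clm_of_apply fun u => contDiffAt_clm_of_apply fun v => ?_
  have h1 := hg.contMDiffAt_apply (contMDiffAt_constField he (e.map_target hy) u)
    (contMDiffAt_constField he (e.map_target hy) v)
  have h2 := (h1.comp y (contMDiffAt_symm_of_mem_maximalAtlas he hy)).contDiffAt
  refine h2.congr_of_eventuallyEq (Filter.eventuallyEq_of_mem (e.open_target.mem_nhds hy)
    fun z hz => ?_)
  simp only [comp]
  rw [coordMetric_apply, ← vecAt_constField_symm he hz, ← vecAt_constField_symm he hz]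

/-- A smooth pseudo-Riemannian metric. -/
structure IsPseudoMetric (g : BilinField E M) : Prop where
  smooth : IsSmoothForm g
  symm : ∀ x u v, formAt g x u v = formAt g x v u
  nondeg : ∀ x u, (∀ w, formAt g x u w = 0) → u = 0

/-- The coordinate expression of a smooth, symmetric and nondegenerate form. -/
lemma IsPseudoMetric.isCoordMetricOn {g : BilinField E M} (hg : IsPseudoMetric g)
    {e : OpenPartialHomeomorph M E} (he : e ∈ IsManifold.maximalAtlas 𝓘(ℝ, E) ∞ M) :
    IsCoordMetricOn (coordMetric g e) e.target where
  isOpen := e.open_target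
  contDiffOn := fun _ hy => (hg.smooth.contDiffAt_coordMetric he hy).contDiffWithinAt
  symm := fun _ _ _ _ => hg.symm _ _ _
  nondeg := fun y hy u hu => by
    have h : dAt E E e.symm y u = 0 := hg.nondeg _ _ fun w => by
      have := hu (dAt E E e (e.symm y) w)
      rwa [coordMetric_apply, dAt_symm_dAt' he hy] at this
    have h2 := dAt_dAt_symm' he hy u
    rw [h, map_zero] at h2
    exact h2.symm

/-- The Killing and totally geodesic conditions quantify over global fields. This turns a field
defined on an open set into a global one without changing it near a point; the vanishing off `O`
later preserves tangency to the submanifold. -/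
lemma exists_bump_smul_field [T2Space M] {O : Set M} (hO : IsOpen O) {x : M} (hx : x ∈ O)
    {V : VField E M} (hV : ∀ z ∈ O, ContMDiffAt 𝓘(ℝ, E) 𝓘(ℝ, E).tangent ∞
      (fun x => (⟨x, V x⟩ : TangentBundle 𝓘(ℝ, E) M)) z) :
    ∃ f : M → ℝ, (∀ᶠ z in 𝓝 x, f z = 1) ∧ (∀ z ∉ O, f z = 0) ∧
      IsSmoothField (fun z => f z • V z) := by
  obtain ⟨f, hf, -⟩ := (SmoothBumpFunction.nhds_basis_support (I := 𝓘(ℝ, E))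
    (hO.mem_nhds hx)).mem_iff.1 (hO.mem_nhds hx)
  refine ⟨f, f.eventuallyEq_one, fun z hz => ?_, ?_⟩
  · by_contra h
    exact hz (hf (subset_tsupport _ h))
  · exact ContMDiffOn.smul_section_of_tsupport f.contMDiff.contMDiffOn hO hf
      fun z hz => (hV z hz).contMDiffWithinAt

lemma coordMetric_chart {g : BilinField E M} {e : OpenPartialHomeomorph M E}
    (he : e ∈ IsManifold.maximalAtlas 𝓘(ℝ, E) ∞ M) {x : M} (hx : x ∈ e.source) (u v : E) :
    coordMetric g e (e x) (dAt E E e x u) (dAt E E e x v) = formAt g x u v := by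
  rw [coordMetric_apply, dAt_symm_dAt he hx, dAt_symm_dAt he hx, e.left_inv hx]

lemma coordField_chart {Z : VField E M} {e : OpenPartialHomeomorph M E} {x : M}
    (hx : x ∈ e.source) : coordField Z e (e x) = dAt E E e x (vecAt Z x) := by
  rw [coordField, e.left_inv hx]

/-- The Lie bracket is natural under pullback by the chart, where `V` is the constant `u`, and there
`[Z,u] = -DZ(u)`. -/
lemma mlieBracket_constField {Z : VField E M} (hZ : IsSmoothField Z)
    {e : OpenPartialHomeomorph M E} (he : e ∈ IsManifold.maximalAtlas 𝓘(ℝ, E) ∞ M) {y : E}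
    (hy : y ∈ e.target) {V : VField E M} {u : E}
    (hV : ∀ᶠ x in 𝓝 (e.symm y), vecAt V x = vecAt (constField e u) x)
    (hVs : IsSmoothField V) :
    vecAt (VectorField.mlieBracket 𝓘(ℝ, E) Z V) (e.symm y) =
      dAt E E e.symm y (- fderiv ℝ (coordField Z e) y u) := by
  have : IsManifold 𝓘(ℝ, E) (minSmoothness ℝ 2) M :=
    IsManifold.of_le (n := ∞) (by simpa using two_le_smooth)
  have h := VectorField.mpullback_mlieBracket (n := ∞) (f := e.symm) (x₀ := y)
    ((hZ _).mdifferentiableAt (by simp)) ((hVs _).mdifferentiableAt (by simp))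
    (contMDiffAt_symm_of_mem_maximalAtlas he hy) (by simpa using two_le_smooth)
  have e1 : VectorField.mpullback 𝓘(ℝ, E) 𝓘(ℝ, E) e.symm Z =ᶠ[𝓝 y] coordField Z e :=
    Filter.eventuallyEq_of_mem (e.open_target.mem_nhds hy)
      fun z hz => mpullback_eq_coordField he hz
  have e2 : VectorField.mpullback 𝓘(ℝ, E) 𝓘(ℝ, E) e.symm V =ᶠ[𝓝 y] fun _ => u := by
    filter_upwards [e.open_target.mem_nhds hy,
      (e.continuousAt_symm hy).eventually hV] with z hz hz'
    refine (mpullback_eq_coordField he hz).trans ?_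
    rw [coordField, hz', vecAt_constField_symm he hz, dAt_dAt_symm' he hz]
  have h3 : VectorField.lieBracket ℝ (coordField Z e) (fun _ => u) y =
      - fderiv ℝ (coordField Z e) y u := by
    simp [VectorField.lieBracket]
  have h4 : VectorField.mlieBracket 𝓘(ℝ, E) (VectorField.mpullback 𝓘(ℝ, E) 𝓘(ℝ, E) e.symm Z)
      (VectorField.mpullback 𝓘(ℝ, E) 𝓘(ℝ, E) e.symm V) y =
      VectorField.lieBracket ℝ (coordField Z e) (fun _ => u) y := by
    refine (e1.mlieBracket_vectorField_eq e2).trans ?_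
    exact (congrFun VectorField.mlieBracketWithin_univ.symm y).trans
      ((congrFun VectorField.mlieBracketWithin_eq_lieBracketWithin y).trans
        (congrFun VectorField.lieBracketWithin_univ y))
  have h5 : dAt E E e (e.symm y) (vecAt (VectorField.mlieBracket 𝓘(ℝ, E) Z V) (e.symm y)) =
      - fderiv ℝ (coordField Z e) y u :=
    (mpullback_eq_coordField he hy).symm.trans (h.trans (h4.trans h3))
  rw [← h5, dAt_symm_dAt' he hy]

/-- The Killing equation in a chart. -/
lemma IsKillingField.isCoordKillingOn [T2Space M] {g : BilinField E M} (hg : IsPseudoMetric g)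
    {Z : VField E M} (hZ : IsKillingField g Z)
    {e : OpenPartialHomeomorph M E} (he : e ∈ IsManifold.maximalAtlas 𝓘(ℝ, E) ∞ M) :
    IsCoordKillingOn (coordMetric g e) (coordField Z e) e.target where
  metric := hg.isCoordMetricOn he
  contDiffOn := fun _ hy => (contDiffAt_coordField he hy (hZ.1 _)).contDiffWithinAt
  killing := fun y hy u v => by
    have hsrc := e.map_target hy
    -- Global test fields that are constant in the chart near the given point.
    have hex : ∀ w : E, ∃ V : VField E M, IsSmoothField V ∧
        ∀ᶠ x in 𝓝 (e.symm y), vecAt V x = vecAt (constField e w) x := fun w => by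
      obtain ⟨f, h1, -, h3⟩ := exists_bump_smul_field e.open_source hsrc
        (V := constField e w) fun z hz => contMDiffAt_constField he hz w
      refine ⟨_, h3, ?_⟩
      filter_upwards [h1] with z hz
      change f z • vecAt (constField e w) z = _
      rw [hz, one_smul]
    obtain ⟨U, hU, hU'⟩ := hex u
    obtain ⟨V, hV, hV'⟩ := hex v
    have h : dAt E ℝ (fun z => formAt g z (vecAt U z) (vecAt V z)) (e.symm y)
        (vecAt Z (e.symm y)) =
        formAt g (e.symm y) (vecAt (VectorField.mlieBracket 𝓘(ℝ, E) Z U) (e.symm y))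
          (vecAt V (e.symm y)) +
        formAt g (e.symm y) (vecAt U (e.symm y))
          (vecAt (VectorField.mlieBracket 𝓘(ℝ, E) Z V) (e.symm y)) := hZ.2 U V hU hV (e.symm y)
    rw [mlieBracket_constField hZ.1 he hy hU' hU, mlieBracket_constField hZ.1 he hy hV' hV,
      hU'.self_of_nhds, hV'.self_of_nhds, vecAt_constField_symm he hy, vecAt_constField_symm he hy,
      ← dAt_symm_coordField he hy, ← coordMetric_apply, ← coordMetric_apply] at h
    have hk : MDifferentiableAt 𝓘(ℝ, E) 𝓘(ℝ, ℝ)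
        (fun z => formAt g z (vecAt U z) (vecAt V z)) (e.symm y) :=
      (hg.smooth.contMDiffAt_apply (hU _) (hV _)).mdifferentiableAt (by simp)
    have hcomp := fderiv_comp_dAt hk
      ((contMDiffAt_symm_of_mem_maximalAtlas he hy).mdifferentiableAt (by simp))
    have hev : (fun z => formAt g (e.symm z) (vecAt U (e.symm z)) (vecAt V (e.symm z))) =ᶠ[𝓝 y]
        fun z => coordMetric g e z u v := by
      filter_upwards [e.open_target.mem_nhds hy, (e.continuousAt_symm hy).eventually hU',
        (e.continuousAt_symm hy).eventually hV'] with z hz h1 h2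
      rw [h1, h2, vecAt_constField_symm he hz, vecAt_constField_symm he hz, coordMetric_apply]
    have hd : HasFDerivAt (coordMetric g e) (fderiv ℝ (coordMetric g e) y) y :=
      ((hg.smooth.contDiffAt_coordMetric he hy).differentiableAt (by simp)).hasFDerivAt
    have hd2 := (hd.clm_apply (hasFDerivAt_const u y)).clm_apply (hasFDerivAt_const v y)
    rw [hev.fderiv_eq, hd2.fderiv] at hcomp
    have h4 := congrArg (fun T : E →L[ℝ] ℝ => T (coordField Z e y)) hcomp
    simp only [ContinuousLinearMap.comp_apply, h] at h4
    simp at h4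
    rw [h4]
    ring

end ChartBridge

/-! ### Lorentzian linear algebra, and convex functions bounded above. -/

section LorentzAlgebra

variable {E : Type*} [NormedAddCommGroup E] [NormedSpace ℝ E]

/-- A symmetric bilinear form of signature `(-,+,…,+)`. -/
structure IsLorentzForm (B : E →L[ℝ] E →L[ℝ] ℝ) : Prop where
  symm : ∀ u v, B u v = B v u
  index_one : ∃ v, B v v < 0 ∧ ∀ w, w ≠ 0 → B v w = 0 → 0 < B w w

namespace IsLorentzForm

variable {B : E →L[ℝ] E →L[ℝ] ℝ}

lemma nondeg (hB : IsLorentzForm B) {u : E} (h : ∀ w, B u w = 0) : u = 0 := by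
  obtain ⟨v, -, hv⟩ := hB.index_one
  by_contra hu
  exact (hv u hu (by rw [hB.symm, h])).ne' (h u)

/-- Subtracting the multiple `c • n` that makes `w` orthogonal to a timelike `v` does not change the
square of `w`, because `n` is null and orthogonal to `w`. On the complement of `v` the form is
positive definite. -/
lemma exists_nonneg_of_orthogonal_null (hB : IsLorentzForm B) {n w : E} (hn : n ≠ 0)
    (hnn : B n n = 0) (hnw : B n w = 0) :
    0 ≤ B w w ∧ (B w w = 0 → ∃ c : ℝ, w = c • n) := by
  obtain ⟨v, hv, hpos⟩ := hB.index_one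
  have hvn : B v n ≠ 0 := fun h => (hpos n hn h).ne' hnn
  let c := B v w / B v n
  have h1 : B v (w - c • n) = 0 := by
    simp only [map_sub, map_smul, smul_eq_mul, c]
    field_simp
    ring
  have h2 : B (w - c • n) (w - c • n) = B w w := by
    simp only [map_sub, map_smul, smul_eq_mul, sub_apply, smul_apply, hnn, hnw, hB.symm w n]
    ring
  by_cases h3 : w - c • n = 0
  · rw [← h2, h3]
    exact ⟨by simp, fun _ => ⟨c, sub_eq_zero.1 h3⟩⟩
  · have := hpos _ h3 h1
    rw [h2] at this
    exact ⟨this.le, fun h => absurd h this.ne'⟩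

lemma timelike_null_ne_zero (hB : IsLorentzForm B) {n z : E} (hn : n ≠ 0) (hnn : B n n = 0)
    (hz : B z z < 0) : B n z ≠ 0 := fun h =>
  (hB.exists_nonneg_of_orthogonal_null hn hnn h).1.not_gt hz

/-- Null vectors span in dimension at least two: if `v` is timelike and `w ≠ 0` is orthogonal to it,
then `r • v + w` and `r • v - w` are null for a suitable `r ≠ 0`, and they span the same plane as
`v` and `w`. -/
lemma eq_zero_of_null (hB : IsLorentzForm B) (hE : 1 < Module.finrank ℝ E) {Y : Type*}
    [AddCommGroup Y] [Module ℝ Y] {T : E →ₗ[ℝ] Y} (hT : ∀ n, n ≠ 0 → B n n = 0 → T n = 0) :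
    T = 0 := by
  obtain ⟨v, hv, hpos⟩ := hB.index_one
  have hv' : B v v ≠ 0 := hv.ne
  have hTn : ∀ n, B n n = 0 → T n = 0 := fun n hn => by
    by_cases h : n = 0
    · rw [h, map_zero]
    · exact hT n h hn
  have key : ∀ w, w ≠ 0 → B v w = 0 → T w = 0 ∧ T v = 0 := by
    intro w hw hvw
    have hs := hpos w hw hvw
    let r := Real.sqrt (B w w / -B v v)
    have hr : r ^ 2 * B v v = - B w w := by
      have : r ^ 2 = B w w / -B v v := Real.sq_sqrt (div_nonneg hs.le (by linarith))
      rw [this]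
      field_simp
    have hr0 : r ≠ 0 := by
      intro h
      rw [h] at hr
      simp only [ne_eq, OfNat.ofNat_ne_zero, not_false_eq_true, zero_pow, zero_mul] at hr
      linarith
    have h1 : T (r • v + w) = 0 := hTn _ <| by
      simp only [map_add, map_smul, smul_eq_mul, add_apply, smul_apply, hvw, hB.symm w v]
      linarith
    have h2 : T (r • v - w) = 0 := hTn _ <| by
      simp only [map_sub, map_smul, smul_eq_mul, sub_apply, smul_apply, hvw, hB.symm w v]
      linarith
    rw [map_add, map_smul] at h1
    rw [map_sub, map_smul, sub_eq_zero] at h2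
    rw [h2, ← two_smul ℝ, smul_eq_zero] at h1
    have h3 : T w = 0 := h1.resolve_left two_ne_zero
    rw [h3, smul_eq_zero] at h2
    exact ⟨h3, h2.resolve_left hr0⟩
  have hdec : ∀ u, B v (u - (B v u / B v v) • v) = 0 := fun u => by
    simp only [map_sub, map_smul, smul_eq_mul]
    field_simp
    ring
  have hv0 : v ≠ 0 := by
    rintro rfl
    simp at hv
  have hTv : T v = 0 := by
    -- The dimension supplies a nonzero vector orthogonal to `v`, without which nothing would be
    -- known about `T v`.
    obtain ⟨u, hu⟩ := exists_linearIndependent_pair_of_one_lt_finrank hE hv0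
    refine (key _ ?_ (hdec u)).2
    intro h
    rw [LinearIndependent.pair_iff] at hu
    have := (hu (-(B v u / B v v)) 1 (by rw [← h]; module)).2
    exact one_ne_zero this
  ext u
  have hu : u = (u - (B v u / B v v) • v) + (B v u / B v v) • v := by abel
  rw [hu, map_add, map_smul, hTv, smul_zero, add_zero]
  by_cases h : u - (B v u / B v v) • v = 0
  · rw [h]; simp
  · rw [(key _ h (hdec u)).1]; rfl

end IsLorentzForm

/-- A twice differentiable convex function on the line which is bounded above is constant. -/
lemma deriv_eq_zero_of_convex_of_bounded {f f' f'' : ℝ → ℝ} {C : ℝ} (h1 : ∀ t, HasDerivAt f (f' t) t)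
    (h2 : ∀ t, HasDerivAt f' (f'' t) t) (hpos : ∀ t, 0 ≤ f'' t) (hC : ∀ t, f t ≤ C) (t : ℝ) :
    f' t = 0 := by
  have hmono : Monotone f' := monotone_of_hasDerivAt_nonneg h2 hpos
  have hdiff : Differentiable ℝ f := fun t => (h1 t).differentiableAt
  have hder : ∀ t, deriv f t = f' t := fun t => (h1 t).deriv
  -- A convex function lies above its tangent line at `t`.
  have htan : ∀ s, f t + f' t * (s - t) ≤ f s := by
    intro s
    rcases le_total t s with hs | hs
    · have := (convex_Ici t).mul_sub_le_image_sub_of_le_deriv hdiff.continuous.continuousOn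
        hdiff.differentiableOn (C := f' t) (fun x hx => by
          rw [interior_Ici] at hx
          rw [hder]
          exact hmono (le_of_lt hx)) t (mem_Ici.2 le_rfl) s hs hs
      linarith
    · have := (convex_Iic t).image_sub_le_mul_sub_of_deriv_le hdiff.continuous.continuousOn
        hdiff.differentiableOn (C := f' t) (fun x hx => by
          rw [interior_Iic] at hx
          rw [hder]
          exact hmono (le_of_lt hx)) s hs t (mem_Iic.2 le_rfl) hs
      linarith
  by_contra hne
  -- At this point the tangent line takes the value `C + 1`.
  have h := htan (t + (C - f t + 1) / f' t)
  have h' := hC (t + (C - f t + 1) / f' t)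
  have : f' t * (t + (C - f t + 1) / f' t - t) = C - f t + 1 := by field_simp; ring
  linarith

end LorentzAlgebra

/-! ### The Killing field is parallel. -/

section Parallel

variable {E : Type*} [NormedAddCommGroup E] [NormedSpace ℝ E] [FiniteDimensional ℝ E]
  {M : Type*} [TopologicalSpace M] [ChartedSpace E M] [IsManifold 𝓘(ℝ, E) ∞ M]

lemma IsLorentzianMetric.isLorentzForm {g : BilinField E M} (hg : IsLorentzianMetric g) (x : M) :
    IsLorentzForm (formAt g x) :=
  ⟨hg.symm x, hg.index_one x⟩

lemma IsLorentzianMetric.isPseudoMetric {g : BilinField E M} (hg : IsLorentzianMetric g) :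
    IsPseudoMetric g :=
  ⟨hg.contMDiff, hg.symm, fun x _ h => (hg.isLorentzForm x).nondeg h⟩

lemma velocity_eq {γ : ℝ → M} {t : ℝ} {p : M} {v : TangentSpace 𝓘(ℝ, E) p}
    (h : velocity (E := E) γ t = ⟨p, v⟩) : γ t = p ∧ dAt ℝ E γ t 1 = v :=
  ⟨congrArg TotalSpace.proj h, congrArg (fun z : TangentBundle 𝓘(ℝ, E) M => (z.snd : E)) h⟩

lemma hasDerivAt_chart {γ : ℝ → M} (hγ : MDifferentiable 𝓘(ℝ, ℝ) 𝓘(ℝ, E) γ)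
    {e : OpenPartialHomeomorph M E} (he : e ∈ IsManifold.maximalAtlas 𝓘(ℝ, E) ∞ M) {t : ℝ}
    (ht : γ t ∈ e.source) :
    HasDerivAt (fun s => e (γ s)) (dAt E E e (γ t) (dAt ℝ E γ t 1)) t := by
  have h1 := (mdifferentiable_of_mem_maximalAtlas he).mdifferentiableAt ht
  have h2 : DifferentiableAt ℝ (fun s => e (γ s)) t := (h1.comp t (hγ t)).differentiableAt
  refine h2.hasDerivAt.congr_deriv ?_
  rw [← fderiv_apply_one_eq_deriv, fderiv_comp_dAt h1 (hγ t)]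
  rfl

/-- The covariant derivative of a vector field at a point, in the chart at this point. -/
def chartNabla (g : BilinField E M) (Z : VField E M) (e : OpenPartialHomeomorph M E) (y u : E) : E :=
  fderiv ℝ (coordField Z e) y u + christoffel (coordMetric g e) y u (coordField Z e y)

/-- The curvature form, on vectors of the model space. -/
def curvAt (g : BilinField E M) (p : M) (u v : E) : ℝ := curvatureForm g p u v

/-- A vector field which is parallel at each point, in the preferred chart at the point. -/
def IsParallelField (g : BilinField E M) (Z : VField E M) : Prop :=
  ∀ (p : M) (u : E), chartNabla g Z (chartAt E p) (chartAt E p p) u = 0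

section Geodesic

variable {g : BilinField E M} {Z : VField E M} [T2Space M]

lemma IsGeodesic.contDiffAt_chart {γ : ℝ → M} (hγ : IsGeodesic g γ)
    {e : OpenPartialHomeomorph M E} (he : e ∈ IsManifold.maximalAtlas 𝓘(ℝ, E) ∞ M) {t : ℝ}
    (ht : γ t ∈ e.source) : ContDiffAt ℝ ∞ (fun s => e (γ s)) t :=
  ((contMDiffAt_of_mem_maximalAtlas he ht).comp t (hγ.1 t)).contDiffAt

variable (hg : IsLorentzianMetric g) (hZ : IsKillingField g Z)
include hg hZ

/-- Facts about a geodesic near one of its points, in terms of a Killing field. -/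
lemma IsGeodesic.killing_facts {γ : ℝ → M} (hγ : IsGeodesic g γ) (t : ℝ) :
    HasDerivAt (fun s => formAt g (γ s) (dAt ℝ E γ s 1) (dAt ℝ E γ s 1)) 0 t ∧
    HasDerivAt (fun s => formAt g (γ s) (vecAt Z (γ s)) (dAt ℝ E γ s 1)) 0 t ∧
    ∃ W : E, W = chartNabla g Z (chartAt E (γ t)) (chartAt E (γ t) (γ t))
        (dAt E E (chartAt E (γ t)) (γ t) (dAt ℝ E γ t 1)) ∧
      formAt g (γ t) (dAt ℝ E γ t 1) (dAt E E (chartAt E (γ t)).symm (chartAt E (γ t) (γ t)) W) = 0 ∧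
      deriv (fun s => formAt g (γ s) (vecAt Z (γ s)) (vecAt Z (γ s))) t =
        2 * formAt g (γ t) (dAt E E (chartAt E (γ t)).symm (chartAt E (γ t) (γ t)) W)
          (vecAt Z (γ t)) ∧
      DifferentiableAt ℝ (fun s => formAt g (γ s) (vecAt Z (γ s)) (vecAt Z (γ s))) t ∧
      HasDerivAt (deriv (fun s => formAt g (γ s) (vecAt Z (γ s)) (vecAt Z (γ s))))
        (2 * (- curvAt g (γ t) (vecAt Z (γ t)) (dAt ℝ E γ t 1) +
          formAt g (γ t) (dAt E E (chartAt E (γ t)).symm (chartAt E (γ t) (γ t)) W)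
            (dAt E E (chartAt E (γ t)).symm (chartAt E (γ t) (γ t)) W))) t := by
  have he : chartAt E (γ t) ∈ IsManifold.maximalAtlas 𝓘(ℝ, E) ∞ M := IsManifold.chart_mem_maximalAtlas _
  have hx : γ t ∈ (chartAt E (γ t)).source := mem_chart_source _ _
  have hgeo := hγ.2 _ (chart_mem_atlas E (γ t))
  -- The chart at `γ t` is fixed once and used for all times near `t`.
  obtain ⟨e, hee⟩ : ∃ e, e = chartAt E (γ t) := ⟨_, rfl⟩
  have hcurv : curvAt g (γ t) (vecAt Z (γ t)) (dAt ℝ E γ t 1) =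
      coordMetric g e (e (γ t)) (coordRiemann (coordMetric g e) (e (γ t))
        (dAt E E e (γ t) (vecAt Z (γ t))) (dAt E E e (γ t) (dAt ℝ E γ t 1))
        (dAt E E e (γ t) (dAt ℝ E γ t 1))) (dAt E E e (γ t) (vecAt Z (γ t))) := by
    rw [hee]; rfl
  rw [hcurv]
  rw [← hee] at he hx hgeo ⊢
  clear hcurv
  have hK := hZ.isCoordKillingOn hg.isPseudoMetric he
  have hmd : MDifferentiable 𝓘(ℝ, ℝ) 𝓘(ℝ, E) γ := hγ.1.mdifferentiable (by simp)
  let c : ℝ → E := fun s => e (γ s)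
  have hev : ∀ᶠ s in 𝓝 t, γ s ∈ e.source :=
    hγ.1.continuous.continuousAt.eventually (e.open_source.mem_nhds hx)
  have hcd : ∀ s, γ s ∈ e.source → HasDerivAt c (dAt E E e (γ s) (dAt ℝ E γ s 1)) s :=
    fun s hs => hasDerivAt_chart hmd he hs
  have hder : ∀ s, γ s ∈ e.source → deriv c s = dAt E E e (γ s) (dAt ℝ E γ s 1) :=
    fun s hs => (hcd s hs).deriv
  have hsm : ContDiffAt ℝ 2 c t := (hγ.contDiffAt_chart he hx).of_le two_le_smooth
  have hct : c t ∈ e.target := e.map_source hx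
  have h2 : HasDerivAt (deriv c) (deriv (deriv c) t) t := by
    have h : ContDiffAt ℝ 1 (fderiv ℝ c) t := hsm.fderiv_right (m := 1) (by norm_num)
    have h' : DifferentiableAt ℝ (fun s => fderiv ℝ c s 1) t :=
      (h.clm_apply contDiffAt_const).differentiableAt (by simp)
    exact h'.hasDerivAt
  have hZc : HasDerivAt (fun s => coordField Z e (c s))
      (fderiv ℝ (coordField Z e) (c t) (deriv c t)) t :=
    HasFDerivAt.comp_hasDerivAt t (hK.hasFDerivAt hct)
      (hsm.differentiableAt (by simp)).hasDerivAt
  have hzz : ∀ s, γ s ∈ e.source → formAt g (γ s) (vecAt Z (γ s)) (vecAt Z (γ s)) =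
      coordMetric g e (c s) (coordField Z e (c s)) (coordField Z e (c s)) := fun s hs => by
    rw [coordField_chart hs, coordMetric_chart he hs]
  have hW : ∀ w : E, coordMetric g e (e (γ t)) w (dAt E E e (γ t) (vecAt Z (γ t))) =
      formAt g (γ t) (dAt E E e.symm (e (γ t)) w) (vecAt Z (γ t)) := fun w => by
    rw [← coordMetric_chart he hx, dAt_dAt_symm he hx]
  refine ⟨?_, ?_, _, rfl, ?_, ?_, ?_, ?_⟩
  · have := hK.metric.hasDerivAt_apply hct (hsm.differentiableAt (by simp)).hasDerivAt h2 h2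
    rw [hgeo t hx] at this
    simp only [map_zero, zero_apply, add_zero] at this
    refine this.congr_of_eventuallyEq ?_
    filter_upwards [hev] with s hs
    rw [hder s hs, coordMetric_chart he hs]
  · have := hK.metric.hasDerivAt_apply hct (hsm.differentiableAt (by simp)).hasDerivAt hZc h2
    rw [hgeo t hx, map_zero, add_zero] at this
    -- Skewness on the pair `(c',c')` says that the derivative of `Z` along `c'` is orthogonal to
    -- `c'`; with `c''+Γ(c',c') = 0` this is the conservation of `g(Z,c')`.
    have hsk := hK.skew hct (deriv c t) (deriv c t)
    rw [hK.metric.symm _ hct (deriv c t), ← two_mul, mul_eq_zero] at hsk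
    rw [hsk.resolve_left two_ne_zero] at this
    refine this.congr_of_eventuallyEq ?_
    filter_upwards [hev] with s hs
    rw [hder s hs, coordField_chart hs, coordMetric_chart he hs]
  · have hsk := hK.skew hct (deriv c t) (deriv c t)
    rw [hK.metric.symm _ hct (deriv c t), ← two_mul, mul_eq_zero] at hsk
    have := hsk.resolve_left two_ne_zero
    rw [hder t hx] at this
    rw [hg.isPseudoMetric.symm, ← coordMetric_chart he hx, dAt_dAt_symm he hx]
    exact this
  · have := hK.hasDerivAt_normSq hct (hsm.differentiableAt (by simp))
    have h3 := this.congr_of_eventuallyEq (f₁ := fun s => formAt g (γ s) (vecAt Z (γ s))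
      (vecAt Z (γ s))) (by filter_upwards [hev] with s hs using hzz s hs)
    rw [h3.deriv, ← hW, ← coordField_chart hx, hder t hx]
    rfl
  · have := hK.hasDerivAt_normSq hct (hsm.differentiableAt (by simp))
    exact (this.congr_of_eventuallyEq
      (by filter_upwards [hev] with s hs using hzz s hs)).differentiableAt
  · have h3 := (hK.hasDerivAt_deriv_normSq hct hsm (hgeo t hx)).const_mul 2
    have hev2 : deriv (fun s => formAt g (γ s) (vecAt Z (γ s)) (vecAt Z (γ s))) =ᶠ[𝓝 t]
        fun s => 2 * coordMetric g e (c s) (fderiv ℝ (coordField Z e) (c s) (deriv c s) +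
          christoffel (coordMetric g e) (c s) (deriv c s) (coordField Z e (c s)))
            (coordField Z e (c s)) := by
      filter_upwards [hev.eventually_nhds] with s hs
      have h4 := hK.hasDerivAt_normSq (e.map_source hs.self_of_nhds)
        (hcd s hs.self_of_nhds).differentiableAt
      exact (h4.congr_of_eventuallyEq
        (by filter_upwards [hs] with r hr using hzz r hr)).deriv
    refine (h3.congr_of_eventuallyEq hev2).congr_deriv ?_
    rw [← coordMetric_chart he hx, dAt_dAt_symm he hx, hder t hx, ← coordField_chart hx]
    rfl

/-- A timelike Killing field with nonnegative timelike sectional curvatures on a null complete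
Lorentzian manifold is parallel. -/
theorem IsKillingField.isParallelField (hE : 1 < Module.finrank ℝ E) (hZt : IsTimelikeField g Z)
    (hnull : IsNullComplete g)
    (hK : ∀ (p : M) (v : TangentSpace 𝓘(ℝ, E) p), LinearIndependent ℝ ![Z p, v] →
      0 ≤ sectionalCurvature g p (Z p) v) : IsParallelField g Z := by
  intro p
  have hmax : chartAt E p ∈ IsManifold.maximalAtlas 𝓘(ℝ, E) ∞ M := IsManifold.chart_mem_maximalAtlas _
  have hmem : p ∈ (chartAt E p).source := mem_chart_source _ _
  have hLp := hg.isLorentzForm p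
  -- It suffices to treat null directions, since they span.
  have key : ∀ n : E, n ≠ 0 → formAt g p n n = 0 →
      chartNabla g Z (chartAt E p) (chartAt E p p) (dAt E E (chartAt E p) p n) = 0 := by
    intro n hn0 hnn
    obtain ⟨γ, hγ, hv⟩ := hnull p n hn0 hnn
    obtain ⟨hγ0, hn⟩ := velocity_eq hv
    subst hγ0
    have hnull : ∀ t, formAt g (γ t) (dAt ℝ E γ t 1) (dAt ℝ E γ t 1) = 0 := fun t => by
      have h := is_const_of_deriv_eq_zero (f := fun s => formAt g (γ s) (dAt ℝ E γ s 1)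
        (dAt ℝ E γ s 1)) (fun s => (hγ.killing_facts hg hZ s).1.differentiableAt)
        (fun s => (hγ.killing_facts hg hZ s).1.deriv) t 0
      simp only [hn] at h
      exact h.trans hnn
    -- The product is conserved, and at time zero a timelike vector is not orthogonal to a null one.
    have hne : ∀ t, formAt g (γ t) (vecAt Z (γ t)) (dAt ℝ E γ t 1) ≠ 0 := fun t => by
      have h := is_const_of_deriv_eq_zero (f := fun s => formAt g (γ s) (vecAt Z (γ s))
        (dAt ℝ E γ s 1)) (fun s => (hγ.killing_facts hg hZ s).2.1.differentiableAt)
        (fun s => (hγ.killing_facts hg hZ s).2.1.deriv) t 0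
      simp only [hn] at h
      rw [h, hLp.symm]
      exact hLp.timelike_null_ne_zero hn0 hnn (hZt _)
    have hv0 : ∀ t, dAt ℝ E γ t 1 ≠ 0 := fun t h => hne t (by rw [h, map_zero])
    -- As the velocity is null, the denominator of the sectional curvature is `-g(Z,γ')² < 0`, so
    -- nonnegative curvature means a nonpositive numerator.
    have hcurv : ∀ t, curvAt g (γ t) (vecAt Z (γ t)) (dAt ℝ E γ t 1) ≤ 0 := fun t => by
      have hli : LinearIndependent ℝ ![vecAt Z (γ t), dAt ℝ E γ t 1] := by
        rw [LinearIndependent.pair_iff]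
        intro a b hab
        have h1 := congrArg (fun w => formAt g (γ t) w (dAt ℝ E γ t 1)) hab
        simp only [map_add, map_smul, add_apply, smul_apply, smul_eq_mul, hnull, mul_zero,
          add_zero, map_zero, zero_apply, mul_eq_zero] at h1
        have ha := h1.resolve_right (hne t)
        rw [ha, zero_smul, zero_add, smul_eq_zero] at hab
        exact ⟨ha, hab.resolve_right (hv0 t)⟩
      have h : 0 ≤ curvAt g (γ t) (vecAt Z (γ t)) (dAt ℝ E γ t 1) /
          (formAt g (γ t) (vecAt Z (γ t)) (vecAt Z (γ t)) *
            formAt g (γ t) (dAt ℝ E γ t 1) (dAt ℝ E γ t 1) -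
            formAt g (γ t) (vecAt Z (γ t)) (dAt ℝ E γ t 1) ^ 2) := hK (γ t) (show E from dAt ℝ E γ t 1) hli
      rw [hnull, mul_zero, zero_sub] at h
      by_contra hc
      push Not at hc
      have h2 : 0 < formAt g (γ t) (vecAt Z (γ t)) (dAt ℝ E γ t 1) ^ 2 := by
        have := hne t
        positivity
      exact (div_neg_of_pos_of_neg hc (neg_lt_zero.2 h2)).not_ge h
    choose W hWdef hWorth hd1 hd2 hd3 using fun t => (hγ.killing_facts hg hZ t).2.2
    have hWnn := fun t =>
      (hg.isLorentzForm (γ t)).exists_nonneg_of_orthogonal_null (hv0 t) (hnull t) (hWorth t)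
    -- `g(Z,Z)` along `γ` is convex and negative on the whole line, hence constant.
    have hzero := deriv_eq_zero_of_convex_of_bounded (C := 0) (fun t => (hd2 t).hasDerivAt) hd3
      (fun t => mul_nonneg zero_le_two (by linarith [hcurv t, (hWnn t).1]))
      (fun t => (hZt (γ t)).le)
    have hz2 : deriv (fun s => formAt g (γ s) (vecAt Z (γ s)) (vecAt Z (γ s))) = fun _ => 0 :=
      funext hzero
    have h3 := hd3 0
    rw [hz2] at h3
    have h4 := h3.unique (hasDerivAt_const 0 0)
    -- Both nonnegative terms of the second derivative vanish. So the derivative `W` of `Z` is null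
    -- and orthogonal to the velocity, hence a multiple `c` of it; the vanishing first derivative `2
    -- * c * g(γ',Z)` then forces `c = 0`.
    have h5 := (hWnn 0).2 (by linarith [hcurv 0, (hWnn 0).1])
    obtain ⟨c, hc⟩ := h5
    have h6 := hd1 0
    rw [hzero 0, hc, map_smul, smul_apply, smul_eq_mul, hLp.symm] at h6
    have hc0 : c = 0 := by
      by_contra hc0
      exact mul_ne_zero two_ne_zero (mul_ne_zero hc0 (hne 0)) h6.symm
    rw [hc0, zero_smul] at hc
    have h7 := dAt_dAt_symm hmax hmem (W 0)
    rw [hc, map_zero] at h7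
    rw [← hn, ← hWdef 0, ← h7]
  have hlin : ((fderiv ℝ (coordField Z (chartAt E p)) (chartAt E p p) +
      (christoffelMap (coordMetric g (chartAt E p)) (chartAt E p p)).flip
        (coordField Z (chartAt E p) (chartAt E p p))).comp
          (dAt E E (chartAt E p) p) : E →L[ℝ] E).toLinearMap = 0 :=
    hLp.eq_zero_of_null hE fun n h1 h2 => key n h1 h2
  intro u
  have h := congrArg (fun T : E →ₗ[ℝ] E =>
    T (dAt E E (chartAt E p).symm (chartAt E p p) u)) hlin
  simp only [ContinuousLinearMap.coe_coe, ContinuousLinearMap.comp_apply,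
    dAt_dAt_symm hmax hmem, LinearMap.zero_apply] at h
  exact h

end Geodesic

end Parallel

/-! ### Slice charts and the Hessian of a totally geodesic inclusion. -/

section Submanifold

variable {E : Type*} [NormedAddCommGroup E] [NormedSpace ℝ E] [FiniteDimensional ℝ E]
  {M : Type*} [TopologicalSpace M] [ChartedSpace E M] [IsManifold 𝓘(ℝ, E) ∞ M]
  {F : Type*} [NormedAddCommGroup F] [NormedSpace ℝ F] [FiniteDimensional ℝ F]
  {L : Type*} [TopologicalSpace L] [ChartedSpace F L] [IsManifold 𝓘(ℝ, F) ∞ L]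

/-- Charts `φ` of `L` and `Ψ` of `M` in which `i : L → M` is the linear map `J` with left inverse
`R`, such that the points of `L` in the open set `O` are those in the domain of `φ`. -/
structure IsSliceChart (i : L → M) (φ : OpenPartialHomeomorph L F) (Ψ : OpenPartialHomeomorph M E)
    (O : Set M) (J : F →L[ℝ] E) (R : E →L[ℝ] F) : Prop where
  mem_dom : φ ∈ IsManifold.maximalAtlas 𝓘(ℝ, F) ∞ L
  mem_cod : Ψ ∈ IsManifold.maximalAtlas 𝓘(ℝ, E) ∞ M
  isOpen : IsOpen O
  subset_source : O ⊆ Ψ.source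
  preimage : i ⁻¹' O = φ.source
  eq_linear : ∀ z ∈ φ.source, Ψ (i z) = J (φ z)
  left_inv : ∀ u, R (J u) = u

/-- The linear normal form comes from the immersion. The topological embedding provides `O`, which
no other sheet of `L` enters. -/
lemma exists_isSliceChart {i : L → M} (hi : Manifold.IsSmoothEmbedding 𝓘(ℝ, F) 𝓘(ℝ, E) ∞ i) (q : L) :
    ∃ φ Ψ O J R, IsSliceChart (E := E) (F := F) i φ Ψ O J R ∧ q ∈ φ.source := by
  have h := hi.isImmersion.isImmersionAt q
  obtain ⟨O, hO, hpre⟩ := hi.isEmbedding.isOpen_iff.1 h.domChart.open_source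
  refine ⟨h.domChart, h.codChart, O ∩ h.codChart.source,
    (h.equiv : (F × h.complement) →L[ℝ] E).comp (ContinuousLinearMap.inl ℝ F h.complement),
    (ContinuousLinearMap.fst ℝ F h.complement).comp
      (h.equiv.symm : E →L[ℝ] (F × h.complement)),
    ⟨h.domChart_mem_maximalAtlas, h.codChart_mem_maximalAtlas, hO.inter h.codChart.open_source,
      inter_subset_right, ?_, ?_, ?_⟩, h.mem_domChart_source⟩
  · rw [preimage_inter, hpre]
    exact inter_eq_left.2 h.source_subset_preimage_source
  · intro z hz
    have h1 := h.writtenInCharts (show h.domChart z ∈ (h.domChart.extend 𝓘(ℝ, F)).target by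
      simpa using h.domChart.map_source hz)
    simpa [h.domChart.left_inv hz] using h1
  · intro u
    simp

variable {i : L → M}

lemma contDiffAt_coord_map (hi : ContMDiff 𝓘(ℝ, F) 𝓘(ℝ, E) ∞ i) {φ : OpenPartialHomeomorph L F}
    (hφ : φ ∈ IsManifold.maximalAtlas 𝓘(ℝ, F) ∞ L) {e : OpenPartialHomeomorph M E}
    (he : e ∈ IsManifold.maximalAtlas 𝓘(ℝ, E) ∞ M) {x : F} (hx : x ∈ φ.target)
    (hx' : i (φ.symm x) ∈ e.source) : ContDiffAt ℝ ∞ (fun z => e (i (φ.symm z))) x :=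
  ((contMDiffAt_of_mem_maximalAtlas he hx').comp x
    ((hi _).comp x (contMDiffAt_symm_of_mem_maximalAtlas hφ hx))).contDiffAt

lemma fderiv_coord_map (hi : ContMDiff 𝓘(ℝ, F) 𝓘(ℝ, E) ∞ i) {φ : OpenPartialHomeomorph L F}
    (hφ : φ ∈ IsManifold.maximalAtlas 𝓘(ℝ, F) ∞ L) {e : OpenPartialHomeomorph M E}
    (he : e ∈ IsManifold.maximalAtlas 𝓘(ℝ, E) ∞ M) {x : F} (hx : x ∈ φ.target)
    (hx' : i (φ.symm x) ∈ e.source) (u : F) :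
    fderiv ℝ (fun z => e (i (φ.symm z))) x u =
      dAt E E e (i (φ.symm x)) (dAt F E i (φ.symm x) (dAt F F φ.symm x u)) := by
  have h1 : MDifferentiableAt 𝓘(ℝ, F) 𝓘(ℝ, F) φ.symm x :=
    (contMDiffAt_symm_of_mem_maximalAtlas hφ hx).mdifferentiableAt (by simp)
  have h2 : MDifferentiableAt 𝓘(ℝ, F) 𝓘(ℝ, E) i (φ.symm x) := (hi _).mdifferentiableAt (by simp)
  have h3 : MDifferentiableAt 𝓘(ℝ, E) 𝓘(ℝ, E) e (i (φ.symm x)) :=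
    (contMDiffAt_of_mem_maximalAtlas he hx').mdifferentiableAt (by simp)
  have h4 := fderiv_comp_dAt (f := fun z => i (φ.symm z)) h3 (h2.comp x h1)
  rw [h4, dAt_comp h2 h1]
  rfl

namespace IsSliceChart

variable {φ : OpenPartialHomeomorph L F} {Ψ : OpenPartialHomeomorph M E} {O : Set M}
  {J : F →L[ℝ] E} {R : E →L[ℝ] F} (h : IsSliceChart i φ Ψ O J R)
include h

lemma mem_open {q : L} (hq : q ∈ φ.source) : i q ∈ O := h.preimage.symm.subset hq

lemma dAt_eq (hi : ContMDiff 𝓘(ℝ, F) 𝓘(ℝ, E) ∞ i) {q : L} (hq : q ∈ φ.source) (u : F) :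
    dAt E E Ψ (i q) (dAt F E i q u) = J (dAt F F φ q u) := by
  have hx := φ.map_source hq
  have h1 := fderiv_coord_map hi h.mem_dom h.mem_cod hx
    (by rw [φ.left_inv hq]; exact h.subset_source (h.mem_open hq)) (dAt F F φ q u)
  rw [φ.left_inv hq, dAt_symm_dAt h.mem_dom hq] at h1
  have h2 : (fun z => Ψ (i (φ.symm z))) =ᶠ[𝓝 (φ q)] J := by
    filter_upwards [φ.open_target.mem_nhds hx] with z hz
    rw [h.eq_linear _ (φ.map_target hz), φ.right_inv hz]
  rw [← h1, h2.fderiv_eq, J.fderiv]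

lemma dAt_injective (hi : ContMDiff 𝓘(ℝ, F) 𝓘(ℝ, E) ∞ i) {q : L} (hq : q ∈ φ.source) {u : F}
    (hu : dAt F E i q u = 0) : u = 0 := by
  have h1 := h.dAt_eq hi hq u
  rw [hu, map_zero] at h1
  have h2 := h.left_inv (dAt F F φ q u)
  rw [← h1, map_zero] at h2
  have h3 := dAt_symm_dAt h.mem_dom hq u
  rw [← h2, map_zero] at h3
  exact h3.symm

/-- A vector is tangent to the submanifold if its coordinate expression is in the slice. -/
lemma exists_of_slice (hi : ContMDiff 𝓘(ℝ, F) 𝓘(ℝ, E) ∞ i) {q : L} (hq : q ∈ φ.source) {w : E}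
    (hw : J (R (dAt E E Ψ (i q) w)) = dAt E E Ψ (i q) w) : ∃ u, dAt F E i q u = w := by
  refine ⟨dAt F F φ.symm (φ q) (R (dAt E E Ψ (i q) w)), ?_⟩
  have hΨ := h.subset_source (h.mem_open hq)
  rw [← dAt_symm_dAt h.mem_cod hΨ w, ← dAt_symm_dAt h.mem_cod hΨ (dAt F E i q _), h.dAt_eq hi hq,
    dAt_dAt_symm h.mem_dom hq, dAt_symm_dAt h.mem_cod hΨ, hw,
    dAt_symm_dAt h.mem_cod hΨ]

/-- In a slice chart of a totally geodesic submanifold, the Hessian of the inclusion is tangent. -/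
lemma mapHessian_mem_range [T2Space M] (hi : ContMDiff 𝓘(ℝ, F) 𝓘(ℝ, E) ∞ i) {g : BilinField E M}
    (hL : IsTotallyGeodesic F g i) {q : L} (hq : q ∈ φ.source) (u v : F) :
    ∃ w : F, mapHessian (coordMetric g (chartAt E (i q)))
        (fun z => chartAt E (i q) (i (φ.symm z))) (φ q) u v =
      fderiv ℝ (fun z => chartAt E (i q) (i (φ.symm z))) (φ q) w := by
  obtain ⟨e, hee⟩ : ∃ e, e = chartAt E (i q) := ⟨_, rfl⟩
  have he : e ∈ IsManifold.maximalAtlas 𝓘(ℝ, E) ∞ M := hee ▸ IsManifold.chart_mem_maximalAtlas _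
  have hp : i q ∈ e.source := hee ▸ mem_chart_source _ _
  have hx := φ.map_source hq
  have hx' : i (φ.symm (φ q)) ∈ e.source := by rwa [φ.left_inv hq]
  -- The coordinate direction `v` of `L` is extended to the field `J v` of the slice chart and cut
  -- off inside `O`. It is tangent at every point of `L`: in `O` because `L` is the slice there,
  -- outside because the field is zero.
  obtain ⟨f, hf1, hf0, hV⟩ := exists_bump_smul_field h.isOpen (h.mem_open hq)
    (V := constField Ψ (J v))
    fun z hz => contMDiffAt_constField h.mem_cod (h.subset_source hz) _
  let V : VField E M := fun z => f z • constField Ψ (J v) z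
  have hVi : ∀ z ∈ φ.source, vecAt (constField Ψ (J v)) (i z) =
      dAt F E i z (dAt F F φ.symm (φ z) v) := fun z hz => by
    have h1 := dAt_symm_dAt h.mem_cod (h.subset_source (h.mem_open hz))
      (dAt F E i z (dAt F F φ.symm (φ z) v))
    rw [h.dAt_eq hi hz, dAt_dAt_symm h.mem_dom hz] at h1
    exact h1
  have htan : ∀ z : L, IsTangentTo F i z (V (i z)) := by
    intro z
    by_cases hz : i z ∈ O
    · have hz' : z ∈ φ.source := h.preimage.subset hz
      refine ⟨(f (i z) • dAt F F φ.symm (φ z) v : F), ?_⟩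
      change dAt F E i z (f (i z) • dAt F F φ.symm (φ z) v) = f (i z) • vecAt (constField Ψ (J v)) (i z)
      rw [hVi z hz', map_smul]
    · refine ⟨(0 : F), ?_⟩
      change dAt F E i z 0 = f (i z) • vecAt (constField Ψ (J v)) (i z)
      rw [hf0 _ hz, map_zero, zero_smul]
  obtain ⟨w, hw⟩ : ∃ w : F, _ := hL V hV htan q (show E from dAt F E i q (dAt F F φ.symm (φ q) u)) ⟨_, rfl⟩
  refine ⟨dAt F F φ q w, ?_⟩
  have hcov : dAt F E i q w = (dAt E E e (i q)).inverse
      (fderiv ℝ (coordField V e) (e (i q)) (dAt E E e (i q)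
        (dAt F E i q (dAt F F φ.symm (φ q) u))) +
        christoffel (coordMetric g e) (e (i q))
          (dAt E E e (i q) (dAt F E i q (dAt F F φ.symm (φ q) u)))
          (coordField V e (e (i q)))) := by
    rw [hee]; exact hw
  rw [← hee]
  rw [inverse_dAt he hp] at hcov
  have hcov2 := congrArg (dAt E E e (i q)) hcov
  rw [dAt_dAt_symm he hp] at hcov2
  have hFd := fun u => fderiv_coord_map hi h.mem_dom he hx hx' u
  simp only [φ.left_inv hq] at hFd
  rw [hFd, dAt_symm_dAt h.mem_dom hq, hcov2, ← hFd, mapHessian]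
  have hsm := contDiffAt_coord_map hi h.mem_dom he hx hx'
  have hev : ∀ᶠ z in 𝓝 (φ q), z ∈ φ.target ∧ i (φ.symm z) ∈ e.source ∧ f (i (φ.symm z)) = 1 := by
    have hc : Filter.Tendsto (fun z => i (φ.symm z)) (𝓝 (φ q)) (𝓝 (i q)) := by
      have h0 : ContinuousAt (fun z => i (φ.symm z)) (φ q) :=
        hi.continuous.continuousAt.comp (φ.continuousAt_symm hx)
      have h1 := h0.tendsto
      rwa [φ.left_inv hq] at h1
    filter_upwards [φ.open_target.mem_nhds hx, hc.eventually (e.open_source.mem_nhds hp),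
      hc.eventually hf1] with z h1 h2 h3 using ⟨h1, h2, h3⟩
  -- Near the point `DF v` is the restriction of `V` to `L`, so the Hessian of the inclusion is the
  -- covariant derivative of `V`, which is tangent by hypothesis.
  have hcoord : ∀ z, z ∈ φ.target ∧ i (φ.symm z) ∈ e.source ∧ f (i (φ.symm z)) = 1 →
      fderiv ℝ (fun z => e (i (φ.symm z))) z v = coordField V e (e (i (φ.symm z))) := by
    rintro z ⟨h1, h2, h3⟩
    rw [coordField_chart h2, fderiv_coord_map hi h.mem_dom he h1 h2]
    change _ = dAt E E e _ (f (i (φ.symm z)) • vecAt (constField Ψ (J v)) (i (φ.symm z)))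
    rw [h3, one_smul, hVi _ (φ.map_target h1), φ.right_inv h1]
  have hVd : DifferentiableAt ℝ (coordField V e) (e (i (φ.symm (φ q)))) :=
    (contDiffAt_coordField he (e.map_source hx') (hV _)).differentiableAt (by simp)
  have h5 : fderiv ℝ (fun z => fderiv ℝ (fun z => e (i (φ.symm z))) z v) (φ q) =
      (fderiv ℝ (coordField V e) (e (i (φ.symm (φ q))))).comp
        (fderiv ℝ (fun z => e (i (φ.symm z))) (φ q)) := by
    rw [Filter.EventuallyEq.fderiv_eq (hev.mono hcoord)]
    exact fderiv_comp (g := coordField V e) _ hVd (hsm.differentiableAt (by simp))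
  rw [h5, hcoord _ hev.self_of_nhds, φ.left_inv hq]
  rfl

end IsSliceChart

end Submanifold

/-! ### The Hessian under changes of variables and isometries. -/

section HessianTransformation

variable {E : Type*} [NormedAddCommGroup E] [NormedSpace ℝ E] [FiniteDimensional ℝ E]
  {K : Type*} [NormedAddCommGroup K] [NormedSpace ℝ K] [FiniteDimensional ℝ K]
  {X : Type*} [NormedAddCommGroup X] [NormedSpace ℝ X]

lemma fderiv_fderiv_comp_apply {τ : K → E} {F : X → K} {x : X} (hτ : ContDiffAt ℝ 2 τ (F x))
    (hF : ContDiffAt ℝ 2 F x) (u v : X) :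
    fderiv ℝ (fun z => fderiv ℝ (fun y => τ (F y)) z v) x u =
      fderiv ℝ (fun z => fderiv ℝ τ z (fderiv ℝ F x v)) (F x) (fderiv ℝ F x u) +
        fderiv ℝ τ (F x) (fderiv ℝ (fun z => fderiv ℝ F z v) x u) := by
  have hFd : ∀ᶠ z in 𝓝 x, DifferentiableAt ℝ F z :=
    (hF.eventually (by simp)).mono fun z hz => hz.differentiableAt (by simp)
  have hτd : ∀ᶠ z in 𝓝 x, DifferentiableAt ℝ τ (F z) :=
    hF.continuousAt.eventually
      ((hτ.eventually (by simp)).mono fun z hz => hz.differentiableAt (by simp))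
  have hev : (fun z => fderiv ℝ (fun y => τ (F y)) z v) =ᶠ[𝓝 x]
      fun z => fderiv ℝ τ (F z) (fderiv ℝ F z v) := by
    filter_upwards [hFd, hτd] with z h1 h2
    rw [show (fun y => τ (F y)) = τ ∘ F from rfl, fderiv_comp _ h2 h1]
    rfl
  have h1 : HasFDerivAt (fun z => fderiv ℝ τ (F z))
      ((fderiv ℝ (fderiv ℝ τ) (F x)).comp (fderiv ℝ F x)) x :=
    HasFDerivAt.comp (g := fderiv ℝ τ) x
      ((hτ.fderiv_right (m := 1) (by norm_num)).differentiableAt (by simp)).hasFDerivAt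
      (hF.differentiableAt (by simp)).hasFDerivAt
  rw [hev.fderiv_eq, (h1.clm_apply (hasFDerivAt_fderiv_apply hF v)).fderiv,
    fderiv_fderiv_apply hτ, fderiv_fderiv_apply hF]
  simp [add_comm]

/-- The Hessian of a map after a change of variables in the source. -/
lemma mapHessian_comp {G : E → E →L[ℝ] E →L[ℝ] ℝ} {τ : K → E} {F : X → K} {x : X}
    (hτ : ContDiffAt ℝ 2 τ (F x)) (hF : ContDiffAt ℝ 2 F x) (u v : X) :
    mapHessian G (fun y => τ (F y)) x u v =
      mapHessian G τ (F x) (fderiv ℝ F x u) (fderiv ℝ F x v) +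
        fderiv ℝ τ (F x) (fderiv ℝ (fun z => fderiv ℝ F z v) x u) := by
  have h : fderiv ℝ (fun y => τ (F y)) x = (fderiv ℝ τ (F x)).comp (fderiv ℝ F x) :=
    fderiv_comp (g := τ) x (hτ.differentiableAt (by simp)) (hF.differentiableAt (by simp))
  rw [mapHessian, fderiv_fderiv_comp_apply hτ hF, mapHessian, h]
  simp only [ContinuousLinearMap.comp_apply]
  abel

namespace IsCoordMetricOn

variable {G : E → E →L[ℝ] E →L[ℝ] ℝ} {Ω : Set E} {G' : K → K →L[ℝ] K →L[ℝ] ℝ} {Ω' : Set K}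

/-- The transformation law of the Christoffel symbols under an isometry. -/
lemma mapHessian_eq_of_isometry (hG : IsCoordMetricOn G Ω) (hG' : IsCoordMetricOn G' Ω')
    {τ : K → E} {y : K} (hy : y ∈ Ω') (hτy : τ y ∈ Ω) (hτ : ContDiffAt ℝ 2 τ y)
    (hsurj : Surjective (fderiv ℝ τ y))
    (hiso : ∀ᶠ z in 𝓝 y, ∀ a b, G (τ z) (fderiv ℝ τ z a) (fderiv ℝ τ z b) = G' z a b) (u v : K) :
    mapHessian G τ y u v = fderiv ℝ τ y (christoffel G' y u v) := by
  -- Both terms account for the derivative of the same metric `G'`, so `D`, paired with the image of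
  -- the derivative, has the symmetry and skewness of Koszul's argument. Surjectivity of the
  -- derivative then gives `D = 0`.
  let D : K → K → E := fun u v => mapHessian G τ y u v - fderiv ℝ τ y (christoffel G' y u v)
  have hDs : ∀ u v, D u v = D v u := fun u v => by
    simp only [D]
    rw [hG.mapHessian_comm hτy hτ, hG'.christoffel_comm hy]
  have key : ∀ a b u, G (τ y) (D u a) (fderiv ℝ τ y b) + G (τ y) (D u b) (fderiv ℝ τ y a) = 0 := by
    intro a b u
    obtain ⟨T, hT, h'⟩ := hG.hasFDerivAt_pullback hτy hτ a b
    obtain ⟨T', hT', h''⟩ := hG'.hasFDerivAt_apply (f := fun z => z) hy (hasFDerivAt_id y)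
      (hasFDerivAt_const a y) (hasFDerivAt_const b y)
    have h1 := hT.unique (hT'.congr_of_eventuallyEq (hiso.mono fun z hz => hz a b))
    have h2 := h' u
    rw [h1, h''] at h2
    simp only [zero_apply, zero_add, ContinuousLinearMap.id_apply] at h2
    rw [← hiso.self_of_nhds, ← hiso.self_of_nhds] at h2
    simp only [D, map_sub, sub_apply]
    rw [hG.symm _ hτy (mapHessian G τ y u b), hG.symm _ hτy (fderiv ℝ τ y (christoffel G' y u b))]
    linarith
  refine sub_eq_zero.1 (hG.nondeg _ hτy _ fun w => ?_)
  obtain ⟨w, rfl⟩ := hsurj w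
  change G (τ y) (D u v) _ = 0
  have h1 := key v w u
  have h2 := key u w v
  have h3 := key u v w
  rw [hDs v u] at h2
  rw [hDs w u, hDs w v] at h3
  linarith

/-- The Hessian is natural under isometries of the target. -/
lemma mapHessian_isometry_comp (hG : IsCoordMetricOn G Ω) (hG' : IsCoordMetricOn G' Ω')
    {τ : K → E} {F : X → K} {x : X} (hy : F x ∈ Ω') (hτy : τ (F x) ∈ Ω)
    (hτ : ContDiffAt ℝ 2 τ (F x)) (hF : ContDiffAt ℝ 2 F x) (hsurj : Surjective (fderiv ℝ τ (F x)))
    (hiso : ∀ᶠ z in 𝓝 (F x), ∀ a b, G (τ z) (fderiv ℝ τ z a) (fderiv ℝ τ z b) = G' z a b) (u v : X) :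
    mapHessian G (fun z => τ (F z)) x u v = fderiv ℝ τ (F x) (mapHessian G' F x u v) := by
  rw [mapHessian_comp hτ hF, hG.mapHessian_eq_of_isometry hG' hy hτy hτ hsurj hiso, mapHessian,
    map_add, add_comm]

end IsCoordMetricOn

end HessianTransformation

/-! ### A parallel rank-one form and a parallel one-form give flat coordinates. -/

section FlatNull

variable {F : Type*} [NormedAddCommGroup F] [NormedSpace ℝ F] [FiniteDimensional ℝ F]

/-- A degenerate form `B` and a one-form `η` on an open set, with `B + η ⊗ η` positive definite, which
are parallel for a (pointwise given) torsion-free connection. -/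
structure IsParallelPair (B : F → F →L[ℝ] F →L[ℝ] ℝ) (η : F → F →L[ℝ] ℝ) (U : Set F) : Prop where
  isOpen : IsOpen U
  contDiffAt_form : ∀ x ∈ U, ContDiffAt ℝ ∞ B x
  contDiffAt_one : ∀ x ∈ U, ContDiffAt ℝ ∞ η x
  symm : ∀ x ∈ U, ∀ u v, B x u v = B x v u
  null : ∀ x ∈ U, ∃ n, n ≠ 0 ∧ ∀ v, B x n v = 0
  pos : ∀ x ∈ U, ∀ v, v ≠ 0 → 0 < B x v v + η x v * η x v
  parallel : ∀ x ∈ U, ∃ T : F → F → F, (∀ u v, T u v = T v u) ∧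
    (∀ w a b, fderiv ℝ B x w a b = B x (T w a) b + B x a (T w b)) ∧
    ∀ w a, fderiv ℝ η x w a = η x (T w a)

namespace IsParallelPair

variable {B : F → F →L[ℝ] F →L[ℝ] ℝ} {η : F → F →L[ℝ] ℝ} {U : Set F} (h : IsParallelPair B η U)
include h

/-- In dimension two `η` has a nonzero kernel, where `B` alone must be positive. -/
lemma exists_pos (hF : Module.finrank ℝ F = 2) {x : F} (hx : x ∈ U) : ∃ u, 0 < B x u u := by
  have : LinearMap.ker (η x : F →ₗ[ℝ] ℝ) ≠ ⊥ := by
    intro hk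
    have := LinearMap.finrank_le_finrank_of_injective (LinearMap.ker_eq_bot.1 hk)
    rw [hF, Module.finrank_self] at this
    omega
  obtain ⟨u, hu, hu0⟩ := Submodule.exists_mem_ne_zero_of_ne_bot this
  have hu' : η x u = 0 := hu
  have := h.pos x hx u hu0
  rw [hu', mul_zero, add_zero] at this
  exact ⟨u, this⟩

/-- The Gram determinant of a degenerate form vanishes. -/
lemma gram (hF : Module.finrank ℝ F = 2) {x : F} (hx : x ∈ U) {u : F} (hu : B x u u ≠ 0) (a v : F) :
    B x a v * B x u u = B x a u * B x u v := by
  obtain ⟨n, hn0, hn⟩ := h.null x hx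
  -- The vector `u` and the null vector `n` form a basis, in which only the coefficient of `u` is
  -- seen by `B`.
  have hli : LinearIndependent ℝ ![u, n] := by
    rw [LinearIndependent.pair_iff]
    intro s t hst
    have h1 := congrArg (B x u) hst
    rw [map_add, map_smul, map_smul, h.symm x hx u n, hn, smul_zero, add_zero, map_zero,
      smul_eq_mul, mul_eq_zero] at h1
    have hs := h1.resolve_right hu
    rw [hs, zero_smul, zero_add, smul_eq_zero] at hst
    exact ⟨hs, hst.resolve_right hn0⟩
  have hspan : ∀ a : F, ∃ s t : ℝ, s • u + t • n = a := fun a => by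
    have := hli.span_eq_top_of_card_eq_finrank' (by simp [hF])
    have ha : a ∈ Submodule.span ℝ (range ![u, n]) := this ▸ Submodule.mem_top
    simp only [Matrix.range_cons, Matrix.range_empty, union_empty, singleton_union] at ha
    exact Submodule.mem_span_pair.1 ha
  obtain ⟨s, t, rfl⟩ := hspan a
  simp only [map_add, map_smul, add_apply, smul_apply, smul_eq_mul, hn, mul_zero, add_zero]
  ring

/-- The square root of the degenerate form, as a one-form. -/
lemma fderiv_root (hF : Module.finrank ℝ F = 2) {x : F} (hx : x ∈ U) {u : F} (hu : 0 < B x u u) :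
    ContDiffAt ℝ ∞ (fun z => (Real.sqrt (B z u u))⁻¹ • B z u) x ∧
    ∀ w v, fderiv ℝ (fun z => (Real.sqrt (B z u u))⁻¹ • B z u) x w v =
      fderiv ℝ (fun z => (Real.sqrt (B z u u))⁻¹ • B z u) x v w := by
  have hB := h.contDiffAt_form x hx
  have hBu : ContDiffAt ℝ ∞ (fun z => B z u) x := hB.clm_apply contDiffAt_const
  have hβ : ContDiffAt ℝ ∞ (fun z => B z u u) x := hBu.clm_apply contDiffAt_const
  have hr0 : Real.sqrt (B x u u) ≠ 0 := (Real.sqrt_pos.2 hu).ne'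
  have hr : ContDiffAt ℝ ∞ (fun z => (Real.sqrt (B z u u))⁻¹) x := (hβ.sqrt hu.ne').inv hr0
  refine ⟨hr.smul hBu, ?_⟩
  obtain ⟨T, hTs, hTB, -⟩ := h.parallel x hx
  have hBd := (hB.differentiableAt (by simp)).hasFDerivAt
  have hBud : HasFDerivAt (fun z => B z u) ((fderiv ℝ B x).flip u) x := by
    refine (hBd.clm_apply (hasFDerivAt_const u x)).congr_fderiv ?_
    ext; simp
  have hβd : HasFDerivAt (fun z => B z u u) (((fderiv ℝ B x).flip u).flip u) x := by
    refine (hBud.clm_apply (hasFDerivAt_const u x)).congr_fderiv ?_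
    ext; simp
  have hrd := (hasDerivAt_inv hr0).comp_hasFDerivAt x (hβd.sqrt hu.ne')
  -- The root `θ` is itself parallel, `(D_w θ) v = θ(T(w,v))`: the terms with `T(w,u)`, from
  -- `B(u,·)` and from the normalising factor, cancel by the Gram identity. Closedness follows from
  -- the symmetry of `T`.
  have key : ∀ w v, fderiv ℝ (fun z => (Real.sqrt (B z u u))⁻¹ • B z u) x w v =
      (Real.sqrt (B x u u))⁻¹ * B x u (T w v) := by
    intro w v
    have hsm : HasFDerivAt (fun z => (Real.sqrt (B z u u))⁻¹ • B z u) _ x := hrd.smul hBud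
    rw [hsm.fderiv]
    have hg := h.gram hF hx hu.ne' (T w u) v
    simp only [comp_apply, add_apply, smul_apply, ContinuousLinearMap.smulRight_apply,
      ContinuousLinearMap.flip_apply, hTB, smul_eq_mul, h.symm x hx u (T w u)]
    field_simp
    rw [Real.sq_sqrt hu.le]
    linear_combination 2 * hg
  intro w v
  rw [key, key, hTs]

lemma fderiv_one_comm {x : F} (hx : x ∈ U) (w v : F) : fderiv ℝ η x w v = fderiv ℝ η x v w := by
  obtain ⟨T, hTs, -, hT⟩ := h.parallel x hx
  rw [hT, hT, hTs]

/-- Near each point there are coordinates in which `B + η ⊗ η` is the Euclidean metric. -/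
theorem exists_flat_coordinates (hF : Module.finrank ℝ F = 2) {x₀ : F} (hx₀ : x₀ ∈ U) :
    ∃ ψ : OpenPartialHomeomorph F (EuclideanSpace ℝ (Fin 2)), x₀ ∈ ψ.source ∧ ψ.source ⊆ U ∧
      (∀ x ∈ ψ.source, ContDiffAt ℝ ∞ ψ x) ∧ (∀ y ∈ ψ.target, ContDiffAt ℝ ∞ ψ.symm y) ∧
      ∀ x ∈ ψ.source, ∀ a b, B x a b + η x a * η x b =
        inner ℝ (fderiv ℝ ψ x a) (fderiv ℝ ψ x b) := by
  obtain ⟨u, hu⟩ := h.exists_pos hF hx₀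
  have hopen : ∀ᶠ z in 𝓝 x₀, z ∈ U ∧ 0 < B z u u := by
    have hβ : ContinuousAt (fun z => B z u u) x₀ :=
      (((h.contDiffAt_form x₀ hx₀).clm_apply contDiffAt_const).clm_apply
        contDiffAt_const).continuousAt
    exact (h.isOpen.eventually_mem hx₀).and (hβ.eventually (lt_mem_nhds hu))
  obtain ⟨r, hr, hball⟩ := Metric.eventually_nhds_iff_ball.1 hopen
  -- By the Gram identity `B = θ ⊗ θ`. By the Poincaré lemma on the ball, the closed forms `θ` and
  -- `η` have primitives `s` and `t`, which are the flat coordinates.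
  let θ : F → F →L[ℝ] ℝ := fun z => (Real.sqrt (B z u u))⁻¹ • B z u
  have hθ := fun z hz => h.fderiv_root hF (hball z hz).1 (hball z hz).2
  obtain ⟨s, hs⟩ := (convex_ball x₀ r).exists_forall_hasFDerivAt_of_fderiv_symmetric
    Metric.isOpen_ball
    (fun z hz => ((hθ z hz).1.differentiableAt (by simp)).differentiableWithinAt)
    (fun z hz => (hθ z hz).2)
  obtain ⟨t, ht⟩ := (convex_ball x₀ r).exists_forall_hasFDerivAt_of_fderiv_symmetric
    Metric.isOpen_ball
    (fun z hz => ((h.contDiffAt_one z (hball z hz).1).differentiableAt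
      (by simp)).differentiableWithinAt)
    (fun z hz => h.fderiv_one_comm (hball z hz).1)
  let e₀ : EuclideanSpace ℝ (Fin 2) := EuclideanSpace.single 0 1
  let e₁ : EuclideanSpace ℝ (Fin 2) := EuclideanSpace.single 1 1
  let f : F → EuclideanSpace ℝ (Fin 2) := fun z => s z • e₀ + t z • e₁
  let f' : F → F →L[ℝ] EuclideanSpace ℝ (Fin 2) := fun z =>
    (θ z).smulRight e₀ + (η z).smulRight e₁
  have hf : ∀ z ∈ Metric.ball x₀ r, HasFDerivAt f (f' z) z := fun z hz =>
    ((hs z hz).smul_const e₀).add ((ht z hz).smul_const e₁)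
  have hinner : ∀ z ∈ Metric.ball x₀ r, ∀ a b, B z a b + η z a * η z b =
      inner ℝ (f' z a) (f' z b) := by
    intro z hz a b
    have hg := h.gram hF (hball z hz).1 (hball z hz).2.ne' a b
    have hne : Real.sqrt (B z u u) ≠ 0 := (Real.sqrt_pos.2 (hball z hz).2).ne'
    have h1 : θ z a * θ z b = B z a b := by
      simp only [θ, smul_apply, smul_eq_mul]
      rw [h.symm z (hball z hz).1 u a]
      field_simp
      rw [Real.sq_sqrt (hball z hz).2.le, ← hg, mul_comm]
    rw [← h1]
    simp [f', e₀, e₁, PiLp.inner_apply, Fin.sum_univ_two]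
    ring
  -- The inner product pulls back to the positive definite form `B + η ⊗ η`, so the derivative has
  -- no kernel and the inverse function theorem applies.
  have hinj : ∀ z ∈ Metric.ball x₀ r, Injective (f' z) := fun z hz => by
    refine (injective_iff_map_eq_zero _).2 fun v hv => ?_
    by_contra hv0
    have h1 := h.pos z (hball z hz).1 v hv0
    rw [hinner z hz, hv, inner_zero_left] at h1
    exact lt_irrefl _ h1
  have hequiv : ∀ z ∈ Metric.ball x₀ r, ∃ A : F ≃L[ℝ] EuclideanSpace ℝ (Fin 2),
      (A : F →L[ℝ] EuclideanSpace ℝ (Fin 2)) = f' z := fun z hz =>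
    ⟨(LinearEquiv.ofInjectiveOfFinrankEq (f' z : F →ₗ[ℝ] EuclideanSpace ℝ (Fin 2))
      (hinj z hz) (by simp [hF])).toContinuousLinearEquiv, by ext; rfl⟩
  have hsmooth : ContDiffOn ℝ ∞ f (Metric.ball x₀ r) := by
    refine (contDiffOn_infty_iff_fderiv_of_isOpen Metric.isOpen_ball).2
      ⟨fun z hz => (hf z hz).differentiableAt.differentiableWithinAt, ?_⟩
    refine ContDiffOn.congr (f := f') (fun z hz => ?_) fun z hz => (hf z hz).fderiv
    exact (((hθ z hz).1.smulRight contDiffAt_const).add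
      ((h.contDiffAt_one z (hball z hz).1).smulRight contDiffAt_const)).contDiffWithinAt
  have hx : x₀ ∈ Metric.ball x₀ r := Metric.mem_ball_self hr
  obtain ⟨A, hA⟩ := hequiv x₀ hx
  have hfx : ContDiffAt ℝ ∞ f x₀ := hsmooth.contDiffAt (Metric.isOpen_ball.mem_nhds hx)
  let ψ := (hfx.toOpenPartialHomeomorph f (by rw [hA]; exact hf x₀ hx) (by simp)).restr
    (Metric.ball x₀ r)
  have hψ : ψ.source ⊆ Metric.ball x₀ r := by
    rw [OpenPartialHomeomorph.restr_source, Metric.isOpen_ball.interior_eq]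
    exact inter_subset_right
  refine ⟨ψ, ?_, fun z hz => (hball z (hψ hz)).1, fun z hz => ?_, fun y hy => ?_, fun z hz => ?_⟩
  · rw [OpenPartialHomeomorph.restr_source, Metric.isOpen_ball.interior_eq]
    exact ⟨ContDiffAt.mem_toOpenPartialHomeomorph_source _ _ _, hx⟩
  · exact hsmooth.contDiffAt (Metric.isOpen_ball.mem_nhds (hψ hz))
  · have hz := hψ (ψ.map_target hy)
    obtain ⟨A, hA⟩ := hequiv _ hz
    exact ψ.contDiffAt_symm (f₀' := A) hy (by rw [hA]; exact hf _ hz)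
      (hsmooth.contDiffAt (Metric.isOpen_ball.mem_nhds hz))
  · intro a b
    have : fderiv ℝ ψ z = f' z := (hf z (hψ hz)).fderiv
    rw [this, hinner z (hψ hz)]

end IsParallelPair

end FlatNull

/-! ### Vanishing of the Hessian does not depend on the chart. -/

section HessianCongr

variable {E : Type*} [NormedAddCommGroup E] [NormedSpace ℝ E]
  {X : Type*} [NormedAddCommGroup X] [NormedSpace ℝ X]

lemma mapHessian_congr {G : E → E →L[ℝ] E →L[ℝ] ℝ} {F F' : X → E} {x : X} (h : F =ᶠ[𝓝 x] F')
    (u v : X) : mapHessian G F x u v = mapHessian G F' x u v := by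
  have h1 : (fun z => fderiv ℝ F z v) =ᶠ[𝓝 x] fun z => fderiv ℝ F' z v :=
    h.eventuallyEq_nhds.mono fun z hz => by simp only [hz.fderiv_eq]
  rw [mapHessian, mapHessian, h1.fderiv_eq, h.fderiv_eq, h.self_of_nhds]

end HessianCongr

section ChartTransition

variable {E : Type*} [NormedAddCommGroup E] [NormedSpace ℝ E] [FiniteDimensional ℝ E]
  {M : Type*} [TopologicalSpace M] [ChartedSpace E M] [IsManifold 𝓘(ℝ, E) ∞ M]
  {X : Type*} [NormedAddCommGroup X] [NormedSpace ℝ X]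

/-- The Hessian of a map into a manifold, computed in two charts. -/
lemma IsPseudoMetric.mapHessian_chart {g : BilinField E M} (hg : IsPseudoMetric g)
    {e e' : OpenPartialHomeomorph M E} (he : e ∈ IsManifold.maximalAtlas 𝓘(ℝ, E) ∞ M)
    (he' : e' ∈ IsManifold.maximalAtlas 𝓘(ℝ, E) ∞ M) {f : X → M} {x : X} (hf : ContinuousAt f x)
    (hx : f x ∈ e.source) (hx' : f x ∈ e'.source) (hsm : ContDiffAt ℝ 2 (fun z => e' (f z)) x)
    (u v : X) (h0 : mapHessian (coordMetric g e') (fun z => e' (f z)) x u v = 0) :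
    mapHessian (coordMetric g e) (fun z => e (f z)) x u v = 0 := by
  let τ : E → E := fun y => e (e'.symm y)
  have hy : e' (f x) ∈ e'.target := e'.map_source hx'
  have hye : e'.symm (e' (f x)) ∈ e.source := by rwa [e'.left_inv hx']
  have hd : ∀ y ∈ e'.target, e'.symm y ∈ e.source → ContDiffAt ℝ ∞ τ y ∧
      fderiv ℝ τ y = (dAt E E e (e'.symm y)).comp (dAt E E e'.symm y) := fun y h1 h2 =>
    ⟨((contMDiffAt_of_mem_maximalAtlas he h2).comp y
      (contMDiffAt_symm_of_mem_maximalAtlas he' h1)).contDiffAt,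
      fderiv_comp_dAt ((contMDiffAt_of_mem_maximalAtlas he h2).mdifferentiableAt (by simp))
        ((contMDiffAt_symm_of_mem_maximalAtlas he' h1).mdifferentiableAt (by simp))⟩
  have hev : (fun z => e (f z)) =ᶠ[𝓝 x] fun z => τ (e' (f z)) := by
    filter_upwards [hf.eventually (e'.open_source.mem_nhds hx')] with z hz
    simp only [τ, e'.left_inv hz]
  have hτ := hd _ hy hye
  rw [mapHessian_congr hev]
  have h := (hg.isCoordMetricOn he).mapHessian_isometry_comp (hg.isCoordMetricOn he')
    (τ := τ) (F := fun z => e' (f z)) (x := x) hy (e.map_source hye) (hτ.1.of_le two_le_smooth) hsm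
    (fun w => ⟨dAt E E e' (f x) (dAt E E e.symm (e (f x)) w), by
      rw [hτ.2, ContinuousLinearMap.comp_apply, dAt_symm_dAt he' hx', e'.left_inv hx',
        dAt_dAt_symm he hx]⟩)
    (by
      filter_upwards [e'.open_target.mem_nhds hy,
        (e'.continuousAt_symm hy).eventually (e.open_source.mem_nhds hye)] with z h1 h2 a b
      rw [(hd z h1 h2).2]
      simp only [τ, ContinuousLinearMap.comp_apply]
      rw [coordMetric_chart he h2, coordMetric_apply]) u v
  rw [h, h0, map_zero]

end ChartTransition

/-! ### Totally geodesic null submanifolds with a parallel rigging. -/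

section NullSubmanifold

variable {E : Type*} [NormedAddCommGroup E] [NormedSpace ℝ E] [FiniteDimensional ℝ E]
  {M : Type*} [TopologicalSpace M] [ChartedSpace E M] [IsManifold 𝓘(ℝ, E) ∞ M]
  {F : Type*} [NormedAddCommGroup F] [NormedSpace ℝ F] [FiniteDimensional ℝ F]
  {L : Type*} [TopologicalSpace L] [ChartedSpace F L] [IsManifold 𝓘(ℝ, F) ∞ L]

/-- A totally geodesic null embedded submanifold in a Lorentzian manifold with a parallel timelike
vector field. -/
structure IsParallelNullSubmanifold (g : BilinField E M) (Z : VField E M) (i : L → M) : Prop where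
  lorentz : IsLorentzianMetric g
  smooth : IsSmoothField Z
  timelike : IsTimelikeField g Z
  parallel : IsParallelField g Z
  embedding : Manifold.IsSmoothEmbedding 𝓘(ℝ, F) 𝓘(ℝ, E) ∞ i
  null : IsNullImmersed (F := F) g i
  geodesic : IsTotallyGeodesic F g i

/-- The one-form `g(Z, ·)` of the submanifold in a chart. -/
def coordOneForm (g : BilinField E M) (Z : VField E M) (i : L → M) (φ : OpenPartialHomeomorph L F)
    (x : F) : F →L[ℝ] ℝ :=
  (formAt g (i (φ.symm x)) (vecAt Z (i (φ.symm x)))).comp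
    ((dAt F E i (φ.symm x)).comp (dAt F F φ.symm x))

lemma coordMetric_riggedMetric (g : BilinField E M) (Z : VField E M) (i : L → M)
    (φ : OpenPartialHomeomorph L F) (x u v : F) :
    coordMetric (riggedMetric (F := F) g Z i) φ x u v =
      coordMetric (pullbackForm (F := F) g i) φ x u v +
        coordOneForm g Z i φ x u * coordOneForm g Z i φ x v := rfl

namespace IsParallelNullSubmanifold

variable {g : BilinField E M} {Z : VField E M} {i : L → M}
  (h : IsParallelNullSubmanifold (F := F) g Z i)
include h

lemma dAt_injective {q : L} {u : F} (hu : dAt F E i q u = 0) : u = 0 := by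
  obtain ⟨φ, Ψ, O, J, R, hS, hq⟩ := exists_isSliceChart h.embedding q
  exact hS.dAt_injective h.embedding.contMDiff hq hu

lemma exists_null (q : L) : ∃ n : F, n ≠ 0 ∧ ∀ w, formAt (pullbackForm (F := F) g i) q n w = 0 :=
  h.null q

/-- The degenerate direction is mapped to a nonzero null vector orthogonal to all tangent vectors,
and nothing orthogonal to a null vector is timelike. -/
lemma pullback_nonneg (q : L) (v : F) : 0 ≤ formAt (pullbackForm (F := F) g i) q v v := by
  obtain ⟨n, hn0, hn⟩ := h.exists_null q
  exact ((h.lorentz.isLorentzForm (i q)).exists_nonneg_of_orthogonal_null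
    (fun h0 => hn0 (h.dAt_injective h0)) (hn n) (hn v)).1

/-- Where the induced form vanishes, `v` is a multiple of the null direction, and `g(Z,·)` is
nonzero on it because `Z` is timelike. -/
lemma rigged_pos (q : L) {v : F} (hv : v ≠ 0) : 0 < formAt (riggedMetric (F := F) g Z i) q v v := by
  obtain ⟨n, hn0, hn⟩ := h.exists_null q
  have hB := h.lorentz.isLorentzForm (i q)
  have hin0 : dAt F E i q n ≠ 0 := fun h0 => hn0 (h.dAt_injective h0)
  have h1 := hB.exists_nonneg_of_orthogonal_null (w := dAt F E i q v) hin0 (hn n) (hn v)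
  change 0 < formAt g (i q) (dAt F E i q v) (dAt F E i q v) +
    formAt g (i q) (vecAt Z (i q)) (dAt F E i q v) * formAt g (i q) (vecAt Z (i q)) (dAt F E i q v)
  rcases h1.1.lt_or_eq with h2 | h2
  · exact add_pos_of_pos_of_nonneg h2 (mul_self_nonneg _)
  · obtain ⟨c, hc⟩ := h1.2 h2.symm
    have hc0 : c ≠ 0 := by
      rintro rfl
      rw [zero_smul] at hc
      exact hv (h.dAt_injective hc)
    rw [← h2, zero_add, hc, map_smul, smul_eq_mul]
    have := hB.timelike_null_ne_zero (z := vecAt Z (i q)) hin0 (hn n) (h.timelike (i q))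
    rw [hB.symm] at this
    exact mul_self_pos.2 (mul_ne_zero hc0 this)

section Chart

variable {φ : OpenPartialHomeomorph L F} (hφ : φ ∈ IsManifold.maximalAtlas 𝓘(ℝ, F) ∞ L)
  {e : OpenPartialHomeomorph M E} (he : e ∈ IsManifold.maximalAtlas 𝓘(ℝ, E) ∞ M)
include hφ he

lemma coordMetric_pullback {x : F} (hx : x ∈ φ.target) (hx' : i (φ.symm x) ∈ e.source) (a b : F) :
    coordMetric (pullbackForm (F := F) g i) φ x a b =
      coordMetric g e (e (i (φ.symm x))) (fderiv ℝ (fun z => e (i (φ.symm z))) x a)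
        (fderiv ℝ (fun z => e (i (φ.symm z))) x b) := by
  rw [fderiv_coord_map h.embedding.contMDiff hφ he hx hx',
    fderiv_coord_map h.embedding.contMDiff hφ he hx hx', coordMetric_chart he hx']
  rfl

lemma coordOneForm_eq {x : F} (hx : x ∈ φ.target) (hx' : i (φ.symm x) ∈ e.source) (a : F) :
    coordOneForm g Z i φ x a = coordMetric g e (e (i (φ.symm x)))
      (coordField Z e (e (i (φ.symm x)))) (fderiv ℝ (fun z => e (i (φ.symm z))) x a) := by
  rw [fderiv_coord_map h.embedding.contMDiff hφ he hx hx', coordField_chart hx',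
    coordMetric_chart he hx']
  rfl

lemma eventually_mem {x : F} (hx : x ∈ φ.target) (hx' : i (φ.symm x) ∈ e.source) :
    ∀ᶠ z in 𝓝 x, z ∈ φ.target ∧ i (φ.symm z) ∈ e.source := by
  have h0 : ContinuousAt (fun z => i (φ.symm z)) x :=
    h.embedding.contMDiff.continuous.continuousAt.comp (φ.continuousAt_symm hx)
  exact (φ.open_target.eventually_mem hx).and (h0.eventually (e.open_source.mem_nhds hx'))

lemma fderiv_coord_injective {x : F} (hx : x ∈ φ.target) (hx' : i (φ.symm x) ∈ e.source) {a : F}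
    (ha : fderiv ℝ (fun z => e (i (φ.symm z))) x a = 0) : a = 0 := by
  rw [fderiv_coord_map h.embedding.contMDiff hφ he hx hx'] at ha
  have h1 := dAt_symm_dAt he hx' (dAt F E i (φ.symm x) (dAt F F φ.symm x a))
  rw [ha, map_zero] at h1
  have h2 := h.dAt_injective h1.symm
  have h3 := dAt_dAt_symm' hφ hx a
  rw [h2, map_zero] at h3
  exact h3.symm

lemma contDiffAt_coord {x : F} (hx : x ∈ φ.target) (hx' : i (φ.symm x) ∈ e.source) :
    ContDiffAt ℝ ∞ (fun z => e (i (φ.symm z))) x :=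
  contDiffAt_coord_map h.embedding.contMDiff hφ he hx hx'

end Chart

variable {φ : OpenPartialHomeomorph L F} (hφ : φ ∈ IsManifold.maximalAtlas 𝓘(ℝ, F) ∞ L)
include hφ

/-- The Hessian of the inclusion is tangent to the submanifold. -/
lemma exists_tangent_hessian [T2Space M] {x : F} (hx : x ∈ φ.target) :
    ∃ T : F → F → F, (∀ u v, T u v = T v u) ∧ ∀ u v,
      mapHessian (coordMetric g (chartAt E (i (φ.symm x))))
        (fun z => chartAt E (i (φ.symm x)) (i (φ.symm z))) x u v =
      fderiv ℝ (fun z => chartAt E (i (φ.symm x)) (i (φ.symm z))) x (T u v) := by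
  obtain ⟨φ', Ψ, O, J, R, hS, hq⟩ := exists_isSliceChart h.embedding (φ.symm x)
  have hrange := fun u v => hS.mapHessian_mem_range h.embedding.contMDiff h.geodesic hq u v
  obtain ⟨e, hee⟩ : ∃ e, e = chartAt E (i (φ.symm x)) := ⟨_, rfl⟩
  have he : e ∈ IsManifold.maximalAtlas 𝓘(ℝ, E) ∞ M := hee ▸ IsManifold.chart_mem_maximalAtlas _
  have hp : i (φ.symm x) ∈ e.source := hee ▸ mem_chart_source _ _
  rw [← hee] at hrange ⊢
  have hx' := φ'.map_source hq
  have hp' : i (φ'.symm (φ' (φ.symm x))) ∈ e.source := by rwa [φ'.left_inv hq]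
  let c : F → F := fun z => φ' (φ.symm z)
  have hc : ContDiffAt ℝ ∞ c x := ((contMDiffAt_of_mem_maximalAtlas hS.mem_dom hq).comp x
      (contMDiffAt_symm_of_mem_maximalAtlas hφ hx)).contDiffAt
  have hcd : fderiv ℝ c x = (dAt F F φ' (φ.symm x)).comp (dAt F F φ.symm x) :=
    fderiv_comp_dAt ((contMDiffAt_of_mem_maximalAtlas hS.mem_dom hq).mdifferentiableAt (by simp))
      ((contMDiffAt_symm_of_mem_maximalAtlas hφ hx).mdifferentiableAt (by simp))
  have hev : (fun z => e (i (φ.symm z))) =ᶠ[𝓝 x] fun z => e (i (φ'.symm (c z))) := by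
    filter_upwards [(φ.continuousAt_symm hx).eventually (φ'.open_source.mem_nhds hq)] with z hz
    simp only [c, φ'.left_inv hz]
  have hsm := h.contDiffAt_coord hS.mem_dom he hx' hp'
  have hfd : fderiv ℝ (fun z => e (i (φ.symm z))) x =
      (fderiv ℝ (fun z => e (i (φ'.symm z))) (c x)).comp (fderiv ℝ c x) := by
    rw [hev.fderiv_eq]
    exact fderiv_comp (g := fun z => e (i (φ'.symm z))) x (hsm.differentiableAt (by simp))
      (hc.differentiableAt (by simp))
  have hT : ∀ u v, ∃ w, mapHessian (coordMetric g e) (fun z => e (i (φ.symm z))) x u v =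
      fderiv ℝ (fun z => e (i (φ.symm z))) x w := by
    -- Passing from the slice chart to `φ` changes the Hessian by a tangent vector, so it stays
    -- tangent.
    intro u v
    obtain ⟨w, hw⟩ := hrange (fderiv ℝ c x u) (fderiv ℝ c x v)
    rw [mapHessian_congr hev, mapHessian_comp (τ := fun z => e (i (φ'.symm z))) (F := c)
      (hsm.of_le two_le_smooth) (hc.of_le two_le_smooth)]
    simp only [c] at hw ⊢
    rw [hw, ← map_add]
    refine ⟨dAt F F φ (φ.symm x) (dAt F F φ'.symm (φ' (φ.symm x)) (w +
      fderiv ℝ (fun z => fderiv ℝ c z v) x u)), ?_⟩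
    rw [hfd, hcd]
    simp only [ContinuousLinearMap.comp_apply]
    rw [dAt_symm_dAt' hφ hx, dAt_dAt_symm hS.mem_dom hq]
  choose T hT using hT
  -- `T` is determined by the Hessian because the inclusion is an immersion, so it inherits its
  -- symmetry.
  refine ⟨T, fun u v => sub_eq_zero.1 (h.fderiv_coord_injective hφ he hx hp ?_), hT⟩
  rw [map_sub, ← hT, ← hT, (h.lorentz.isPseudoMetric.isCoordMetricOn he).mapHessian_comm
    (F := fun z => e (i (φ.symm z))) (e.map_source hp) ((h.contDiffAt_coord hφ he hx hp).of_le two_le_smooth), sub_self]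

lemma contDiffAt_coordMetric_pullback {x : F} (hx : x ∈ φ.target) :
    ContDiffAt ℝ ∞ (coordMetric (pullbackForm (F := F) g i) φ) x := by
  obtain ⟨e, hee⟩ : ∃ e, e = chartAt E (i (φ.symm x)) := ⟨_, rfl⟩
  have he : e ∈ IsManifold.maximalAtlas 𝓘(ℝ, E) ∞ M := hee ▸ IsManifold.chart_mem_maximalAtlas _
  have hp : i (φ.symm x) ∈ e.source := hee ▸ mem_chart_source _ _
  have hsm := h.contDiffAt_coord hφ he hx hp
  have hD := fun a : F => (hsm.fderiv_right (m := ∞) (by simp)).clm_apply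
    (contDiffAt_const (c := a))
  have hG : ContDiffAt ℝ ∞ (fun z => coordMetric g e (e (i (φ.symm z)))) x :=
    ContDiffAt.comp (g := coordMetric g e) x
      (h.lorentz.isPseudoMetric.smooth.contDiffAt_coordMetric he (e.map_source hp)) hsm
  refine contDiffAt_clm_of_apply fun u => contDiffAt_clm_of_apply fun v => ?_
  refine ((hG.clm_apply (hD u)).clm_apply (hD v)).congr_of_eventuallyEq ?_
  filter_upwards [h.eventually_mem hφ he hx hp] with z hz
  exact h.coordMetric_pullback hφ he hz.1 hz.2 u v

lemma contDiffAt_coordOneForm {x : F} (hx : x ∈ φ.target) :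
    ContDiffAt ℝ ∞ (coordOneForm g Z i φ) x := by
  obtain ⟨e, hee⟩ : ∃ e, e = chartAt E (i (φ.symm x)) := ⟨_, rfl⟩
  have he : e ∈ IsManifold.maximalAtlas 𝓘(ℝ, E) ∞ M := hee ▸ IsManifold.chart_mem_maximalAtlas _
  have hp : i (φ.symm x) ∈ e.source := hee ▸ mem_chart_source _ _
  have hsm := h.contDiffAt_coord hφ he hx hp
  have hD := fun a : F => (hsm.fderiv_right (m := ∞) (by simp)).clm_apply
    (contDiffAt_const (c := a))
  have hG : ContDiffAt ℝ ∞ (fun z => coordMetric g e (e (i (φ.symm z)))) x :=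
    ContDiffAt.comp (g := coordMetric g e) x
      (h.lorentz.isPseudoMetric.smooth.contDiffAt_coordMetric he (e.map_source hp)) hsm
  have hZ : ContDiffAt ℝ ∞ (fun z => coordField Z e (e (i (φ.symm z)))) x :=
    ContDiffAt.comp (g := coordField Z e) x
      (contDiffAt_coordField he (e.map_source hp) (h.smooth _)) hsm
  refine contDiffAt_clm_of_apply fun u => ?_
  refine ((hG.clm_apply hZ).clm_apply (hD u)).congr_of_eventuallyEq ?_
  filter_upwards [h.eventually_mem hφ he hx hp] with z hz
  exact h.coordOneForm_eq hφ he hz.1 hz.2 u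

/-- The induced form and the one-form `g(Z, ·)` are parallel for the induced connection. -/
lemma fderiv_of_tangent_hessian {x : F} (hx : x ∈ φ.target) {T : F → F → F}
    (hT : ∀ u v, mapHessian (coordMetric g (chartAt E (i (φ.symm x))))
        (fun z => chartAt E (i (φ.symm x)) (i (φ.symm z))) x u v =
      fderiv ℝ (fun z => chartAt E (i (φ.symm x)) (i (φ.symm z))) x (T u v)) :
    (∀ w a b, fderiv ℝ (coordMetric (pullbackForm (F := F) g i) φ) x w a b =
      coordMetric (pullbackForm (F := F) g i) φ x (T w a) b +
        coordMetric (pullbackForm (F := F) g i) φ x a (T w b)) ∧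
    ∀ w a, fderiv ℝ (coordOneForm g Z i φ) x w a = coordOneForm g Z i φ x (T w a) := by
  have hpar := h.parallel (i (φ.symm x))
  obtain ⟨e, hee⟩ : ∃ e, e = chartAt E (i (φ.symm x)) := ⟨_, rfl⟩
  have he : e ∈ IsManifold.maximalAtlas 𝓘(ℝ, E) ∞ M := hee ▸ IsManifold.chart_mem_maximalAtlas _
  have hp : i (φ.symm x) ∈ e.source := hee ▸ mem_chart_source _ _
  rw [← hee] at hT hpar
  have hsm := h.contDiffAt_coord hφ he hx hp
  have hG := h.lorentz.isPseudoMetric.isCoordMetricOn he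
  constructor
  · intro w a b
    have h1 : HasFDerivAt (fun z => coordMetric (pullbackForm (F := F) g i) φ z a b) _ x :=
      (((h.contDiffAt_coordMetric_pullback hφ hx).differentiableAt (by simp)).hasFDerivAt.clm_apply
        (hasFDerivAt_const a x)).clm_apply (hasFDerivAt_const b x)
    obtain ⟨T', hT', hT''⟩ := hG.hasFDerivAt_pullback (F := fun z => e (i (φ.symm z)))
      (e.map_source hp) (hsm.of_le two_le_smooth) a b
    have h2 := h1.unique (hT'.congr_of_eventuallyEq (by
      filter_upwards [h.eventually_mem hφ he hx hp] with z hz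
      exact h.coordMetric_pullback hφ he hz.1 hz.2 a b))
    have h3 := hT'' w
    rw [← h2, hT, hT, ← h.coordMetric_pullback hφ he hx hp,
      ← h.coordMetric_pullback hφ he hx hp] at h3
    simpa using h3
  · intro w a
    have h1 : HasFDerivAt (fun z => coordOneForm g Z i φ z a) _ x :=
      ((h.contDiffAt_coordOneForm hφ hx).differentiableAt (by simp)).hasFDerivAt.clm_apply
        (hasFDerivAt_const a x)
    have hZ : HasFDerivAt (fun z => coordField Z e (e (i (φ.symm z))))
        ((fderiv ℝ (coordField Z e) (e (i (φ.symm x)))).comp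
          (fderiv ℝ (fun z => e (i (φ.symm z))) x)) x :=
      HasFDerivAt.comp (g := coordField Z e) x
        ((contDiffAt_coordField he (e.map_source hp) (h.smooth _)).differentiableAt
          (by simp)).hasFDerivAt (hsm.differentiableAt (by simp)).hasFDerivAt
    obtain ⟨T', hT', hT''⟩ := hG.hasFDerivAt_apply (f := fun z => e (i (φ.symm z)))
      (e.map_source hp) (hsm.differentiableAt (by simp)).hasFDerivAt hZ
      (hasFDerivAt_fderiv_apply (hsm.of_le two_le_smooth) a)
    have h2 := h1.unique (hT'.congr_of_eventuallyEq (by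
      filter_upwards [h.eventually_mem hφ he hx hp] with z hz
      exact h.coordOneForm_eq hφ he hz.1 hz.2 a))
    have h3 := hT'' w
    have h4 := hT w a
    rw [mapHessian, fderiv_fderiv_apply (hsm.of_le two_le_smooth)] at h4
    -- In the product rule for `g(Z, DF a)`, the derivative of `Z` vanishes and the derivative of
    -- `DF a` is the Hessian, that is, `DF (T w a)`.
    have h5 := hpar (fderiv ℝ (fun z => e (i (φ.symm z))) x w)
    rw [chartNabla] at h5
    rw [← h2, ContinuousLinearMap.comp_apply, h5, map_zero, zero_apply, zero_add,
      ContinuousLinearMap.flip_apply, h4, ← h.coordOneForm_eq hφ he hx hp] at h3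
    simpa using h3

lemma isParallelPair [T2Space M] : IsParallelPair (coordMetric (pullbackForm (F := F) g i) φ)
    (coordOneForm g Z i φ) φ.target where
  isOpen := φ.open_target
  contDiffAt_form := fun x hx => h.contDiffAt_coordMetric_pullback hφ hx
  contDiffAt_one := fun x hx => h.contDiffAt_coordOneForm hφ hx
  symm := fun x _ u v => h.lorentz.symm _ _ _
  null := fun x hx => by
    obtain ⟨n, hn0, hn⟩ := h.exists_null (φ.symm x)
    refine ⟨dAt F F φ (φ.symm x) n, fun h0 => hn0 ?_, fun v => ?_⟩
    · have := dAt_symm_dAt' hφ hx n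
      rw [h0, map_zero] at this
      exact this.symm
    · rw [coordMetric_apply, dAt_symm_dAt' hφ hx]
      exact hn _
  pos := fun x hx v hv => by
    rw [← coordMetric_riggedMetric, coordMetric_apply]
    refine h.rigged_pos _ fun h0 => hv ?_
    have := dAt_dAt_symm' hφ hx v
    rw [h0, map_zero] at this
    exact this.symm
  parallel := fun x hx => by
    obtain ⟨T, hTs, hT⟩ := h.exists_tangent_hessian hφ hx
    exact ⟨T, hTs, h.fderiv_of_tangent_hessian hφ hx hT⟩

end IsParallelNullSubmanifold

end NullSubmanifold

/-! ### Geodesics as solutions of an ordinary differential equation. -/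

section GeodesicUniqueness

variable {E : Type*} [NormedAddCommGroup E] [NormedSpace ℝ E] [FiniteDimensional ℝ E]
  {X : Type*} [NormedAddCommGroup X] [NormedSpace ℝ X]
  {G : E → E →L[ℝ] E →L[ℝ] ℝ} {Ω : Set E}

/-- Local uniqueness of geodesics in a coordinate domain. -/
lemma IsCoordMetricOn.geodesic_unique (hG : IsCoordMetricOn G Ω) {c₁ c₂ v₁ v₂ : ℝ → E} {t₀ : ℝ}
    (hΩ : c₁ t₀ ∈ Ω)
    (h₁ : ∀ᶠ t in 𝓝 t₀, HasDerivAt c₁ (v₁ t) t ∧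
      HasDerivAt v₁ (-christoffel G (c₁ t) (v₁ t) (v₁ t)) t)
    (h₂ : ∀ᶠ t in 𝓝 t₀, HasDerivAt c₂ (v₂ t) t ∧
      HasDerivAt v₂ (-christoffel G (c₂ t) (v₂ t) (v₂ t)) t)
    (hc : c₁ t₀ = c₂ t₀) (hv : v₁ t₀ = v₂ t₀) : c₁ =ᶠ[𝓝 t₀] c₂ := by
  -- The geodesic spray: a first-order system on positions and velocities, locally Lipschitz because
  -- it is smooth.
  let Y : E × E → E × E := fun z => (z.2, -christoffel G z.1 z.2 z.2)
  have hY : ContDiffAt ℝ 1 Y (c₁ t₀, v₁ t₀) :=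
    (contDiffAt_snd.prodMk (hG.contDiffAt_christoffel (a := fun z : E × E => z.1)
      (b := fun z => z.2) (c := fun z => z.2) hΩ contDiffAt_fst contDiffAt_snd
        contDiffAt_snd).neg).of_le (by simp)
  obtain ⟨K, s, hs, hK⟩ := hY.exists_lipschitzOnWith
  have key : ∀ c v : ℝ → E, (∀ᶠ t in 𝓝 t₀, HasDerivAt c (v t) t ∧
      HasDerivAt v (-christoffel G (c t) (v t) (v t)) t) → (c t₀, v t₀) = (c₁ t₀, v₁ t₀) →
      ∀ᶠ t in 𝓝 t₀, HasDerivAt (fun t => (c t, v t)) (Y (c t, v t)) t ∧ (c t, v t) ∈ s := by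
    intro c v h h0
    have hcont : ContinuousAt (fun t => (c t, v t)) t₀ :=
      h.self_of_nhds.1.continuousAt.prodMk h.self_of_nhds.2.continuousAt
    have hev : ∀ᶠ t in 𝓝 t₀, (c t, v t) ∈ s := hcont.eventually
      (show s ∈ 𝓝 (c t₀, v t₀) by rw [h0]; exact hs)
    filter_upwards [h, hev] with t ht hts
    exact ⟨ht.1.prodMk ht.2, hts⟩
  have := ODE_solution_unique_of_eventually (v := fun _ => Y) (s := fun _ => s)
    (Filter.Eventually.of_forall fun _ => hK) (key c₁ v₁ h₁ rfl) (key c₂ v₂ h₂ (by rw [hc, hv]))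
    (by rw [hc, hv])
  exact this.mono fun t ht => congrArg Prod.fst ht

/-- If the Hessian of a map vanishes, then it maps straight lines to geodesics. -/
lemma hasDerivAt_line_of_mapHessian {Φ : X → E} {x₀ b : X} (t₀ : ℝ)
    (h : ∀ᶠ z in 𝓝 x₀, ContDiffAt ℝ 2 Φ z ∧ mapHessian G Φ z b b = 0) :
    ∀ᶠ t in 𝓝 t₀, HasDerivAt (fun t => Φ (x₀ + (t - t₀) • b))
        (fderiv ℝ Φ (x₀ + (t - t₀) • b) b) t ∧
      HasDerivAt (fun t => fderiv ℝ Φ (x₀ + (t - t₀) • b) b)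
        (-christoffel G (Φ (x₀ + (t - t₀) • b)) (fderiv ℝ Φ (x₀ + (t - t₀) • b) b)
          (fderiv ℝ Φ (x₀ + (t - t₀) • b) b)) t := by
  have hl : ∀ t, HasDerivAt (fun t : ℝ => x₀ + (t - t₀) • b) b t := fun t => by
    simpa using (((hasDerivAt_id t).sub_const t₀).smul_const b).const_add x₀
  have hcont : Filter.Tendsto (fun t : ℝ => x₀ + (t - t₀) • b) (𝓝 t₀) (𝓝 x₀) := by
    have := (hl t₀).continuousAt.tendsto
    simpa using this
  filter_upwards [hcont.eventually h] with t ht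
  obtain ⟨h1, h2⟩ := ht
  have h3 := ((hasFDerivAt_fderiv_apply h1 b).comp_hasDerivAt t (hl t))
  rw [mapHessian, fderiv_fderiv_apply h1] at h2
  refine ⟨(h1.differentiableAt (by simp)).hasFDerivAt.comp_hasDerivAt t (hl t),
    h3.congr_deriv ?_⟩
  rw [ContinuousLinearMap.flip_apply]
  exact eq_neg_of_add_eq_zero_left h2

end GeodesicUniqueness

/-! ### Flat charts of the rigged metric, and lines in them as geodesics of the ambient manifold. -/

section FlatChart

variable {F : Type*} [NormedAddCommGroup F] [InnerProductSpace ℝ F] [FiniteDimensional ℝ F]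
  {L : Type*} [TopologicalSpace L] [ChartedSpace F L] [IsManifold 𝓘(ℝ, F) ∞ L]

/-- A chart in which the form `h` is the inner product of the model space. -/
structure IsFlatChart (h : BilinField F L) (σ : OpenPartialHomeomorph L F) : Prop where
  mem : σ ∈ IsManifold.maximalAtlas 𝓘(ℝ, F) ∞ L
  coordMetric_eq : ∀ y ∈ σ.target, ∀ a b, coordMetric h σ y a b = inner ℝ a b

/-- A curve which is a straight line in flat charts. -/
def IsFlatLine (h : BilinField F L) (c : ℝ → L) : Prop :=
  ∀ t₀, ∃ σ, IsFlatChart h σ ∧ c t₀ ∈ σ.source ∧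
    ∃ b : F, ∀ᶠ t in 𝓝 t₀, c t = σ.symm (σ (c t₀) + (t - t₀) • b)

end FlatChart

namespace IsParallelNullSubmanifold

variable {E : Type*} [NormedAddCommGroup E] [NormedSpace ℝ E] [FiniteDimensional ℝ E]
  {M : Type*} [TopologicalSpace M] [ChartedSpace E M] [IsManifold 𝓘(ℝ, E) ∞ M] [T2Space M]

section Existence

variable {L : Type*} [TopologicalSpace L] [ChartedSpace (EuclideanSpace ℝ (Fin 2)) L]
  [IsManifold 𝓘(ℝ, EuclideanSpace ℝ (Fin 2)) ∞ L]
  {g : BilinField E M} {Z : VField E M} {i : L → M}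

/-- The rigged metric of a totally geodesic null surface is flat. -/
theorem exists_isFlatChart
    (h : IsParallelNullSubmanifold (F := EuclideanSpace ℝ (Fin 2)) g Z i) (q : L) :
    ∃ σ, IsFlatChart (riggedMetric (F := EuclideanSpace ℝ (Fin 2)) g Z i) σ ∧ q ∈ σ.source := by
  obtain ⟨φ, hφ, hq⟩ : ∃ φ ∈ IsManifold.maximalAtlas 𝓘(ℝ, EuclideanSpace ℝ (Fin 2)) ∞ L,
    q ∈ φ.source := ⟨_, IsManifold.chart_mem_maximalAtlas q, mem_chart_source _ q⟩
  obtain ⟨ψ, hψq, hψs, hψ1, hψ2, hψ⟩ := (h.isParallelPair hφ).exists_flat_coordinates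
    (by simp) (φ.map_source hq)
  have hsrc : ∀ z ∈ (φ.trans ψ).source, z ∈ φ.source ∧ φ z ∈ ψ.source := fun z hz => by
    simpa using hz
  have htgt : ∀ y ∈ (φ.trans ψ).target, y ∈ ψ.target ∧ ψ.symm y ∈ φ.target := fun y hy => by
    simpa using hy
  have hmem : φ.trans ψ ∈ IsManifold.maximalAtlas 𝓘(ℝ, EuclideanSpace ℝ (Fin 2)) ∞ L := by
    refine OpenPartialHomeomorph.mem_maximalAtlas_of_contMDiffOn _ (fun z hz => ?_) fun y hy => ?_
    · exact ((hψ1 _ (hsrc z hz).2).contMDiffAt.comp z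
        (contMDiffAt_of_mem_maximalAtlas hφ (hsrc z hz).1)).contMDiffWithinAt
    · exact ((contMDiffAt_symm_of_mem_maximalAtlas hφ (htgt y hy).2).comp y
        (hψ2 _ (htgt y hy).1).contMDiffAt).contMDiffWithinAt
  refine ⟨φ.trans ψ, ⟨hmem, fun y hy a b => ?_⟩, by simpa using ⟨hq, hψq⟩⟩
  obtain ⟨hy1, hy2⟩ := htgt y hy
  have hd : dAt (EuclideanSpace ℝ (Fin 2)) (EuclideanSpace ℝ (Fin 2)) (φ.trans ψ).symm y =
      (dAt (EuclideanSpace ℝ (Fin 2)) (EuclideanSpace ℝ (Fin 2)) φ.symm (ψ.symm y)).comp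
        (fderiv ℝ ψ.symm y) := by
    rw [← dAt_eq_fderiv]
    exact dAt_comp (f := ψ.symm) (h := φ.symm)
      ((contMDiffAt_symm_of_mem_maximalAtlas hφ hy2).mdifferentiableAt (by simp))
      ((hψ2 _ hy1).contMDiffAt.mdifferentiableAt (by simp))
  have hinv : ∀ a, fderiv ℝ ψ (ψ.symm y) (fderiv ℝ ψ.symm y a) = a := fun a => by
    have h1 := fderiv_comp (g := ψ) (f := ψ.symm) y
      ((hψ1 _ (ψ.map_target hy1)).differentiableAt (by simp))
      ((hψ2 _ hy1).differentiableAt (by simp))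
    have h2 : (ψ ∘ ψ.symm) =ᶠ[𝓝 y] id := by
      filter_upwards [ψ.open_target.mem_nhds hy1] with z hz using ψ.right_inv hz
    rw [h2.fderiv_eq, fderiv_id] at h1
    exact (congrArg (fun T : EuclideanSpace ℝ (Fin 2) →L[ℝ] EuclideanSpace ℝ (Fin 2) => T a)
      h1).symm
  rw [coordMetric_apply, hd, ContinuousLinearMap.comp_apply, ContinuousLinearMap.comp_apply]
  have h3 := hψ _ (ψ.map_target hy1) (fderiv ℝ ψ.symm y a) (fderiv ℝ ψ.symm y b)
  rw [hinv, hinv, ← coordMetric_riggedMetric, coordMetric_apply] at h3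
  exact h3

end Existence

variable {F : Type*} [NormedAddCommGroup F] [InnerProductSpace ℝ F] [FiniteDimensional ℝ F]
  {L : Type*} [TopologicalSpace L] [ChartedSpace F L] [IsManifold 𝓘(ℝ, F) ∞ L]
  {g : BilinField E M} {Z : VField E M} {i : L → M}
  (h : IsParallelNullSubmanifold (F := F) g Z i)
  {σ : OpenPartialHomeomorph L F} (hσ : IsFlatChart (riggedMetric (F := F) g Z i) σ)
include h hσ

/-- The inclusion has vanishing Hessian in flat charts. -/
lemma mapHessian_flatChart_eq_zero {x : F} (hx : x ∈ σ.target) {e : OpenPartialHomeomorph M E}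
    (he : e ∈ IsManifold.maximalAtlas 𝓘(ℝ, E) ∞ M) (hx' : i (σ.symm x) ∈ e.source) (u v : F) :
    mapHessian (coordMetric g e) (fun z => e (i (σ.symm z))) x u v = 0 := by
  obtain ⟨T, hTs, hT⟩ := h.exists_tangent_hessian hσ.mem hx
  obtain ⟨hTB, hTη⟩ := h.fderiv_of_tangent_hessian hσ.mem hx hT
  -- The connection `T` preserves both summands of the rigged metric, which has constant
  -- coefficients in a flat chart.
  have hpair : ∀ a b u, inner ℝ (T u a) b + inner ℝ a (T u b) = 0 := by
    intro a b u
    have h1 : HasFDerivAt (fun z => coordMetric (pullbackForm (F := F) g i) σ z a b) _ x :=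
      (((h.contDiffAt_coordMetric_pullback hσ.mem hx).differentiableAt
        (by simp)).hasFDerivAt.clm_apply (hasFDerivAt_const a x)).clm_apply (hasFDerivAt_const b x)
    have h2 := fun a => ((h.contDiffAt_coordOneForm hσ.mem hx).differentiableAt
      (by simp)).hasFDerivAt.clm_apply (hasFDerivAt_const (a : F) x)
    have h3 := h1.add ((h2 a).mul (h2 b))
    have h4 := h3.unique ((hasFDerivAt_const (inner ℝ a b) x).congr_of_eventuallyEq (by
      filter_upwards [σ.open_target.mem_nhds hx] with z hz
      exact hσ.coordMetric_eq z hz a b))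
    have h5 := congrArg (fun T : F →L[ℝ] ℝ => T u) h4
    simp only [ContinuousLinearMap.comp_zero, zero_add, add_apply, smul_apply, smul_eq_mul,
      ContinuousLinearMap.flip_apply, hTB, hTη, zero_apply] at h5
    rw [← hσ.coordMetric_eq x hx, ← hσ.coordMetric_eq x hx, coordMetric_riggedMetric,
      coordMetric_riggedMetric]
    linarith
  -- Koszul's argument again: `T` is symmetric and metric for the constant inner product, so it is
  -- the zero connection.
  have hT0 : ∀ u v, T u v = 0 := by
    intro u v
    refine ext_inner_right ℝ fun w => ?_
    have h1 := hpair v w u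
    have h2 := hpair u w v
    have h3 := hpair u v w
    rw [real_inner_comm (T u w)] at h1
    rw [hTs v u, real_inner_comm (T v w)] at h2
    rw [hTs w u, hTs w v, real_inner_comm (T v w)] at h3
    rw [inner_zero_left]
    linarith
  have he' : chartAt E (i (σ.symm x)) ∈ IsManifold.maximalAtlas 𝓘(ℝ, E) ∞ M :=
    IsManifold.chart_mem_maximalAtlas _
  refine h.lorentz.isPseudoMetric.mapHessian_chart he he' (f := fun z => i (σ.symm z))
    (h.embedding.contMDiff.continuous.continuousAt.comp (σ.continuousAt_symm hx)) hx'
    (mem_chart_source _ _)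
    ((h.contDiffAt_coord hσ.mem he' hx (mem_chart_source _ _)).of_le two_le_smooth) u v ?_
  rw [hT, hT0, map_zero]

/-- A geodesic which is tangent to the submanifold at some time is a straight line in flat charts
near this time. -/
lemma geodesic_eq_line {γ : ℝ → M} (hγ : IsGeodesic g γ) {t₀ : ℝ} {q : L} (hq : q ∈ σ.source)
    (hγq : γ t₀ = i q) {u : F} (hu : dAt ℝ E γ t₀ 1 = dAt F E i q u) :
    ∀ᶠ t in 𝓝 t₀, γ t = i (σ.symm (σ q + (t - t₀) • dAt F F σ q u)) := by
  obtain ⟨e, hee⟩ : ∃ e, e = chartAt E (i q) := ⟨_, rfl⟩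
  have hea : e ∈ atlas E M := hee ▸ chart_mem_atlas _ _
  have he : e ∈ IsManifold.maximalAtlas 𝓘(ℝ, E) ∞ M := hee ▸ IsManifold.chart_mem_maximalAtlas _
  have hp : i q ∈ e.source := hee ▸ mem_chart_source _ _
  have hG := h.lorentz.isPseudoMetric.isCoordMetricOn he
  have hx := σ.map_source hq
  have hx' : i (σ.symm (σ q)) ∈ e.source := by rwa [σ.left_inv hq]
  have hev := h.eventually_mem hσ.mem he hx hx'
  have hmd : MDifferentiable 𝓘(ℝ, ℝ) 𝓘(ℝ, E) γ := hγ.1.mdifferentiable (by simp)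
  have hsrc : ∀ᶠ t in 𝓝 t₀, γ t ∈ e.source :=
    hγ.1.continuous.continuousAt.eventually (e.open_source.mem_nhds (by rwa [hγq]))
  have h1 : ∀ᶠ t in 𝓝 t₀, HasDerivAt (fun s => e (γ s)) (deriv (fun s => e (γ s)) t) t ∧
      HasDerivAt (deriv (fun s => e (γ s))) (-christoffel (coordMetric g e) (e (γ t))
        (deriv (fun s => e (γ s)) t) (deriv (fun s => e (γ s)) t)) t := by
    filter_upwards [hsrc] with t ht
    have hsm := hγ.contDiffAt_chart he ht
    have h2 : DifferentiableAt ℝ (deriv (fun s => e (γ s))) t :=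
      ((((hsm.of_le two_le_smooth).fderiv_right (m := 1) (by norm_num)).clm_apply
        contDiffAt_const).differentiableAt (by simp) :
          DifferentiableAt ℝ (fun s => fderiv ℝ (fun s => e (γ s)) s 1) t)
    refine ⟨(hsm.differentiableAt (by simp)).hasDerivAt, h2.hasDerivAt.congr_deriv ?_⟩
    exact eq_neg_of_add_eq_zero_left (hγ.2 e hea t ht)
  -- The Hessian vanishes, so the straight line is mapped to a geodesic of the ambient metric. It
  -- has the position and velocity of `γ` at `t₀`, and uniqueness applies.
  have h2 := hasDerivAt_line_of_mapHessian (G := coordMetric g e)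
    (Φ := fun z => e (i (σ.symm z))) (x₀ := σ q) (b := dAt F F σ q u) t₀ (by
      filter_upwards [hev] with z hz
      exact ⟨(h.contDiffAt_coord hσ.mem he hz.1 hz.2).of_le two_le_smooth,
        h.mapHessian_flatChart_eq_zero hσ hz.1 he hz.2 _ _⟩)
  have h3 := hG.geodesic_unique (c₁ := fun s => e (γ s)) (by
      simp only [hγq]
      exact e.map_source hp) h1 h2
    (by simp [hγq, σ.left_inv hq])
    (by
      simp only [sub_self, zero_smul, add_zero]
      rw [fderiv_coord_map h.embedding.contMDiff hσ.mem he hx hx', σ.left_inv hq,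
        dAt_symm_dAt hσ.mem hq, (hasDerivAt_chart hmd he (by rwa [hγq])).deriv, hu, hγq])
  have hl : Filter.Tendsto (fun t : ℝ => σ q + (t - t₀) • dAt F F σ q u) (𝓝 t₀) (𝓝 (σ q)) := by
    have : ContinuousAt (fun t : ℝ => σ q + (t - t₀) • dAt F F σ q u) t₀ := by fun_prop
    simpa using this.tendsto
  filter_upwards [h3, hsrc, hl.eventually hev] with t ht1 ht2 ht3
  exact e.injOn ht2 ht3.2 ht1

end IsParallelNullSubmanifold

/-! ### Completeness: tangent geodesics remain in the closed submanifold. -/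

namespace IsParallelNullSubmanifold

variable {E : Type*} [NormedAddCommGroup E] [NormedSpace ℝ E] [FiniteDimensional ℝ E]
  {M : Type*} [TopologicalSpace M] [ChartedSpace E M] [IsManifold 𝓘(ℝ, E) ∞ M] [T2Space M]
  {F : Type*} [NormedAddCommGroup F] [InnerProductSpace ℝ F] [FiniteDimensional ℝ F]
  {L : Type*} [TopologicalSpace L] [ChartedSpace F L] [IsManifold 𝓘(ℝ, F) ∞ L]
  {g : BilinField E M} {Z : VField E M} {i : L → M}
  (h : IsParallelNullSubmanifold (F := F) g Z i) (hclosed : IsClosed (range i))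
  (hflat : ∀ q : L, ∃ σ, IsFlatChart (riggedMetric (F := F) g Z i) σ ∧ q ∈ σ.source)
include h hclosed hflat

/-- A complete geodesic tangent to a closed totally geodesic null submanifold at one time stays in
this submanifold. -/
lemma geodesic_tangent {γ : ℝ → M} (hγ : IsGeodesic g γ) {q₀ : L} {u₀ : F} (hq₀ : γ 0 = i q₀)
    (hu₀ : dAt ℝ E γ 0 1 = dAt F E i q₀ u₀) (t : ℝ) :
    ∃ (q : L) (u : F), γ t = i q ∧ dAt ℝ E γ t 1 = dAt F E i q u := by
  -- The times at which the geodesic is in `L` with tangent velocity form a clopen set. Openness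
  -- holds because the geodesic is then locally a flat line of `L`.
  let S : Set ℝ := {t | ∃ (q : L) (u : F), γ t = i q ∧ dAt ℝ E γ t 1 = dAt F E i q u}
  have hmd : MDifferentiable 𝓘(ℝ, ℝ) 𝓘(ℝ, E) γ := hγ.1.mdifferentiable (by simp)
  have hopen : IsOpen S := by
    refine isOpen_iff_mem_nhds.2 fun t₀ ⟨q, u, hq, hu⟩ => ?_
    obtain ⟨σ, hσ, hqσ⟩ := hflat q
    have h1 := h.geodesic_eq_line hσ hγ hqσ hq hu
    have hl : Filter.Tendsto (fun t : ℝ => σ q + (t - t₀) • dAt F F σ q u) (𝓝 t₀) (𝓝 (σ q)) := by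
      have : ContinuousAt (fun t : ℝ => σ q + (t - t₀) • dAt F F σ q u) t₀ := by fun_prop
      simpa using this.tendsto
    filter_upwards [h1.eventually_nhds,
      hl.eventually (σ.open_target.mem_nhds (σ.map_source hqσ))] with t ht ht'
    let κ : ℝ → L := fun s => σ.symm (σ q + (s - t₀) • dAt F F σ q u)
    have hκ : MDifferentiableAt 𝓘(ℝ, ℝ) 𝓘(ℝ, F) κ t := by
      have h2 : MDifferentiableAt 𝓘(ℝ, ℝ) 𝓘(ℝ, F)
          (fun s : ℝ => σ q + (s - t₀) • dAt F F σ q u) t :=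
        DifferentiableAt.mdifferentiableAt (by fun_prop)
      exact MDifferentiableAt.comp t
        ((contMDiffAt_symm_of_mem_maximalAtlas hσ.mem ht').mdifferentiableAt (by simp)) h2
    refine ⟨κ t, dAt ℝ F κ t 1, ht.self_of_nhds, ?_⟩
    have h3 : γ =ᶠ[𝓝 t] fun s => i (κ s) := ht
    rw [dAt_congr h3, dAt_comp (h.embedding.contMDiff.mdifferentiable (by simp) _) hκ]
    rfl
  have hclS : IsClosed S := by
    refine isClosed_of_closure_subset fun t₀ ht₀ => ?_
    have hmem : γ t₀ ∈ range i := by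
      refine closure_minimal (t := γ ⁻¹' range i) ?_ (hclosed.preimage hγ.1.continuous) ht₀
      rintro t ⟨q, u, hq, -⟩
      exact ⟨q, hq.symm⟩
    obtain ⟨q, hq⟩ := hmem
    obtain ⟨φ, Ψ, O, J, R, hS, hqφ⟩ := exists_isSliceChart h.embedding q
    have hΨ : ∀ t, γ t ∈ O → HasDerivAt (fun s => Ψ (γ s))
        (dAt E E Ψ (γ t) (dAt ℝ E γ t 1)) t := fun t ht =>
      hasDerivAt_chart hmd hS.mem_cod (hS.subset_source ht)
    have hO : γ t₀ ∈ O := hq ▸ hS.mem_open hqφ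
    have hcont : ContinuousAt (deriv fun s => Ψ (γ s)) t₀ :=
      ((((hγ.contDiffAt_chart hS.mem_cod (hS.subset_source hO)).of_le two_le_smooth).fderiv_right
        (m := 1) (by norm_num)).clm_apply contDiffAt_const).continuousAt
    -- The limit position is in `L` since `L` is closed. In a slice chart tangency of the velocity
    -- is the closed linear condition `J (R w) = w`, so it passes to the limit too.
    have hzero : J (R (deriv (fun s => Ψ (γ s)) t₀)) = deriv (fun s => Ψ (γ s)) t₀ := by
      by_contra hne
      have hd : ContinuousAt (fun t => J (R (deriv (fun s => Ψ (γ s)) t)) -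
          deriv (fun s => Ψ (γ s)) t) t₀ :=
        ((J.continuous.comp R.continuous).continuousAt.comp hcont).sub hcont
      have hne' : ∀ᶠ t in 𝓝 t₀,
          J (R (deriv (fun s => Ψ (γ s)) t)) ≠ deriv (fun s => Ψ (γ s)) t :=
        (hd.eventually_ne (sub_ne_zero.2 hne)).mono fun t ht => sub_ne_zero.1 ht
      have hO' : ∀ᶠ t in 𝓝 t₀, γ t ∈ O :=
        hγ.1.continuous.continuousAt.eventually (hS.isOpen.mem_nhds hO)
      obtain ⟨t, ⟨⟨p, u, hp, hu⟩, h1⟩, h2⟩ :=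
        ((mem_closure_iff_frequently.1 ht₀).and_eventually hne' |>.and_eventually hO').exists
      refine h1 ?_
      -- The points of `L` met near `t₀` lie in the same slice because `L` enters `O` only through
      -- the domain of `φ`.
      have hpφ : p ∈ φ.source := hS.preimage.subset (show i p ∈ O from hp ▸ h2)
      rw [(hΨ t h2).deriv, hu, hp, hS.dAt_eq h.embedding.contMDiff hpφ, hS.left_inv]
    rw [(hΨ t₀ hO).deriv, ← hq] at hzero
    obtain ⟨u, hu⟩ := hS.exists_of_slice h.embedding.contMDiff hqφ hzero
    exact ⟨q, u, hq.symm, hu.symm⟩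
  have huniv : S = univ := IsClopen.eq_univ ⟨hclS, hopen⟩ ⟨0, q₀, u₀, hq₀, hu₀⟩
  exact huniv.symm.subset (mem_univ t)

/-- Straight lines in flat charts extend to complete straight lines. -/
theorem exists_isFlatLine (hnull : IsNullComplete g) (hspace : IsSpacelikeComplete g)
    {σ : OpenPartialHomeomorph L F} (hσ : IsFlatChart (riggedMetric (F := F) g Z i) σ) {q : L}
    (hq : q ∈ σ.source) (b : F) :
    ∃ c, IsFlatLine (riggedMetric (F := F) g Z i) c ∧ c 0 = q ∧
      ∀ᶠ t in 𝓝 (0 : ℝ), c t = σ.symm (σ q + t • b) := by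
  -- The zero vector is treated apart, since null completeness concerns nonzero vectors only.
  by_cases hb : b = 0
  · refine ⟨fun _ => q, fun t₀ => ⟨σ, hσ, hq, 0, ?_⟩, rfl, ?_⟩ <;>
    simp [hb, σ.left_inv hq]
  let u : F := dAt F F σ.symm (σ q) b
  have hσu : dAt F F σ q u = b := dAt_dAt_symm hσ.mem hq b
  let w : E := dAt F E i q u
  have hw : w ≠ 0 := fun hw0 => hb (by rw [← hσu, h.dAt_injective hw0, map_zero])
  -- Tangent vectors of a null submanifold are spacelike or null, which is where the two
  -- completeness hypotheses enter.
  have hcomp : HasCompleteGeodesic g (i q) w := by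
    have hnn : 0 ≤ formAt g (i q) w w := h.pullback_nonneg q u
    rcases hnn.lt_or_eq with h1 | h1
    · exact hspace (i q) w h1
    · exact hnull (i q) w hw h1.symm
  obtain ⟨γ, hγ, hγv⟩ := hcomp
  obtain ⟨hγ0, hγ1⟩ := velocity_eq hγv
  choose κ v hκ hv using h.geodesic_tangent hclosed hflat hγ hγ0 hγ1
  have hinj := h.embedding.isEmbedding.injective
  refine ⟨κ, fun t₀ => ?_, hinj ((hκ 0).symm.trans hγ0), ?_⟩
  · obtain ⟨τ, hτ, hτt⟩ := hflat (κ t₀)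
    refine ⟨τ, hτ, hτt, dAt F F τ (κ t₀) (v t₀), ?_⟩
    filter_upwards [h.geodesic_eq_line hτ hγ hτt (hκ t₀) (hv t₀)] with t ht
    exact hinj ((hκ t).symm.trans ht)
  · filter_upwards [h.geodesic_eq_line hσ hγ hq hγ0 hγ1] with t ht
    rw [sub_zero, hσu] at ht
    exact hinj ((hκ t).symm.trans ht)

end IsParallelNullSubmanifold

/-! ### Atlases with Euclidean transitions, and their straight lines. -/

section AffineAtlas

variable {F : Type*} [NormedAddCommGroup F] [InnerProductSpace ℝ F]
  {L : Type*} [TopologicalSpace L]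

lemma AffineIsometryEquiv.map_add_smul (A : F ≃ᵃⁱ[ℝ] F) (a b : F) (t : ℝ) :
    A (a + t • b) = A a + t • A.linearIsometryEquiv b := by
  have := A.map_vadd a (t • b)
  rw [vadd_eq_add, vadd_eq_add, map_smul, add_comm] at this
  rw [this, add_comm]

lemma affine_unique {a a' b b' : F} {t₀ : ℝ} (h : ∀ᶠ t in 𝓝 t₀, a + t • b = a' + t • b') :
    a = a' ∧ b = b' := by
  have h1 : ∀ a b : F, HasDerivAt (fun t : ℝ => a + t • b) b t₀ := fun a b => by
    simpa using ((hasDerivAt_id t₀).smul_const b).const_add a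
  have hb : b = b' := (h1 a b).unique ((h1 a' b').congr_of_eventuallyEq h)
  have h0 := h.self_of_nhds
  rw [hb, add_left_inj] at h0
  exact ⟨h0, hb⟩

/-- Along the line from `x` to any `y` the two maps are affine functions of time that agree near
time zero. -/
lemma AffineIsometryEquiv.eq_of_eventuallyEq {A B : F ≃ᵃⁱ[ℝ] F} {x : F}
    (h : ∀ᶠ y in 𝓝 x, A y = B y) : A = B := by
  ext y
  have hl : Filter.Tendsto (fun t : ℝ => x + t • (y - x)) (𝓝 0) (𝓝 x) := by
    have : ContinuousAt (fun t : ℝ => x + t • (y - x)) 0 := by fun_prop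
    simpa using this.tendsto
  have h1 := affine_unique (t₀ := 0) (a := A x) (a' := B x) (b := A.linearIsometryEquiv (y - x))
    (b' := B.linearIsometryEquiv (y - x)) ((hl.eventually h).mono fun t ht => by
      rwa [A.map_add_smul, B.map_add_smul] at ht)
  have h2 := A.map_add_smul x (y - x) 1
  rw [h1.1, h1.2, ← B.map_add_smul] at h2
  simpa using h2

/-- A family of charts such that the changes of charts are locally affine isometries, and such that
there are arbitrarily small charts onto balls. -/
structure IsAffineAtlas (S : Set (OpenPartialHomeomorph L F)) : Prop where
  transition : ∀ σ ∈ S, ∀ τ ∈ S, ∀ q ∈ σ.source, q ∈ τ.source →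
    ∃ A : F ≃ᵃⁱ[ℝ] F, ∀ᶠ p in 𝓝 q, τ p = A (σ p)
  exists_ball : ∀ q, ∃ σ ∈ S, q ∈ σ.source ∧ ∃ r, 0 < r ∧ σ.target = Metric.ball (σ q) r

/-- The curve `c` is a straight line near `t₀` in some chart. -/
def LineAt (S : Set (OpenPartialHomeomorph L F)) (c : ℝ → L) (t₀ : ℝ) : Prop :=
  ∃ σ ∈ S, c t₀ ∈ σ.source ∧ ∃ b : F, ∀ᶠ t in 𝓝 t₀, c t = σ.symm (σ (c t₀) + (t - t₀) • b)

/-- The map `P` is an affine isometry in the chart `σ` near `x`. -/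
def GermAt (P : F → L) (σ : OpenPartialHomeomorph L F) (A : F ≃ᵃⁱ[ℝ] F) (x : F) : Prop :=
  ∀ᶠ y in 𝓝 x, A y ∈ σ.target ∧ P y = σ.symm (A y)

variable {S : Set (OpenPartialHomeomorph L F)}

lemma tendsto_line (a b : F) (t₀ : ℝ) :
    Filter.Tendsto (fun t : ℝ => a + (t - t₀) • b) (𝓝 t₀) (𝓝 a) := by
  have : ContinuousAt (fun t : ℝ => a + (t - t₀) • b) t₀ := by fun_prop
  simpa using this.tendsto

lemma lineAt_symm {σ : OpenPartialHomeomorph L F} (hσ : σ ∈ S) {a b : F} {t₀ : ℝ}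
    (h : a + t₀ • b ∈ σ.target) : LineAt S (fun t => σ.symm (a + t • b)) t₀ := by
  refine ⟨σ, hσ, σ.map_target h, b, Filter.Eventually.of_forall fun t => ?_⟩
  rw [σ.right_inv h, sub_smul, add_assoc, add_sub_cancel]

namespace LineAt

variable {c : ℝ → L} {t₀ : ℝ}

lemma continuousAt (hc : LineAt S c t₀) : ContinuousAt c t₀ := by
  obtain ⟨σ, -, hq, b, hb⟩ := hc
  have h1 : Filter.Tendsto (fun t => σ.symm (σ (c t₀) + (t - t₀) • b)) (𝓝 t₀) (𝓝 (c t₀)) := by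
    have := (σ.continuousAt_symm (σ.map_source hq)).tendsto
    rw [σ.left_inv hq] at this
    exact this.comp (tendsto_line _ _ _)
  exact h1.congr' (hb.mono fun t ht => ht.symm)

lemma comp_mul {s : ℝ} (hc : LineAt S c (s * t₀)) : LineAt S (fun t => c (s * t)) t₀ := by
  obtain ⟨σ, hσ, hq, b, hb⟩ := hc
  refine ⟨σ, hσ, hq, s • b, ?_⟩
  have : Filter.Tendsto (fun t => s * t) (𝓝 t₀) (𝓝 (s * t₀)) := by
    have h : Continuous fun t : ℝ => s * t := by fun_prop
    exact h.tendsto t₀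
  filter_upwards [this.eventually hb] with t ht
  rw [ht, smul_smul]
  congr 3
  ring

variable (hS : IsAffineAtlas S)
include hS

lemma exists_eq (hc : LineAt S c t₀) {τ : OpenPartialHomeomorph L F} (hτ : τ ∈ S)
    (hq : c t₀ ∈ τ.source) :
    ∃ b, ∀ᶠ t in 𝓝 t₀, c t ∈ τ.source ∧ τ (c t) = τ (c t₀) + (t - t₀) • b := by
  have hcont := hc.continuousAt
  obtain ⟨σ, hσ, hqσ, b, hb⟩ := hc
  obtain ⟨A, hA⟩ := hS.transition σ hσ τ hτ _ hqσ hq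
  refine ⟨A.linearIsometryEquiv b, ?_⟩
  filter_upwards [hb, hcont.eventually hA, hcont.eventually (τ.open_source.mem_nhds hq),
    (tendsto_line (σ (c t₀)) b t₀).eventually (σ.open_target.mem_nhds (σ.map_source hqσ))]
    with t h1 h2 h3 h4
  refine ⟨h3, ?_⟩
  rw [h2, h1, σ.right_inv h4, A.map_add_smul, hA.self_of_nhds]

/-- Straight lines are determined by their germs. -/
lemma eqOn [T2Space L] {c' : ℝ → L} {I : Set ℝ} (hI : IsPreconnected I) (hc : ∀ t ∈ I, LineAt S c t)
    (hc' : ∀ t ∈ I, LineAt S c' t) (ht₀ : t₀ ∈ I) (h : c =ᶠ[𝓝 t₀] c') : EqOn c c' I := by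
  -- The set of times at which the germs agree is open; it must be shown to be closed in `I`. At a
  -- limit time `t` the values agree by the Hausdorff property.
  have hsub : I ⊆ {t | c =ᶠ[𝓝 t] c'} := by
    refine hI.subset_of_closure_inter_subset isOpen_setOfPred_eventually_nhds ⟨t₀, ht₀, h⟩ ?_
    rintro t ⟨htc, htI⟩
    have hfr := mem_closure_iff_frequently.1 htc
    have heq : c t = c' t := by
      by_contra hne
      obtain ⟨U, V, hU, hV, h1, h2, hd⟩ := t2_separation hne
      obtain ⟨s, ⟨hs, hsU⟩, hsV⟩ := ((hfr.and_eventually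
        ((hc t htI).continuousAt.eventually (hU.mem_nhds h1))).and_eventually
          ((hc' t htI).continuousAt.eventually (hV.mem_nhds h2))).exists
      exact hd.le_bot ⟨hsU, hs.self_of_nhds ▸ hsV⟩
    obtain ⟨σ, hσ, hqσ, -⟩ := hc t htI
    obtain ⟨b, hb⟩ := (hc t htI).exists_eq hS hσ hqσ
    obtain ⟨b', hb'⟩ := (hc' t htI).exists_eq hS hσ (heq ▸ hqσ)
    obtain ⟨s, ⟨hs, h1⟩, h2⟩ := ((hfr.and_eventually hb).and_eventually hb').exists
    by_cases hst : s = t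
    · rwa [hst] at hs
    -- In one chart both curves are affine near `t` with the same value at `t`; a second common
    -- value, at a nearby `s ≠ t`, makes the directions equal.
    · have h3 : (s - t) • b = (s - t) • b' := by
        have := h1.2.symm.trans ((congrArg σ hs.self_of_nhds).trans h2.2)
        rwa [heq, add_right_inj] at this
      have hbb : b = b' := smul_right_injective F (sub_ne_zero.2 hst) h3
      filter_upwards [hb, hb'] with r h4 h5
      exact σ.injOn h4.1 h5.1 (by rw [h4.2, h5.2, heq, hbb])
  exact fun t ht => (hsub ht).self_of_nhds

end LineAt

/-- Balls are convex, so a line spends an interval of time in one. This is why charts onto balls are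
needed: uniqueness of lines propagates through the whole chart. -/
lemma isPreconnected_line_mem_ball (A : F ≃ᵃⁱ[ℝ] F) (a b c : F) (r : ℝ) :
    IsPreconnected {t : ℝ | A (a + t • b) ∈ Metric.ball c r} := by
  have : Convex ℝ {t : ℝ | A (a + t • b) ∈ Metric.ball c r} := by
    intro s hs t ht α β hα hβ hαβ
    have h1 := convex_ball c r hs ht hα hβ hαβ
    have h2 : A (a + (α • s + β • t) • b) = α • A (a + s • b) + β • A (a + t • b) := by
      rw [A.map_add_smul, A.map_add_smul, A.map_add_smul, add_smul, smul_assoc, smul_assoc,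
        smul_add, smul_add, add_add_add_comm, ← add_smul α β, hαβ, one_smul]
    rw [mem_ofPred_eq, h2]
    exact h1
  exact this.isPreconnected

namespace GermAt

variable {P : F → L} {σ : OpenPartialHomeomorph L F} {A : F ≃ᵃⁱ[ℝ] F} {x : F}

lemma mem_source (h : GermAt P σ A x) : P x ∈ σ.source := by
  rw [h.self_of_nhds.2]
  exact σ.map_target h.self_of_nhds.1

lemma apply_eq (h : GermAt P σ A x) : σ (P x) = A x := by
  rw [h.self_of_nhds.2, σ.right_inv h.self_of_nhds.1]

lemma continuousAt (h : GermAt P σ A x) : ContinuousAt P x := by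
  have h1 : ContinuousAt (fun y => σ.symm (A y)) x :=
    (σ.continuousAt_symm h.self_of_nhds.1).comp A.continuous.continuousAt
  exact h1.congr (h.mono fun y hy => hy.2.symm)

lemma eventually (h : GermAt P σ A x) : ∀ᶠ y in 𝓝 x, GermAt P σ A y :=
  eventually_eventually_nhds.2 h

lemma unique {B : F ≃ᵃⁱ[ℝ] F} (h : GermAt P σ A x) (h' : GermAt P σ B x) : A = B := by
  refine AffineIsometryEquiv.eq_of_eventuallyEq (x := x) ?_
  filter_upwards [h, h'] with y hy hy'
  rw [← σ.right_inv hy.1, ← hy.2, hy'.2, σ.right_inv hy'.1]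

lemma change (hS : IsAffineAtlas S) (hσ : σ ∈ S) (h : GermAt P σ A x)
    {τ : OpenPartialHomeomorph L F} (hτ : τ ∈ S) (hx : P x ∈ τ.source) :
    ∃ B, GermAt P τ B x := by
  obtain ⟨T, hT⟩ := hS.transition σ hσ τ hτ _ h.mem_source hx
  refine ⟨A.trans T, ?_⟩
  filter_upwards [h.eventually, h.continuousAt.eventually hT,
    h.continuousAt.eventually (τ.open_source.mem_nhds hx)] with y h1 h2 h3
  have h4 : A.trans T y = τ (P y) := by
    rw [h2, h1.apply_eq]
    rfl
  rw [h4]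
  exact ⟨τ.map_source h3, (τ.left_inv h3).symm⟩

lemma lineAt (hσ : σ ∈ S) {a b : F} {t₀ : ℝ} (h : GermAt P σ A (a + t₀ • b)) :
    LineAt S (fun t => P (a + t • b)) t₀ := by
  refine ⟨σ, hσ, h.mem_source, A.linearIsometryEquiv b, ?_⟩
  have hl : Filter.Tendsto (fun t : ℝ => a + t • b) (𝓝 t₀) (𝓝 (a + t₀ • b)) := by
    have : Continuous fun t : ℝ => a + t • b := by fun_prop
    exact this.tendsto t₀
  filter_upwards [hl.eventually h] with t ht
  rw [ht.2, h.apply_eq, A.map_add_smul, A.map_add_smul, sub_smul]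
  congr 1
  abel

end GermAt

end AffineAtlas

/-! ### The exponential map of a complete affine atlas is a covering. -/

section AffineCovering

variable {F : Type*} [NormedAddCommGroup F] [InnerProductSpace ℝ F]
  {L : Type*} [TopologicalSpace L] {S : Set (OpenPartialHomeomorph L F)}

section

variable [T2Space L] (hS : IsAffineAtlas S) {P : F → L} {σ : OpenPartialHomeomorph L F} (hσ : σ ∈ S)
  {c : F} {r : ℝ} (hball : σ.target = Metric.ball c r)
include hS hσ hball

/-- A straight line which agrees with a straight line of a chart onto a ball at some time agrees with
it as long as the latter stays in the ball. -/
lemma lineAt_eq_symm {κ : ℝ → L} {a b : F} {A : F ≃ᵃⁱ[ℝ] F} {t₀ t : ℝ}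
    (hκ : ∀ s, LineAt S κ s) (h : ∀ᶠ s in 𝓝 t₀, κ s = σ.symm (A (a + s • b)))
    (ht₀ : A (a + t₀ • b) ∈ Metric.ball c r) (ht : A (a + t • b) ∈ Metric.ball c r) :
    κ t = σ.symm (A (a + t • b)) := by
  refine LineAt.eqOn hS (c' := fun s => σ.symm (A (a + s • b)))
    (isPreconnected_line_mem_ball A a b c r) (fun s _ => hκ s) (fun s hs => ?_) ht₀ h ht
  have h1 : A (a + s • b) ∈ σ.target := hball ▸ hs
  simp only [A.map_add_smul] at h1 ⊢
  exact lineAt_symm hσ h1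

/-- `P` maps the segment from `x` to `y` to a straight line, which agrees near `x` with the line of
the chart; the latter stays in the ball by convexity. So a germ of `P` extends over the full
preimage of the ball, whose radius does not depend on `x`. -/
lemma GermAt.eq_of_mem_ball (hP : ∀ a b t, LineAt S (fun t : ℝ => P (a + t • b)) t)
    {A : F ≃ᵃⁱ[ℝ] F} {x y : F} (h : GermAt P σ A x) (hy : A y ∈ Metric.ball c r) :
    P y = σ.symm (A y) := by
  have hl : Filter.Tendsto (fun t : ℝ => x + t • (y - x)) (𝓝 0) (𝓝 x) := by
    simpa using tendsto_line x (y - x) 0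
  have h1 := lineAt_eq_symm hS hσ hball (κ := fun t => P (x + t • (y - x))) (a := x) (b := y - x)
    (A := A) (t₀ := 0) (t := 1) (hP _ _) ((hl.eventually h).mono fun t ht => ht.2)
    (by simpa using hball.subset h.self_of_nhds.1) (by simpa using hy)
  simpa using h1

lemma GermAt.of_mem_ball (hP : ∀ a b t, LineAt S (fun t : ℝ => P (a + t • b)) t)
    {A : F ≃ᵃⁱ[ℝ] F} {x y : F} (h : GermAt P σ A x) (hy : A y ∈ Metric.ball c r) :
    GermAt P σ A y := by
  filter_upwards [(Metric.isOpen_ball.preimage A.continuous).mem_nhds hy] with z hz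
  exact ⟨hball.symm.subset hz, h.eq_of_mem_ball hS hσ hball hP hz⟩

end

/-- The exponential map of an affine atlas in which all straight lines are complete. -/
theorem IsAffineAtlas.exists_exp [T2Space L] [Nonempty L] (hS : IsAffineAtlas S)
    (hlines : ∀ σ ∈ S, ∀ q ∈ σ.source, ∀ b : F, ∃ c, (∀ t, LineAt S c t) ∧
      ∀ᶠ t in 𝓝 (0 : ℝ), c t = σ.symm (σ q + t • b)) :
    ∃ P : F → L, ∀ x, ∃ σ ∈ S, ∃ A, GermAt P σ A x := by
  obtain ⟨q₀⟩ := ‹Nonempty L›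
  obtain ⟨σ₀, hσ₀, hq₀, r₀, hr₀, hball₀⟩ := hS.exists_ball q₀
  choose c hc hc0 using hlines σ₀ hσ₀ q₀ hq₀
  let P : F → L := fun v => c v 1
  -- Homogeneity of geodesics, by uniqueness: `c v` run at speed `t` is `c (t • v)`.
  have hcP : ∀ v t, c v t = P (t • v) := by
    intro v t
    have h1 : EqOn (fun s => c v (t * s)) (c (t • v)) univ := by
      refine LineAt.eqOn hS (t₀ := 0) isPreconnected_univ (fun s _ => (hc v _).comp_mul)
        (fun s _ => hc _ s) (mem_univ _) ?_
      have hl : Filter.Tendsto (fun s => t * s) (𝓝 0) (𝓝 0) := by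
        have : Continuous fun s : ℝ => t * s := by fun_prop
        simpa using this.tendsto 0
      filter_upwards [hl.eventually (hc0 v), hc0 (t • v)] with s h2 h3
      rw [h2, h3, smul_smul, mul_comm]
    simpa using h1 (mem_univ 1)
  refine ⟨P, fun v => ?_⟩
  -- The times at which `P` is an isometry near `t • v` form a clopen set containing zero.
  let D : Set ℝ := {t | ∃ σ ∈ S, ∃ A, GermAt P σ A (t • v)}
  have hopen : IsOpen D := by
    refine isOpen_iff_mem_nhds.2 fun t ⟨σ, hσ, A, hA⟩ => ?_
    have hl : Filter.Tendsto (fun s : ℝ => s • v) (𝓝 t) (𝓝 (t • v)) := by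
      have : Continuous fun s : ℝ => s • v := by fun_prop
      exact this.tendsto t
    filter_upwards [hl.eventually hA.eventually] with s hs
    exact ⟨σ, hσ, A, hs⟩
  have hD0 : (0 : ℝ) ∈ D := by
    refine ⟨σ₀, hσ₀, AffineIsometryEquiv.vaddConst ℝ (σ₀ q₀), ?_⟩
    have hA : ∀ y, AffineIsometryEquiv.vaddConst ℝ (σ₀ q₀) y = σ₀ q₀ + y := fun y => by
      simp [add_comm]
    have h0 : (AffineIsometryEquiv.vaddConst ℝ (σ₀ q₀)) ((0 : ℝ) • v) ∈
        Metric.ball (σ₀ q₀) r₀ := by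
      rw [hA, zero_smul, add_zero]
      exact Metric.mem_ball_self hr₀
    filter_upwards [(Metric.isOpen_ball.preimage
      (AffineIsometryEquiv.vaddConst ℝ (σ₀ q₀)).continuous).mem_nhds h0] with y hy
    refine ⟨hball₀.symm.subset hy, ?_⟩
    have h1 := lineAt_eq_symm hS hσ₀ hball₀ (κ := c y) (a := 0) (b := y)
      (A := AffineIsometryEquiv.vaddConst ℝ (σ₀ q₀)) (t₀ := 0) (t := 1) (hc y)
      ((hc0 y).mono fun t ht => by rw [ht, zero_add, hA]) (by simpa using hr₀) (by simpa using hy)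
    simpa using h1
  have hclosed : IsClosed D := by
    refine isClosed_of_closure_subset fun t₁ ht₁ => ?_
    by_cases ht₁0 : t₁ = 0
    · rwa [ht₁0]
    obtain ⟨σ, hσ, hq, r, hr, hball⟩ := hS.exists_ball (c v t₁)
    obtain ⟨b, hb⟩ := (hc v t₁).exists_eq hS hσ hq
    obtain ⟨t, ⟨σ', hσ', A', hA'⟩, hbt⟩ :=
      ((mem_closure_iff_frequently.1 ht₁).and_eventually hb.eventually_nhds).exists
    obtain ⟨A, hA⟩ := hA'.change hS hσ' hσ (by rw [← hcP]; exact hbt.self_of_nhds.1)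
    have hl : Filter.Tendsto (fun s : ℝ => s • v) (𝓝 t) (𝓝 (t • v)) := by
      have : Continuous fun s : ℝ => s • v := by fun_prop
      exact this.tendsto t
    -- A chart at the limit point reads the ray as an affine function near `t₁`. At a nearby good
    -- time `t` it coincides with `A (s • v)`, so they also coincide at `t₁`.
    have hAt₁ : A (t₁ • v) = σ (c v t₁) := by
      have h1 := affine_unique (t₀ := t) (a := A 0) (b := A.linearIsometryEquiv v)
        (a' := σ (c v t₁) - t₁ • b) (b' := b) (by
          filter_upwards [hbt, hl.eventually hA.eventually] with s h1 h2
          rw [← A.map_add_smul, zero_add, ← h2.apply_eq, ← hcP, h1.2, sub_smul]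
          abel)
      have h2 := A.map_add_smul 0 v t₁
      rw [h1.1, h1.2, zero_add, sub_add_cancel] at h2
      exact h2
    have hw1 : Filter.Tendsto (fun y : F => t • t₁⁻¹ • y) (𝓝 (t₁ • v)) (𝓝 (t • v)) := by
      have : Continuous fun y : F => t • t₁⁻¹ • y := by fun_prop
      have := this.tendsto (t₁ • v)
      rwa [inv_smul_smul₀ ht₁0] at this
    have hmem : A (t₁ • v) ∈ Metric.ball (σ (c v t₁)) r := by
      rw [hAt₁]
      exact Metric.mem_ball_self hr
    refine ⟨σ, hσ, A, ?_⟩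
    -- For `y` near `t₁ • v`, the ray through `y` is at time `t` in the region where `A` represents
    -- `P`, and at time `t₁` in the preimage of the ball. It is compared with the chart line between
    -- these times; `t₁ ≠ 0` allows `y` to be reached at time `t₁`.
    filter_upwards [hw1.eventually hA.eventually,
      (Metric.isOpen_ball.preimage A.continuous).mem_nhds hmem] with y h1 h2
    refine ⟨hball.symm.subset h2, ?_⟩
    have hl' : Filter.Tendsto (fun s : ℝ => s • t₁⁻¹ • y) (𝓝 t) (𝓝 (t • t₁⁻¹ • y)) := by
      have : Continuous fun s : ℝ => s • t₁⁻¹ • y := by fun_prop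
      exact this.tendsto t
    have h3 := lineAt_eq_symm hS hσ hball (κ := c (t₁⁻¹ • y)) (a := 0) (b := t₁⁻¹ • y)
      (A := A) (t₀ := t) (t := t₁) (hc _)
      ((hl'.eventually h1).mono fun s hs => by rw [hcP, hs.2, zero_add])
      (by rw [zero_add]; exact hball.subset h1.self_of_nhds.1)
      (by rw [zero_add, smul_inv_smul₀ ht₁0]; exact h2)
    rwa [hcP, zero_add, smul_inv_smul₀ ht₁0] at h3
  have huniv : D = univ := IsClopen.eq_univ ⟨hclosed, hopen⟩ ⟨0, hD0⟩
  have h1 : (1 : ℝ) ∈ D := huniv.symm.subset (mem_univ _)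
  have h2 : ∃ σ ∈ S, ∃ A, GermAt P σ A ((1 : ℝ) • v) := h1
  rwa [one_smul] at h2

section Covering

variable [T2Space L] (hS : IsAffineAtlas S) {P : F → L} (hP : ∀ x, ∃ σ ∈ S, ∃ A, GermAt P σ A x)
include hS hP

lemma lineAt_of_germs (a b : F) (t : ℝ) : LineAt S (fun t : ℝ => P (a + t • b)) t := by
  obtain ⟨σ, hσ, A, hA⟩ := hP (a + t • b)
  exact hA.lineAt hσ

lemma continuous_of_germs : Continuous P := continuous_iff_continuousAt.2 fun x => by
  obtain ⟨σ, hσ, A, hA⟩ := hP x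
  exact hA.continuousAt

lemma exists_germAt {σ : OpenPartialHomeomorph L F} (hσ : σ ∈ S) {x : F} (hx : P x ∈ σ.source) :
    ∃ A, GermAt P σ A x := by
  obtain ⟨τ, hτ, A, hA⟩ := hP x
  exact hA.change hS hτ hσ hx

/-- If the image of `P` meets a chart onto a ball then it contains the whole chart, because germs
extend over the preimage of the ball. So the image is open and closed. -/
theorem surjective_of_germs [PreconnectedSpace L] : Surjective P := by
  rw [← range_eq_univ]
  refine IsClopen.eq_univ ⟨?_, ?_⟩ (range_nonempty P)
  · refine isClosed_of_closure_subset fun q hq => ?_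
    obtain ⟨σ, hσ, hqσ, r, hr, hball⟩ := hS.exists_ball q
    obtain ⟨p, ⟨x, rfl⟩, hp⟩ := ((mem_closure_iff_frequently.1 hq).and_eventually
      (σ.open_source.mem_nhds hqσ)).exists
    obtain ⟨A, hA⟩ := exists_germAt hS hP hσ hp
    refine ⟨A.symm (σ q), ?_⟩
    rw [hA.eq_of_mem_ball hS hσ hball (lineAt_of_germs hS hP)
      (by simpa using hr), A.apply_symm_apply, σ.left_inv hqσ]
  · refine isOpen_iff_mem_nhds.2 ?_
    rintro _ ⟨x, rfl⟩
    obtain ⟨σ, hσ, hqσ, r, hr, hball⟩ := hS.exists_ball (P x)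
    obtain ⟨A, hA⟩ := exists_germAt hS hP hσ hqσ
    filter_upwards [σ.open_source.mem_nhds hqσ] with p hp
    refine ⟨A.symm (σ p), ?_⟩
    rw [hA.eq_of_mem_ball hS hσ hball (lineAt_of_germs hS hP)
      (by rw [A.apply_symm_apply]; exact hball.subset (σ.map_source hp)), A.apply_symm_apply,
      σ.left_inv hp]

/-- Over a chart `σ` onto a ball centred at `σ q`, every `z` has an isometry `A z` with `P = σ.symm
∘ A z` near `z`, and this extends over the preimage of the ball under `A z`. That ball is the sheet
of `z`; its centre `(A z).symm (σ q)` is its only point over `q` and labels it. -/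
theorem isCoveringMap_of_germs : IsCoveringMap P := by
  intro q
  obtain ⟨σ, hσ, hqσ, r, hr, hball⟩ := hS.exists_ball q
  have hlines := lineAt_of_germs hS hP
  have hcont := continuous_of_germs hS hP
  have hex : ∀ x, ∃ A : F ≃ᵃⁱ[ℝ] F, P x ∈ σ.source → GermAt P σ A x := fun x => by
    by_cases hx : P x ∈ σ.source
    · obtain ⟨A, hA⟩ := exists_germAt hS hP hσ hx
      exact ⟨A, fun _ => hA⟩
    · exact ⟨AffineIsometryEquiv.refl ℝ F, fun h => absurd h hx⟩
  choose A hA using hex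
  have hcenter : ∀ z, A z ((A z).symm (σ q)) ∈ Metric.ball (σ q) r := fun z => by
    simpa using hr
  have hfib : ∀ z, P z ∈ σ.source → P ((A z).symm (σ q)) = q := fun z hz => by
    rw [(hA z hz).eq_of_mem_ball hS hσ hball hlines (hcenter z), (A z).apply_symm_apply,
      σ.left_inv hqσ]
  have hpt : ∀ y, P y = q → A y y = σ q := fun y hy => by
    rw [← (hA y (hy ▸ hqσ)).apply_eq, hy]
  have hdisc : DiscreteTopology (P ⁻¹' {q}) := by
    rw [discreteTopology_iff_isOpen_singleton]
    rintro ⟨y, hy⟩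
    have hgerm := hA y ((show P y = q from hy) ▸ hqσ)
    refine ⟨(A y) ⁻¹' Metric.ball (σ q) r, Metric.isOpen_ball.preimage (A y).continuous, ?_⟩
    ext ⟨z, hz⟩
    simp only [mem_preimage, mem_singleton_iff, Subtype.mk.injEq] at hy hz ⊢
    constructor
    · intro h
      have h1 := hgerm.of_mem_ball hS hσ hball hlines h
      have h2 := h1.apply_eq
      rw [hz, ← hpt y hy] at h2
      exact ((A y).injective h2).symm
    · rintro rfl
      rw [hpt _ hy]
      exact Metric.mem_ball_self hr
  refine ⟨hdisc, σ.source, hqσ, σ.open_source, σ.open_source.preimage hcont, ?_⟩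
  have hsheet : ∀ p ∈ σ.source, ∀ y, P y = q → P ((A y).symm (σ p)) = p ∧
      A ((A y).symm (σ p)) = A y := by
    intro p hp y hy
    have h1 : A y ((A y).symm (σ p)) ∈ Metric.ball (σ q) r := by
      rw [(A y).apply_symm_apply]
      exact hball.subset (σ.map_source hp)
    have h2 := (hA y (hy ▸ hqσ)).of_mem_ball hS hσ hball hlines h1
    have h3 : P ((A y).symm (σ p)) = p := by
      rw [h2.self_of_nhds.2, (A y).apply_symm_apply, σ.left_inv hp]
    exact ⟨h3, (hA _ (h3.symm ▸ hp)).unique h2⟩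
  refine ⟨{
    toFun := fun z => (⟨P z, z.2⟩, ⟨(A z).symm (σ q), hfib z z.2⟩)
    invFun := fun w => ⟨(A w.2).symm (σ w.1), by
      rw [mem_preimage, (hsheet w.1 w.1.2 w.2 w.2.2).1]
      exact w.1.2⟩
    left_inv := fun ⟨z, hz⟩ => ?_
    right_inv := fun ⟨⟨p, hp⟩, ⟨y, hy⟩⟩ => ?_
    continuous_toFun := ?_
    continuous_invFun := ?_ }, fun x => rfl⟩
  · have h1 : A ((A z).symm (σ q)) = A z :=
      (hA _ ((hfib z hz).symm ▸ hqσ)).unique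
        ((hA z hz).of_mem_ball hS hσ hball hlines (hcenter z))
    simp only [Subtype.mk.injEq]
    rw [h1, (hA z hz).apply_eq, (A z).symm_apply_apply]
  · have h1 := hsheet p hp y hy
    refine Prod.ext (Subtype.ext h1.1) (Subtype.ext ?_)
    change (A ((A y).symm (σ p))).symm (σ q) = y
    rw [h1.2, ← hpt y hy, (A y).symm_apply_apply]
  · refine Continuous.prodMk ?_ ?_
    · exact (hcont.comp continuous_subtype_val).subtype_mk _
    · refine Continuous.subtype_mk (continuous_iff_continuousAt.2 fun ⟨z, hz⟩ => ?_) _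
      refine (continuousAt_const (y := (A z).symm (σ q))).congr ?_
      -- The label is locally constant, since the isometry representing a germ is unique.
      have h1 : ∀ᶠ z' in 𝓝 z, A z' = A z := by
        filter_upwards [(hA z hz).eventually] with z' h
        exact (hA z' h.mem_source).unique h
      filter_upwards [continuous_subtype_val.continuousAt.eventually h1] with z' h
      rw [h]
  · refine Continuous.subtype_mk (continuous_prod_of_discrete_right.2 fun y => ?_) _
    exact (A y).symm.continuous.comp
      (σ.continuousOn.comp_continuous continuous_subtype_val fun p => p.2)

end Covering

end AffineCovering

/-! ### Smoothness of a form from its coordinate expressions. -/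

section SmoothForms

variable {F : Type*} [NormedAddCommGroup F] [NormedSpace ℝ F] [FiniteDimensional ℝ F]
  {L : Type*} [TopologicalSpace L] [ChartedSpace F L] [IsManifold 𝓘(ℝ, F) ∞ L]

lemma trivialization_symm_eq {x₀ x : L} (hx : x ∈ (chartAt F x₀).source) (v : F) :
    (trivializationAt F (TangentSpace 𝓘(ℝ, F)) x₀).symm x v =
      dAt F F (chartAt F x₀).symm (chartAt F x₀ x) v := by
  have : IsManifold 𝓘(ℝ, F) 1 L := IsManifold.of_le (n := ∞) (by simp)
  have h1 := TangentBundle.symmL_trivializationAt (I := 𝓘(ℝ, F)) (𝕜 := ℝ) hx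
  have h2 := congrArg (fun T : F →L[ℝ] F => T v) h1
  have h3 : (trivializationAt F (TangentSpace 𝓘(ℝ, F)) x₀).symmL ℝ x v =
      (trivializationAt F (TangentSpace 𝓘(ℝ, F)) x₀).symm x v :=
    Trivialization.symmL_apply _ (by simpa using hx) v
  rw [← h3]
  refine h2.trans ?_
  simp only [dAt, modelWithCornersSelf_coe, range_id, mfderivWithin_univ, extChartAt,
    mfld_simps]

/-- In the bundle trivialisation at `x₀`, the section `h` is its coordinate expression in the
preferred chart at `x₀`. -/
lemma isSmoothForm_of_coordMetric {h : BilinField F L}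
    (H : ∀ e ∈ IsManifold.maximalAtlas 𝓘(ℝ, F) ∞ L, ∀ y ∈ e.target,
      ContDiffAt ℝ ∞ (coordMetric h e) y) : IsSmoothForm h := by
  intro x₀
  have he := IsManifold.chart_mem_maximalAtlas (I := 𝓘(ℝ, F)) (n := ∞) x₀
  refine contMDiffAt_totalSpace.2 ⟨contMDiffAt_id, ?_⟩
  have h1 : ContMDiffAt 𝓘(ℝ, F) 𝓘(ℝ, F →L[ℝ] F →L[ℝ] ℝ) ∞
      (fun x => coordMetric h (chartAt F x₀) (chartAt F x₀ x)) x₀ :=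
    (H _ he _ (mem_chart_target F x₀)).contMDiffAt.comp x₀
      (contMDiffAt_of_mem_maximalAtlas he (mem_chart_source F x₀))
  refine h1.congr_of_eventuallyEq ?_
  filter_upwards [(chartAt F x₀).open_source.mem_nhds (mem_chart_source F x₀)] with x hx
  ext v w
  have h2 := inCoordinates_apply_eq₂ (𝕜 := ℝ) (F₁ := F) (F₂ := F) (F₃ := ℝ)
    (E₁ := fun x : L => TangentSpace 𝓘(ℝ, F) x) (E₂ := fun x : L => TangentSpace 𝓘(ℝ, F) x)
    (E₃ := Bundle.Trivial L ℝ) (x₀ := x₀) (x := x) (ϕ := h x) (v := v) (w := w)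
    (by simpa using hx) (by simpa using hx) (by simp)
  refine h2.trans ?_
  rw [coordMetric_apply, (chartAt F x₀).left_inv hx, ← trivialization_symm_eq hx,
    ← trivialization_symm_eq hx]
  simp [formAt]
  rfl

end SmoothForms

/-! ### Flat charts form an affine atlas. -/

section FlatAtlas

variable {F : Type*} [NormedAddCommGroup F] [InnerProductSpace ℝ F] [FiniteDimensional ℝ F]
  {L : Type*} [TopologicalSpace L] [ChartedSpace F L] [IsManifold 𝓘(ℝ, F) ∞ L]

lemma isCoordMetricOn_inner : IsCoordMetricOn (fun _ : F => (innerSL ℝ : F →L[ℝ] F →L[ℝ] ℝ)) univ where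
  isOpen := isOpen_univ
  contDiffOn := contDiffOn_const
  symm := fun _ _ u v => real_inner_comm v u
  nondeg := fun _ _ u hu => inner_self_eq_zero.1 (hu u)

lemma christoffel_inner (y u v : F) :
    christoffel (fun _ : F => (innerSL ℝ : F →L[ℝ] F →L[ℝ] ℝ)) y u v = 0 :=
  isCoordMetricOn_inner.nondeg y (mem_univ y) _ fun w => by
    rw [isCoordMetricOn_inner.apply_christoffel (mem_univ y)]
    simp

/-- A local isometry of a Euclidean space is an affine isometry. -/
lemma exists_affineIsometry {τ : F → F} {x : F} (hτ : ∀ᶠ z in 𝓝 x, ContDiffAt ℝ ∞ τ z)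
    (hiso : ∀ᶠ z in 𝓝 x, ∀ a b, inner ℝ (fderiv ℝ τ z a) (fderiv ℝ τ z b) = inner ℝ a b) :
    ∃ A : F ≃ᵃⁱ[ℝ] F, ∀ᶠ z in 𝓝 x, τ z = A z := by
  obtain ⟨r, hr, hball⟩ := Metric.eventually_nhds_iff_ball.1 (hτ.and hiso)
  have hlin : ∀ z ∈ Metric.ball x r, ∃ T : F ≃ₗᵢ[ℝ] F, ∀ a, fderiv ℝ τ z a = T a := fun z hz =>
    ⟨((fderiv ℝ τ z : F →ₗ[ℝ] F).isometryOfInner ((hball z hz).2)).toLinearIsometryEquiv rfl,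
      fun a => rfl⟩
  -- The second derivative is orthogonal to the image of the first, which is everything because the
  -- first derivative is a linear isometry of a finite-dimensional space.
  have hD2 : ∀ z ∈ Metric.ball x r, fderiv ℝ (fderiv ℝ τ) z = 0 := by
    intro z hz
    have hsm : ContDiffAt ℝ 2 τ z := (hball z hz).1.of_le two_le_smooth
    obtain ⟨T, hT⟩ := hlin z hz
    ext u v
    have h1 := fun w => isCoordMetricOn_inner.mapHessian_orthogonal (mem_univ (τ z)) hsm
      (fun a b u => by
        have : (fun z => (innerSL ℝ : F →L[ℝ] F →L[ℝ] ℝ) (fderiv ℝ τ z a) (fderiv ℝ τ z b))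
            =ᶠ[𝓝 z] fun _ => inner ℝ a b := by
          filter_upwards [Metric.isOpen_ball.mem_nhds hz] with y hy using (hball y hy).2 a b
        rw [this.fderiv_eq]
        simp) u v w
    have h2 : mapHessian (fun _ : F => (innerSL ℝ : F →L[ℝ] F →L[ℝ] ℝ)) τ z u v =
        fderiv ℝ (fderiv ℝ τ) z u v := by
      rw [mapHessian, christoffel_inner, add_zero, fderiv_fderiv_apply hsm]
    rw [h2] at h1
    refine (inner_self_eq_zero (𝕜 := ℝ)).1 ?_
    have h3 := h1 (T.symm (fderiv ℝ (fderiv ℝ τ) z u v))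
    rw [hT, T.apply_symm_apply] at h3
    exact h3
  have hx : x ∈ Metric.ball x r := Metric.mem_ball_self hr
  obtain ⟨T, hT⟩ := hlin x hx
  have hconst : ∀ z ∈ Metric.ball x r, fderiv ℝ τ z = fderiv ℝ τ x := fun z hz =>
    Metric.isOpen_ball.is_const_of_fderiv_eq_zero (𝕜 := ℝ) (convex_ball x r).isPreconnected
      (fun y hy => (((hball y hy).1.fderiv_right (m := ∞) (by simp)).differentiableAt
        (by simp)).differentiableWithinAt) hD2 hz hx
  obtain ⟨a, ha⟩ := Metric.isOpen_ball.exists_eq_add_of_fderiv_eq (𝕜 := ℝ) (f := τ)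
    (g := fderiv ℝ τ x)
    (convex_ball x r).isPreconnected
    (fun y hy => ((hball y hy).1.differentiableAt (by simp)).differentiableWithinAt)
    (fderiv ℝ τ x).differentiable.differentiableOn
    (fun y hy => by rw [hconst y hy, ContinuousLinearMap.fderiv])
  refine ⟨T.toAffineIsometryEquiv.trans (AffineIsometryEquiv.constVAdd ℝ F a), ?_⟩
  filter_upwards [Metric.isOpen_ball.mem_nhds hx] with z hz
  refine (ha hz).trans ?_
  change fderiv ℝ τ x z + a = _
  rw [hT, AffineIsometryEquiv.coe_trans, comp_apply, AffineIsometryEquiv.coe_constVAdd,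
    LinearIsometryEquiv.coe_toAffineIsometryEquiv]
  exact add_comm _ _

namespace IsFlatChart

variable {h : BilinField F L} {σ τ : OpenPartialHomeomorph L F}

lemma restrict_ball (hσ : IsFlatChart h σ) (c : F) (r : ℝ) :
    IsFlatChart h (σ.symm.restrOpen (Metric.ball c r) Metric.isOpen_ball).symm := by
  refine ⟨OpenPartialHomeomorph.mem_maximalAtlas_of_contMDiffOn _ ?_ ?_, ?_⟩
  · exact (contMDiffOn_of_mem_maximalAtlas hσ.mem).mono inter_subset_left
  · exact (contMDiffOn_symm_of_mem_maximalAtlas hσ.mem).mono inter_subset_left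
  · intro y hy a b
    exact hσ.coordMetric_eq y hy.1 a b

lemma inner_eq (hσ : IsFlatChart h σ) {q : L} (hq : q ∈ σ.source) (u v : F) :
    inner ℝ (dAt F F σ q u) (dAt F F σ q v) = formAt h q u v := by
  rw [← hσ.coordMetric_eq _ (σ.map_source hq), coordMetric_chart hσ.mem hq]

end IsFlatChart

lemma isAffineAtlas_flatChart {h : BilinField F L}
    (hflat : ∀ q : L, ∃ σ, IsFlatChart h σ ∧ q ∈ σ.source) :
    IsAffineAtlas {σ | IsFlatChart h σ} where
  transition := by
    intro σ hσ τ hτ q hqσ hqτ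
    have hσ' : IsFlatChart h σ := hσ
    have hτ' : IsFlatChart h τ := hτ
    have hx := σ.map_source hqσ
    have hev : ∀ᶠ z in 𝓝 (σ q), z ∈ σ.target ∧ σ.symm z ∈ τ.source :=
      (σ.open_target.eventually_mem hx).and ((σ.continuousAt_symm hx).eventually
        (τ.open_source.mem_nhds (by rwa [σ.left_inv hqσ])))
    obtain ⟨A, hA⟩ := exists_affineIsometry (τ := fun z => τ (σ.symm z)) (x := σ q)
      (by
        filter_upwards [hev] with z hz
        exact ((contMDiffAt_of_mem_maximalAtlas hτ'.mem hz.2).comp z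
          (contMDiffAt_symm_of_mem_maximalAtlas hσ'.mem hz.1)).contDiffAt)
      (by
        filter_upwards [hev] with z hz a b
        have h1 : fderiv ℝ (fun z => τ (σ.symm z)) z =
            (dAt F F τ (σ.symm z)).comp (dAt F F σ.symm z) := fderiv_comp_dAt
          ((contMDiffAt_of_mem_maximalAtlas hτ'.mem hz.2).mdifferentiableAt (by simp))
          ((contMDiffAt_symm_of_mem_maximalAtlas hσ'.mem hz.1).mdifferentiableAt (by simp))
        rw [h1, ContinuousLinearMap.comp_apply, ContinuousLinearMap.comp_apply,
          hτ'.inner_eq hz.2, ← hσ'.coordMetric_eq z hz.1]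
        rfl)
    refine ⟨A, ?_⟩
    filter_upwards [(σ.continuousAt hqσ).eventually hA, σ.open_source.mem_nhds hqσ] with p h1 h2
    rwa [σ.left_inv h2] at h1
  exists_ball := by
    intro q
    obtain ⟨σ, hσ, hq⟩ := hflat q
    have hx := σ.map_source hq
    obtain ⟨r, hr, hball⟩ := Metric.isOpen_iff.1 σ.open_target _ hx
    refine ⟨_, hσ.restrict_ball (σ q) r, ?_, r, hr, ?_⟩
    · refine ⟨hq, ?_⟩
      exact Metric.mem_ball_self hr
    · change σ.target ∩ Metric.ball (σ q) r = Metric.ball (σ q) r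
      exact inter_eq_right.2 hball

end FlatAtlas

/-! ### The flat metric: regularity, completeness and universal covering. -/

section RiemannianCompleteness

variable {F : Type*} [NormedAddCommGroup F] [InnerProductSpace ℝ F] [FiniteDimensional ℝ F]
  {L : Type*} [TopologicalSpace L] [ChartedSpace F L] [IsManifold 𝓘(ℝ, F) ∞ L]
  {h : BilinField F L} {σ : OpenPartialHomeomorph L F}

lemma IsFlatChart.christoffel_eq_zero (hσ : IsFlatChart h σ) {y : F} (hy : y ∈ σ.target) (u v : F) :
    christoffel (coordMetric h σ) y u v = 0 := by
  have hev : coordMetric h σ =ᶠ[𝓝 y] fun _ => (innerSL ℝ : F →L[ℝ] F →L[ℝ] ℝ) := by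
    filter_upwards [σ.open_target.mem_nhds hy] with z hz
    ext a b
    exact hσ.coordMetric_eq z hz a b
  rw [← christoffel_inner y u v]
  simp only [christoffel, christoffelFirst, hev.fderiv_eq, hev.self_of_nhds]

/-- In the chart `σ` itself the map is the identity and the Christoffel symbols vanish; vanishing of
the Hessian carries over to `e`. -/
lemma IsFlatChart.mapHessian_symm (hσ : IsFlatChart h σ) (hh : IsPseudoMetric h)
    {e : OpenPartialHomeomorph L F} (he : e ∈ IsManifold.maximalAtlas 𝓘(ℝ, F) ∞ L) {x : F}
    (hx : x ∈ σ.target) (hx' : σ.symm x ∈ e.source) (u v : F) :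
    mapHessian (coordMetric h e) (fun z => e (σ.symm z)) x u v = 0 := by
  have hev : (fun z => σ (σ.symm z)) =ᶠ[𝓝 x] fun z => z := by
    filter_upwards [σ.open_target.mem_nhds hx] with z hz using σ.right_inv hz
  refine hh.mapHessian_chart he hσ.mem (f := σ.symm) (σ.continuousAt_symm hx) hx'
    (σ.map_target hx) (contDiffAt_id.congr_of_eventuallyEq hev) u v ?_
  rw [mapHessian_congr hev, mapHessian, hσ.christoffel_eq_zero hx]
  simp

/-- Curves which are straight lines in flat charts are geodesics. -/
lemma IsFlatLine.isGeodesic (hh : IsPseudoMetric h) {c : ℝ → L} (hc : IsFlatLine h c) :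
    IsGeodesic h c := by
  refine ⟨fun t₀ => ?_, fun e hea t₀ ht₀ => ?_⟩
  · obtain ⟨σ, hσ, hq, b, hb⟩ := hc t₀
    have hl : ContMDiffAt 𝓘(ℝ, ℝ) 𝓘(ℝ, F) ∞ (fun t : ℝ => σ (c t₀) + (t - t₀) • b) t₀ :=
      (contDiffAt_const.add ((contDiffAt_id.sub contDiffAt_const).smul
        contDiffAt_const)).contMDiffAt
    have hs := contMDiffAt_symm_of_mem_maximalAtlas hσ.mem (σ.map_source hq)
    refine (ContMDiffAt.comp_of_eq (g := σ.symm) hs hl ?_).congr_of_eventuallyEq hb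
    simp
  · obtain ⟨σ, hσ, hq, b, hb⟩ := hc t₀
    have he : e ∈ IsManifold.maximalAtlas 𝓘(ℝ, F) ∞ L := IsManifold.subset_maximalAtlas hea
    have hx := σ.map_source hq
    have hx' : σ.symm (σ (c t₀)) ∈ e.source := by rwa [σ.left_inv hq]
    have hΦ : ∀ᶠ z in 𝓝 (σ (c t₀)), z ∈ σ.target ∧ σ.symm z ∈ e.source :=
      (σ.open_target.eventually_mem hx).and ((σ.continuousAt_symm hx).eventually
        (e.open_source.mem_nhds hx'))
    have h1 := hasDerivAt_line_of_mapHessian (G := coordMetric h e)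
      (Φ := fun z => e (σ.symm z)) (x₀ := σ (c t₀)) (b := b) t₀ (by
        filter_upwards [hΦ] with z hz
        exact ⟨((contMDiffAt_of_mem_maximalAtlas he hz.2).comp z
          (contMDiffAt_symm_of_mem_maximalAtlas hσ.mem hz.1)).contDiffAt.of_le two_le_smooth,
          hσ.mapHessian_symm hh he hz.1 hz.2 _ _⟩)
    have h2 : (fun s => e (c s)) =ᶠ[𝓝 t₀] fun t => e (σ.symm (σ (c t₀) + (t - t₀) • b)) := by
      filter_upwards [hb] with t ht
      rw [ht]
    have h3 : deriv (fun s => e (c s)) =ᶠ[𝓝 t₀] fun t =>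
        fderiv ℝ (fun z => e (σ.symm z)) (σ (c t₀) + (t - t₀) • b) b := by
      filter_upwards [h1, h2.eventuallyEq_nhds] with t ht1 ht2
      rw [ht2.deriv_eq, ht1.1.deriv]
    rw [h3.deriv_eq, h1.self_of_nhds.2.deriv, h3.self_of_nhds]
    simp [σ.left_inv hq]

/-- A smooth positive definite field of bilinear forms is a Riemannian metric. -/
lemma exists_riemannianMetric (hs : IsSmoothForm h)
    (hsymm : ∀ q u v, formAt h q u v = formAt h q v u)
    (hpos : ∀ q v, v ≠ 0 → 0 < formAt h q v v)
    (hflat : ∀ q : L, ∃ σ, IsFlatChart h σ ∧ q ∈ σ.source) :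
    ∃ m : ContMDiffRiemannianMetric 𝓘(ℝ, F) ∞ F (fun q : L => TangentSpace 𝓘(ℝ, F) q),
      m.inner = h := by
  refine ⟨⟨h, hsymm, hpos, fun q => ?_, hs⟩, rfl⟩
  obtain ⟨σ, hσ, hq⟩ := hflat q
  -- A flat chart maps the unit ball of `h` at `q` into the Euclidean one, so its vectors are
  -- bounded by the norm of the derivative of the inverse chart.
  change Bornology.IsVonNBounded ℝ {v : F | formAt h q v v < 1}
  refine (NormedSpace.isVonNBounded_iff' ℝ).2 ⟨‖dAt F F σ.symm (σ q)‖, fun v hv => ?_⟩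
  have hv' : formAt h q v v < 1 := hv
  rw [← hσ.inner_eq hq, real_inner_self_eq_norm_sq] at hv'
  have h1 : ‖dAt F F σ q v‖ ≤ 1 := by
    by_contra! hlt
    nlinarith
  rw [← dAt_symm_dAt hσ.mem hq v]
  exact (ContinuousLinearMap.le_opNorm _ _).trans (mul_le_of_le_one_right (norm_nonneg _) h1)

lemma AffineIsometryEquiv.hasFDerivAt (A : F ≃ᵃⁱ[ℝ] F) (x : F) :
    HasFDerivAt A (A.linearIsometryEquiv.toContinuousLinearEquiv : F →L[ℝ] F) x := by
  have h1 := (A.linearIsometryEquiv.toContinuousLinearEquiv : F →L[ℝ] F).hasFDerivAt (x := x)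
  refine (h1.add_const (A 0)).congr_of_eventuallyEq (Filter.Eventually.of_forall fun y => ?_)
  simpa [add_comm] using A.map_add_smul 0 y 1

lemma AffineIsometryEquiv.contDiff (A : F ≃ᵃⁱ[ℝ] F) : ContDiff ℝ ∞ A := by
  have h1 := (A.linearIsometryEquiv.toContinuousLinearEquiv : F →L[ℝ] F).contDiff (n := ∞)
  have h2 : (A : F → F) = fun y =>
      (A.linearIsometryEquiv.toContinuousLinearEquiv : F →L[ℝ] F) y + A 0 := by
    funext y
    simpa [add_comm] using A.map_add_smul 0 y 1
  rw [h2]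
  exact h1.add contDiff_const

/-- The derivative of a map which is an affine isometry in a flat chart. -/
lemma GermAt.dAt_eq (hσ : IsFlatChart h σ) {P : F → L} {A : F ≃ᵃⁱ[ℝ] F} {x : F}
    (hP : GermAt P σ A x) (v : F) :
    dAt F F P x v = dAt F F σ.symm (A x) (A.linearIsometryEquiv v) := by
  have hA := A.hasFDerivAt x
  have hmd : MDifferentiableAt 𝓘(ℝ, F) 𝓘(ℝ, F) A x := hA.differentiableAt.mdifferentiableAt
  rw [dAt_congr (hP.mono fun y hy => hy.2 : P =ᶠ[𝓝 x] fun y => σ.symm (A y)),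
    dAt_comp (h := σ.symm) (f := A)
    ((contMDiffAt_symm_of_mem_maximalAtlas hσ.mem hP.self_of_nhds.1).mdifferentiableAt (by simp))
    hmd, dAt_eq_fderiv (f := A), hA.fderiv]
  rfl

lemma GermAt.isLocalDiffeomorphAt (hσ : IsFlatChart h σ) {P : F → L} {A : F ≃ᵃⁱ[ℝ] F} {x : F}
    (hP : GermAt P σ A x) : IsLocalDiffeomorphAt 𝓘(ℝ, F) 𝓘(ℝ, F) ∞ P x := by
  obtain ⟨O, hO, hOo, hxO⟩ := eventually_nhds_iff.1 hP
  let Φ : OpenPartialHomeomorph F L :=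
    (A.toHomeomorph.toOpenPartialHomeomorph.trans σ.symm).restrOpen O hOo
  have hsrc : ∀ y ∈ Φ.source, y ∈ O ∧ A y ∈ σ.target := fun y hy => ⟨hy.2, (hO y hy.2).1⟩
  have htgt : ∀ q ∈ Φ.target, q ∈ σ.source := fun q hq => by
    have h1 : q ∈ (A.toHomeomorph.toOpenPartialHomeomorph.trans σ.symm).target := hq.1
    simpa using h1
  refine ⟨⟨Φ.toPartialEquiv, Φ.open_source, Φ.open_target, fun y hy => ?_, fun q hq => ?_⟩, ?_, ?_⟩
  · exact (ContMDiffAt.comp (g := σ.symm) (f := A) y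
      (contMDiffAt_symm_of_mem_maximalAtlas hσ.mem (hsrc y hy).2)
      A.contDiff.contMDiff.contMDiffAt).contMDiffWithinAt
  · exact (ContMDiffAt.comp (g := A.symm) (f := σ) q A.symm.contDiff.contMDiff.contMDiffAt
      (contMDiffAt_of_mem_maximalAtlas hσ.mem (htgt q hq))).contMDiffWithinAt
  · exact ⟨by simpa using (hO x hxO).1, hxO⟩
  · intro y hy
    exact (hO y hy.2).2

/-- A surface with a complete flat metric is covered by the Euclidean plane. -/
theorem exists_isMetricUniversalCovering [T2Space L] [ConnectedSpace L]
    (hflat : ∀ q : L, ∃ σ, IsFlatChart h σ ∧ q ∈ σ.source)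
    (hlines : ∀ σ, IsFlatChart h σ → ∀ q ∈ σ.source, ∀ b : F, ∃ c, IsFlatLine h c ∧
      ∀ᶠ t in 𝓝 (0 : ℝ), c t = σ.symm (σ q + t • b)) :
    ∃ P : F → L, IsMetricUniversalCovering (F := F) (F' := F)
      (fun _ => (innerSL ℝ : F →L[ℝ] F →L[ℝ] ℝ)) h P := by
  have hS := isAffineAtlas_flatChart hflat
  obtain ⟨P, hP⟩ := hS.exists_exp hlines
  -- The model space is a vector space, hence contractible and simply connected.
  refine ⟨P, inferInstance, isCoveringMap_of_germs hS hP, surjective_of_germs hS hP,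
    fun x => ?_, ?_⟩
  · obtain ⟨σ, hσ, A, hA⟩ := hP x
    exact hA.isLocalDiffeomorphAt hσ
  · funext x
    obtain ⟨σ, hσ, A, hA⟩ := hP x
    have hσ' : IsFlatChart h σ := hσ
    have key : ∀ u v : F, formAt h (P x) (dAt F F P x u) (dAt F F P x v) = inner ℝ u v := by
      intro u v
      rw [hA.dAt_eq hσ, hA.dAt_eq hσ, hA.self_of_nhds.2, ← coordMetric_apply,
        hσ'.coordMetric_eq _ hA.self_of_nhds.1, LinearIsometryEquiv.inner_map_map]
    exact ContinuousLinearMap.ext fun u => ContinuousLinearMap.ext fun v => key u v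

/-- A manifold in which all straight lines of flat charts extend to all times is complete. -/
theorem isGeodesicallyComplete_of_lines (hh : IsPseudoMetric h)
    (hflat : ∀ q : L, ∃ σ, IsFlatChart h σ ∧ q ∈ σ.source)
    (hlines : ∀ σ, IsFlatChart h σ → ∀ q ∈ σ.source, ∀ b : F, ∃ c, IsFlatLine h c ∧
      ∀ᶠ t in 𝓝 (0 : ℝ), c t = σ.symm (σ q + t • b)) : IsGeodesicallyComplete h := by
  suffices H : ∀ (p : L) (v : F), ∃ c, IsGeodesic h c ∧ c 0 = p ∧ dAt ℝ F c 0 1 = v by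
    intro p v
    obtain ⟨c, hc, rfl, hv⟩ := H p v
    exact ⟨c, hc, congrArg (fun w : F => (⟨c 0, w⟩ : TangentBundle 𝓘(ℝ, F) L)) hv⟩
  intro p v
  obtain ⟨σ, hσ, hp⟩ := hflat p
  obtain ⟨c, hc, hc0⟩ := hlines σ hσ p hp (dAt F F σ p v)
  have hl : HasDerivAt (fun t : ℝ => σ p + t • dAt F F σ p v) (dAt F F σ p v) 0 := by
    simpa using ((hasDerivAt_id (0 : ℝ)).smul_const (dAt F F σ p v)).const_add (σ p)
  have hx : σ p + (0 : ℝ) • dAt F F σ p v = σ p := by simp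
  refine ⟨c, hc.isGeodesic hh, by simpa [σ.left_inv hp] using hc0.self_of_nhds, ?_⟩
  · rw [dAt_congr hc0, dAt_comp (h := σ.symm) (f := fun t : ℝ => σ p + t • dAt F F σ p v)
      (by
        rw [hx]
        exact (contMDiffAt_symm_of_mem_maximalAtlas hσ.mem
          (σ.map_source hp)).mdifferentiableAt (by simp))
      hl.differentiableAt.mdifferentiableAt, ContinuousLinearMap.comp_apply, dAt_eq_fderiv,
      ← deriv, hl.deriv, hx, dAt_symm_dAt hσ.mem hp]

end RiemannianCompleteness

namespace IsParallelNullSubmanifold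

variable {E : Type*} [NormedAddCommGroup E] [NormedSpace ℝ E] [FiniteDimensional ℝ E]
  {M : Type*} [TopologicalSpace M] [ChartedSpace E M] [IsManifold 𝓘(ℝ, E) ∞ M]
  {F : Type*} [NormedAddCommGroup F] [NormedSpace ℝ F] [FiniteDimensional ℝ F]
  {L : Type*} [TopologicalSpace L] [ChartedSpace F L] [IsManifold 𝓘(ℝ, F) ∞ L]
  {g : BilinField E M} {Z : VField E M} {i : L → M}
  (h : IsParallelNullSubmanifold (F := F) g Z i)
include h

lemma isPseudoMetric_rigged : IsPseudoMetric (riggedMetric (F := F) g Z i) where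
  smooth := isSmoothForm_of_coordMetric fun φ hφ x hx => by
    have h1 := h.contDiffAt_coordOneForm hφ hx
    refine contDiffAt_clm_of_apply fun u => contDiffAt_clm_of_apply fun v => ?_
    simp only [coordMetric_riggedMetric]
    exact (((h.contDiffAt_coordMetric_pullback hφ hx).clm_apply contDiffAt_const).clm_apply
      contDiffAt_const).add ((h1.clm_apply contDiffAt_const).mul (h1.clm_apply contDiffAt_const))
  symm := fun q u v => by
    change formAt g (i q) _ _ + _ * _ = formAt g (i q) _ _ + _ * _
    exact congrArg₂ (· + ·) (h.lorentz.symm _ _ _) (mul_comm _ _)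
  nondeg := fun q u hu => by
    by_contra h0
    exact (h.rigged_pos q h0).ne' (hu u)

end IsParallelNullSubmanifold

end

theorem mainTheorem4
    {M : Type*} [TopologicalSpace M] [T2Space M] [SecondCountableTopology M]
    [ChartedSpace (EuclideanSpace ℝ (Fin 3)) M] [IsManifold (𝓡 3) ∞ M]
    (g : BilinField (EuclideanSpace ℝ (Fin 3)) M) (hg : IsLorentzianMetric g)
    (ζ : VField (EuclideanSpace ℝ (Fin 3)) M)
    (hζ_timelike : IsTimelikeField g ζ) (hζ_killing : IsKillingField g ζ)
    (hζ_complete : IsCompleteField ζ)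
    (hchron : IsChronological g ζ)
    (hnull : IsNullComplete g) (hspace : IsSpacelikeComplete g)
    -- a plane containing the timelike vector `ζ p` is automatically timelike
    (hK : ∀ (p : M) (v : TangentSpace (𝓡 3) p), LinearIndependent ℝ ![ζ p, v] →
      0 ≤ sectionalCurvature g p (ζ p) v)
    {L : Type*} [TopologicalSpace L] [ConnectedSpace L]
    [ChartedSpace (EuclideanSpace ℝ (Fin 2)) L] [IsManifold (𝓡 2) ∞ L]
    (i : L → M) (hi : Manifold.IsSmoothEmbedding (𝓡 2) (𝓡 3) ∞ i) (hi_closed : IsClosed (range i))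
    (hL_null : IsNullImmersed (F := EuclideanSpace ℝ (Fin 2)) g i)
    (hL_geod : IsTotallyGeodesic (EuclideanSpace ℝ (Fin 2)) g i) :
    (∃ h : ContMDiffRiemannianMetric (𝓡 2) ∞ (EuclideanSpace ℝ (Fin 2))
        (fun q : L => TangentSpace (𝓡 2) q), 
          h.inner = riggedMetric (F := EuclideanSpace ℝ (Fin 2)) g ζ i) ∧
      IsGeodesicallyComplete
        (riggedMetric (F := EuclideanSpace ℝ (Fin 2)) g ζ i) ∧
      ∃ pr : EuclideanSpace ℝ (Fin 2) → L,
        IsMetricUniversalCovering (euclideanMetric 2)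
          (riggedMetric (F := EuclideanSpace ℝ (Fin 2)) g ζ i) pr := by
  have hpar := hζ_killing.isParallelField hg (by simp) hζ_timelike hnull hK
  have h : IsParallelNullSubmanifold (F := EuclideanSpace ℝ (Fin 2)) g ζ i :=
    ⟨hg, hζ_killing.1, hζ_timelike, hpar, hi, hL_null, hL_geod⟩
  have : T2Space L := hi.isEmbedding.t2Space
  have hflat := h.exists_isFlatChart
  have hh := h.isPseudoMetric_rigged
  have hlines : ∀ σ, IsFlatChart (riggedMetric (F := EuclideanSpace ℝ (Fin 2)) g ζ i) σ →
      ∀ q ∈ σ.source, ∀ b, ∃ c, IsFlatLine (riggedMetric (F := EuclideanSpace ℝ (Fin 2)) g ζ i) c ∧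
        ∀ᶠ t in 𝓝 (0 : ℝ), c t = σ.symm (σ q + t • b) := fun σ hσ q hq b =>
    -- Complete flat lines give both conclusions: they are the geodesics of the rigged metric, and
    -- they define the exponential covering.
    (h.exists_isFlatLine hi_closed hflat hnull hspace hσ hq b).imp fun c hc => ⟨hc.1, hc.2.2⟩
  exact ⟨exists_riemannianMetric hh.smooth hh.symm (fun q _ hv => h.rigged_pos q hv) hflat,
    isGeodesicallyComplete_of_lines hh hflat hlines, exists_isMetricUniversalCovering hflat hlines⟩
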